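/- **Setting.** Fix integers $m,n\ge 0$, $d\ge 1$. Let $\mathbb I=[-m-n..m+n]$, with parity $\hat i=0$ if $|i|\le m$ and $\hat i=1$ otherwise. Let $W=\{w\in\mathrm{Perm}[-d..d] : w(-i)=-w(i)\}$, the Weyl group of type $B_d$, with simple reflections $s_0=(-1,1)$, $s_i=(i,i+1)(-i,-i-1)$ for $1\le i<d$, and length function $\ell$. Let $\mathcal A=\mathbb Z[v,v^{-1}]$, $q=v^2$, and let $\mathcal H$ be the Hecke algebra of $W$ over $\mathcal A$: it is free over $\mathcal{A}$ with basis $T_w$ $(w\in W)$, with $T_wT_{w'}=T_{ww'}$ if $\ell(ww')=\ell(w)+\ell(w')$, and $(T_{s_i}+1)(T_{s_i}-q)=0$. Its bar involution is the ring automorphism with $\bar v=v^{-1}$, $\overline{T_w}=T_{w^{-1}}^{-1}$. For a weak composition $\lambda=(\lambda_0,\dots,\lambda_m|\lambda_{m+1},\dots,\lambda_{m+n})$ of $d$ put $\tilde\lambda_i=\lambda_0+\dots+\lambda_i$ and $R^\lambda_0=[-\lambda_0..\lambda_0]$, $R^\lambda_i=[\tilde\lambda_{i-1}+1..\tilde\lambda_i]$,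 $R^\lambda_{-i}=-R^\lambda_i$ for $1\le i\le m+n$. Let $W_\lambda$ be generated by all $s_k$ with $k\notin\{\tilde\lambda_0,\dots,\tilde\lambda_{m+n-1}\}$; its even part $W_{\lambda^{(0)}}$ (odd part $W_{\lambda^{(1)}}$) is generated by those of these $s_k$ with $k<\tilde\lambda_m$ (with $k>\tilde\lambda_m$), and $W_\lambda=W_{\lambda^{(0)}}\times W_{\lambda^{(1)}}$, $w=w^{(0)}w^{(1)}$. Put $$[xy]_\lambda=\sum_{w\in W_{\lambda^{(0)}}}T_w\cdot\sum_{w\in W_{\lambda^{(1)}}}(-q)^{-\ell(w)}T_w .$$ The $\imath$Schur superalgebra is $\mathcal S=\mathcal S^{\jmath}_{m|n,d}=\mathrm{End}_{\mathcal H}\big(\bigoplus_\lambda [xy]_\lambda\mathcal H\big)$ (endomorphisms of right $\mathcal H$-modules). **Standard elements.** Let $\Xi=\Xi_{m|n,d}$ be the set of matrices $A=(a_{ij})_{i,j\in\mathbb I}$ over $\mathbb N$ with $\sum a_{ij}=2d+1$, $a_{ij}=a_{-i,-j}$, and $a_{ij}\le 1$ whenever $\hat i\ne\hat j$. Each $A\in\Xi$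 is $(|R^\mu_i\cap gR^\nu_j|)_{i,j}$ for exactly one triple $(\mu,g,\nu)$ such that $g$ is the shortest element of $W_\mu gW_\nu$ and $g^{-1}W_{\mu^{(1)}}g\cap W_{\nu^{(0)}}=g^{-1}W_{\mu^{(0)}}g\cap W_{\nu^{(1)}}=\{1\}$. Let $e_A\in\mathcal S$ be the right $\mathcal H$-linear map with $$e_A([xy]_\nu)=[xy]_\mu T_g\sum_w(-q)^{-\ell(w^{(1)})}T_w\in[xy]_\mu\mathcal H,\qquad e_A([xy]_\lambda)=0\quad(\lambda\neq\nu),$$ where $w=w^{(0)}w^{(1)}$ runs over the elements of $W_\nu$ that are shortest in their coset $W_\delta w$, $W_\delta=g^{-1}W_\mu g\cap W_\nu$. Let $I_c=(\{0\}\times[0..m+n])\sqcup([1..m+n]\times\mathbb I)$, $a^\natural_{00}=(a_{00}-1)/2$ and $a^\natural_{ij}=a_{ij}$ for $(i,j)\neq(0,0)$, and $$\ell(A)=\tfrac12\sum_{(i,j)\in I_c}\Big(\sum_{k<i,\,l>j}+\sum_{k>i,\,l<j}\Big)a^\natural_{ij}a_{kl},\qquad \hat\ell(A)=\ell(A)+\tfrac12\sum_{(i,j)\in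 I_c}\sum_{l\ne j}(-1)^{\hat i}a^\natural_{ij}a_{il}.$$ Let $A^\circ$ have the entries $a_{ij}$ in the rows with $\hat i=1$, entry $1$ at $(0,0)$, and $0$ elsewhere. Define $\varphi_A=v^{-\hat\ell(A)}e_A$ and $[A]=(-1)^{\ell(A^\circ)}\varphi_A$. **Order and bar involution.** Let $\mathrm{row}(A)_0=\frac{a_{00}-1}2+\sum_{j>0}a_{0j}$ and $\mathrm{row}(A)_k=\sum_{j\in\mathbb I}a_{kj}$ for $1\le k\le m+n$, let $\mathrm{col}(A)$ be defined in the same way from the columns, and let $\sigma_{ij}(A)=\sum_{x\le i,\,y\ge j}a_{xy}$. Write $A\le_{\rm alg}B$ if $\mathrm{row}(A)=\mathrm{row}(B)$, $\mathrm{col}(A)=\mathrm{col}(B)$ and $\sigma_{ij}(A)\le\sigma_{ij}(B)$ for all $i<j$; write $A<_{\rm alg}B$ if moreover $A\ne B$. For $f\in\mathcal S$ let $\bar f\in\mathcal S$ be the map with $\bar f(\bar x)=\overline{f(x)}$ for all $x\in\bigoplus_\lambda[xy]_\lambda\mathcal H$, where the bar on $\bigoplus_\lambda[xy]_\lambda\mathcal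 H$ is that of $\mathcal H$ in each component. **Theorem.** The elements $e_A$ $(A\in\Xi)$ and $\bar f$ $(f\in\mathcal S)$ exist and are unique. There is a unique $\mathcal A$-basis $\{\{A\}\mid A\in\Xi\}$ of $\mathcal S$ with $$\overline{\{A\}}=\{A\}\in[A]+\sum_{B<_{\rm alg}A}v^{-1}\mathbb Z[v^{-1}]\,[B]\qquad(A\in\Xi),$$ and there is a unique $\mathcal A$-basis $\{\{A\}'\mid A\in\Xi\}$ of $\mathcal S$ with $$\overline{\{A\}'}=\{A\}'\in\varphi_A+\sum_{B<_{\rm alg}A}v^{-1}\mathbb Z[v^{-1}]\,\varphi_B\qquad(A\in\Xi).$$ (These are the canonical bases relative to $\{[A]\}$ and to $\{\varphi_A\}$.) -/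

import Mathlib

open scoped LaurentPolynomial DirectSum

noncomputable section

namespace IotaSchur

/-! ## The Weyl group of type `B_d` -/

/-- The integral interval `[-r..r]`. -/
abbrev SInt (r : ℕ) : Type := ↥(Finset.Icc (-(r : ℤ)) (r : ℤ))

instance instNegSInt (r : ℕ) : Neg (SInt r) :=
  ⟨fun x => ⟨-x.1, by have := Finset.mem_Icc.1 x.2; rw [Finset.mem_Icc]; omega⟩⟩

theorem coe_neg {r : ℕ} (x : SInt r) : (-x).1 = -x.1 := rfl

theorem sint_neg_neg {r : ℕ} (x : SInt r) : -(-x) = x := by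
  apply Subtype.ext; simp [coe_neg]

/-- The Weyl group `{w ∈ Perm [-d..d] | w (-i) = - w i}`. -/
def W (d : ℕ) : Subgroup (Equiv.Perm (SInt d)) where
  carrier := {w | ∀ i, w (-i) = -w i}
  one_mem' := fun _ => rfl
  mul_mem' := by
    intro a b ha hb i
    rw [Equiv.Perm.mul_apply, hb, ha, Equiv.Perm.mul_apply]
  inv_mem' := by
    intro a ha i
    apply a.injective
    rw [ha]
    simp

/-- The point `i` of `[-d..d]`, for `0 ≤ i < d`. -/
def pt {d : ℕ} (i : Fin d) : SInt d :=
  ⟨(i : ℤ), by rw [Finset.mem_Icc]; have := i.2; omega⟩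

/-- The point `i + 1` of `[-d..d]`, for `0 ≤ i < d`. -/
def ptSucc {d : ℕ} (i : Fin d) : SInt d :=
  ⟨(i : ℤ) + 1, by rw [Finset.mem_Icc]; have := i.2; omega⟩

/-- The underlying permutations of the simple reflections: `(-1, 1)` for `i = 0` and
`(i, i+1)(-i, -i-1)` for `1 ≤ i < d`. -/
def simplePerm {d : ℕ} (i : Fin d) : Equiv.Perm (SInt d) :=
  if i.1 = 0 then Equiv.swap (-ptSucc i) (ptSucc i)
  else Equiv.swap (pt i) (ptSucc i) * Equiv.swap (-pt i) (-ptSucc i)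

theorem simplePerm_zero_val {d : ℕ} (i : Fin d) (hi : i.1 = 0) (x : SInt d) :
    (simplePerm i x).1 = if x.1 = 1 then -1 else if x.1 = -1 then 1 else x.1 := by
  rw [simplePerm, if_pos hi, Equiv.swap_apply_def]
  simp only [Subtype.ext_iff]
  split_ifs <;> simp only [coe_neg, ptSucc] at * <;> omega

theorem simplePerm_pos_val {d : ℕ} (i : Fin d) (hi : i.1 ≠ 0) (x : SInt d) :
    (simplePerm i x).1 = if x.1 = i then (i : ℤ) + 1 else if x.1 = (i : ℤ) + 1 then (i : ℤ)
      else if x.1 = -(i : ℤ) then -(i : ℤ) - 1 else if x.1 = -(i : ℤ) - 1 then -(i : ℤ)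
      else x.1 := by
  rw [simplePerm, if_neg hi, Equiv.Perm.mul_apply, Equiv.swap_apply_def, Equiv.swap_apply_def]
  simp only [Subtype.ext_iff]
  split_ifs <;> simp only [coe_neg, ptSucc, pt] at * <;> omega

theorem simplePerm_mem {d : ℕ} (i : Fin d) : simplePerm i ∈ W d := by
  intro x
  apply Subtype.ext
  rw [coe_neg]
  by_cases hi : i.1 = 0
  · rw [simplePerm_zero_val i hi, simplePerm_zero_val i hi, coe_neg]
    split_ifs <;> omega
  · rw [simplePerm_pos_val i hi, simplePerm_pos_val i hi, coe_neg]
    split_ifs <;> omega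

/-- The simple reflections `s_0, …, s_{d-1}`. -/
def s {d : ℕ} (i : Fin d) : W d := ⟨simplePerm i, simplePerm_mem i⟩

/-- The length function: the minimal length of a word in the simple reflections. -/
def len {d : ℕ} (w : W d) : ℕ :=
  sInf {k | ∃ l : List (Fin d), l.length = k ∧ (l.map s).prod = w}

theorem s_mul_self {d : ℕ} (i : Fin d) : s i * s i = 1 := by
  apply Subtype.ext
  apply Equiv.ext
  intro x
  apply Subtype.ext
  change (simplePerm i (simplePerm i x)).1 = x.1
  by_cases hi : i.1 = 0
  · have h1 := simplePerm_zero_val i hi x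
    have h2 := simplePerm_zero_val i hi (simplePerm i x)
    split_ifs at h1 h2 <;> omega
  · have h1 := simplePerm_pos_val i hi x
    have h2 := simplePerm_pos_val i hi (simplePerm i x)
    split_ifs at h1 h2 <;> omega

theorem s_inv {d : ℕ} (i : Fin d) : (s i)⁻¹ = s i := by
  rw [inv_eq_iff_mul_eq_one, s_mul_self]

theorem s_val_sub {d : ℕ} (i : Fin d) (x : SInt d) : ((s i).1 x).1 - x.1 =
    if i.1 = 0 then (if x = ptSucc i then -2 else 0) + (if x = -ptSucc i then 2 else 0)
    else (if x = pt i then 1 else 0) + (if x = ptSucc i then -1 else 0)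
      + (if x = -pt i then -1 else 0) + (if x = -ptSucc i then 1 else 0) := by
  change (simplePerm i x).1 - x.1 = _
  by_cases hi : i.1 = 0
  · rw [simplePerm_zero_val i hi, if_pos hi]
    simp only [Subtype.ext_iff, coe_neg, ptSucc]
    split_ifs <;> omega
  · rw [simplePerm_pos_val i hi, if_neg hi]
    simp only [Subtype.ext_iff, coe_neg, ptSucc, pt]
    split_ifs <;> omega

theorem sum_mul_s {d : ℕ} (w : W d) (i : Fin d) :
    ∑ x, x.1 * ((w * s i).1 x).1 - ∑ x, x.1 * (w.1 x).1 =
      if i.1 = 0 then -4 * (w.1 (ptSucc i)).1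
      else 2 * ((w.1 (pt i)).1 - (w.1 (ptSucc i)).1) := by
  have h1 : ∑ x, x.1 * ((w * s i).1 x).1 = ∑ x, ((s i).1 x).1 * (w.1 x).1 := by
    rw [← Equiv.sum_comp (s i).1]
    apply Finset.sum_congr rfl
    intro x _
    have h2 : (s i).1 ((s i).1 x) = x := congrArg (fun u : W d => u.1 x) (s_mul_self i)
    change _ * (w.1 ((s i).1 ((s i).1 x))).1 = _
    rw [h2]
  rw [h1, ← Finset.sum_sub_distrib]
  simp only [← sub_mul, s_val_sub]
  have hn : ∀ x, (w.1 (-x)).1 = -(w.1 x).1 := fun x => by rw [w.2 x, coe_neg]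
  by_cases hi : i.1 = 0
  · simp only [if_pos hi, add_mul, ite_mul, zero_mul, Finset.sum_add_distrib,
      Finset.sum_ite_eq', Finset.mem_univ, if_true, hn]
    ring
  · simp only [if_neg hi, add_mul, ite_mul, zero_mul, Finset.sum_add_distrib,
      Finset.sum_ite_eq', Finset.mem_univ, if_true, hn]
    ring

theorem eq_one_of_no_descent {d : ℕ} (w : W d)
    (h : ∀ i : Fin d, ∑ x, x.1 * ((w * s i).1 x).1 ≤ ∑ x, x.1 * (w.1 x).1) : w = 1 := by
  have hn : ∀ x, (w.1 (-x)).1 = -(w.1 x).1 := fun x => by rw [w.2 x, coe_neg]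
  have h0 : ∀ x : SInt d, x.1 = 0 → (w.1 x).1 = 0 := by
    intro x hx
    have h1 : -x = x := by apply Subtype.ext; rw [coe_neg]; omega
    have := hn x
    rw [h1] at this
    omega
  have hstep : ∀ i : Fin d, (w.1 (pt i)).1 < (w.1 (ptSucc i)).1 := by
    intro i
    have h1 := h i
    have h2 := sum_mul_s w i
    have hne : (w.1 (pt i)).1 ≠ (w.1 (ptSucc i)).1 := by
      intro he
      have := w.1.injective (Subtype.ext he)
      simp [pt, ptSucc] at this
    split_ifs at h2 with hi
    · have h3 := h0 (pt i) (by simp [pt, hi])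
      omega
    · omega
  have hlow : ∀ k : ℕ, ∀ x : SInt d, x.1 = k → (k : ℤ) ≤ (w.1 x).1 := by
    intro k
    induction k with
    | zero => intro x hx; rw [h0 x (by simpa using hx)]; simp
    | succ k ih =>
      intro x hx
      have hk : k < d := by have := (Finset.mem_Icc.1 x.2).2; omega
      have h1 := ih (pt ⟨k, hk⟩) rfl
      have h2 := hstep ⟨k, hk⟩
      have h3 : x = ptSucc ⟨k, hk⟩ := by apply Subtype.ext; simp [ptSucc, hx]
      rw [h3]; push_cast; omega
  have hup : ∀ k : ℕ, ∀ x : SInt d, x.1 = (d : ℤ) - k → 0 ≤ x.1 → (w.1 x).1 ≤ x.1 := by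
    intro k
    induction k with
    | zero => intro x hx _; have := (Finset.mem_Icc.1 (w.1 x).2).2; simp at hx; omega
    | succ k ih =>
      intro x hx hx0
      have hk : x.1.toNat < d := by push_cast at hx; omega
      have h1 := ih (ptSucc ⟨x.1.toNat, hk⟩) (by simp [ptSucc]; omega) (by simp [ptSucc]; omega)
      have h2 := hstep ⟨x.1.toNat, hk⟩
      have h3 : x = pt ⟨x.1.toNat, hk⟩ := by apply Subtype.ext; simp [pt]; omega
      have h4 : (ptSucc ⟨x.1.toNat, hk⟩ : SInt d).1 = x.1 + 1 := by simp [ptSucc]; omega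
      rw [← h3] at h2
      omega
  have hpos : ∀ x : SInt d, 0 ≤ x.1 → (w.1 x).1 = x.1 := by
    intro x hx
    have h1 := hlow x.1.toNat x (by omega)
    have h2 := hup ((d : ℤ) - x.1).toNat x
      (by have := (Finset.mem_Icc.1 x.2).2; omega) hx
    omega
  apply Subtype.ext
  apply Equiv.ext
  intro x
  apply Subtype.ext
  change (w.1 x).1 = x.1
  by_cases hx : 0 ≤ x.1
  · exact hpos x hx
  · have h1 := hpos (-x) (by rw [coe_neg]; omega)
    rw [hn, coe_neg] at h1
    omega

theorem exists_word {d : ℕ} (w : W d) : ∃ l : List (Fin d), (l.map s).prod = w := by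
  by_contra hw
  let B : Set (W d) := {u | ¬ ∃ l : List (Fin d), (l.map s).prod = u}
  obtain ⟨u, hu, hmax⟩ := Set.exists_max_image B (fun u => ∑ x, x.1 * (u.1 x).1)
    (Set.toFinite B) ⟨w, hw⟩
  have h1 : u ≠ 1 := by
    rintro rfl
    exact hu ⟨[], rfl⟩
  apply h1
  apply eq_one_of_no_descent
  intro i
  apply hmax
  rintro ⟨l, hl⟩
  apply hu
  refine ⟨l ++ [i], ?_⟩
  rw [List.map_append, List.prod_append, hl]
  simp [mul_assoc, s_mul_self]

theorem len_spec {d : ℕ} (w : W d) :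
    ∃ l : List (Fin d), l.length = len w ∧ (l.map s).prod = w := by
  obtain ⟨l, hl⟩ := exists_word w
  exact Nat.sInf_mem (s := {k | ∃ l : List (Fin d), l.length = k ∧ (l.map s).prod = w})
    ⟨l.length, l, rfl, hl⟩

theorem len_le {d : ℕ} (l : List (Fin d)) : len (l.map s).prod ≤ l.length :=
  Nat.sInf_le ⟨l, rfl, rfl⟩

theorem len_mul_le {d : ℕ} (u w : W d) : len (u * w) ≤ len u + len w := by
  obtain ⟨l, hl, rfl⟩ := len_spec u
  obtain ⟨l', hl', rfl⟩ := len_spec w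
  rw [← hl, ← hl', ← List.length_append, ← List.prod_append, ← List.map_append]
  exact len_le _

theorem len_inv_le {d : ℕ} (w : W d) : len w⁻¹ ≤ len w := by
  obtain ⟨l, hl, hw⟩ := len_spec w
  have h : w⁻¹ = (l.reverse.map s).prod := by
    rw [← hw, List.prod_inv_reverse, List.map_map, List.map_reverse]
    congr 2
    apply List.map_congr_left
    intro i _
    exact s_inv i
  rw [h, ← hl, ← List.length_reverse]
  exact len_le _

theorem len_inv {d : ℕ} (w : W d) : len w⁻¹ = len w :=
  le_antisymm (len_inv_le w) (by simpa using len_inv_le w⁻¹)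

theorem exists_left_factor {d : ℕ} (w : W d) (hw : w ≠ 1) :
    ∃ (i : Fin d) (u : W d), w = s i * u ∧ len w = len (s i) + len u ∧ len u < len w := by
  obtain ⟨l, hl, hlw⟩ := len_spec w
  cases l with
  | nil => exact absurd hlw.symm hw
  | cons i l =>
    rw [List.map_cons, List.prod_cons] at hlw
    rw [List.length_cons] at hl
    have h1 : len (l.map s).prod ≤ l.length := len_le l
    have h2 : len (s i) ≤ 1 := by simpa using len_le [i]
    have h3 := len_mul_le (s i) (l.map s).prod
    rw [hlw] at h3
    exact ⟨i, (l.map s).prod, hlw.symm, by omega, by omega⟩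

/-! ## The Hecke algebra over `ℤ[v, v⁻¹]` -/

/-- The ring `𝒜 = ℤ[v, v⁻¹]`. -/
abbrev A : Type := ℤ[T;T⁻¹]

/-- The power `v ^ k`. -/
def vpow (k : ℤ) : A := LaurentPolynomial.T k

/-- `q = v²`. -/
def q : A := vpow 2

/-- `q⁻¹ = v⁻²`. -/
def qInv : A := vpow (-2)

theorem q_mul_qInv : q * qInv = 1 := by
  rw [q, qInv, vpow, vpow, ← LaurentPolynomial.T_add]; simp

/-- `(-q)^{-k}`. -/
def negqInvPow (k : ℕ) : A := (-qInv) ^ k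

/-- The bar involution of `𝒜`, `v ↦ v⁻¹`. -/
def barA : A →+* A := (LaurentPolynomial.invert (R := ℤ)).toRingEquiv.toRingHom

/-- The subset `v⁻¹ ℤ[v⁻¹]` of `𝒜`. -/
def negPart : Set A := {p | ∀ k : ℤ, 0 ≤ k → p.coeff k = 0}

/-- The defining relations of the Hecke algebra on generators `T_w`, `w ∈ W`. -/
inductive HRel (d : ℕ) : FreeAlgebra A (W d) → FreeAlgebra A (W d) → Prop
  | one : HRel d (FreeAlgebra.ι A 1) 1
  | mul (w w' : W d) (h : len (w * w') = len w + len w') :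
      HRel d (FreeAlgebra.ι A w * FreeAlgebra.ι A w') (FreeAlgebra.ι A (w * w'))
  | quad (i : Fin d) :
      HRel d ((FreeAlgebra.ι A (s i) + 1) * (FreeAlgebra.ι A (s i) - algebraMap A _ q)) 0

/-- The Hecke algebra of type `B_d` over `𝒜`: generators `T_w` for `w ∈ W`, relations `T_1 = 1`,
`T_w T_{w'} = T_{ww'}` if `ℓ(ww') = ℓ(w) + ℓ(w')`, and `(T_{s_i} + 1)(T_{s_i} - q) = 0`. -/
def H (d : ℕ) : Type := RingQuot (HRel d)

instance instRingH (d : ℕ) : Ring (H d) := inferInstanceAs (Ring (RingQuot (HRel d)))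

instance instAlgebraH (d : ℕ) : Algebra A (H d) :=
  inferInstanceAs (Algebra A (RingQuot (HRel d)))

/-- The element `T_w` of the Hecke algebra. -/
def Tw {d : ℕ} (w : W d) : H d := RingQuot.mkAlgHom A (HRel d) (FreeAlgebra.ι A w)

theorem Tw_one {d : ℕ} : Tw (1 : W d) = 1 := by
  rw [Tw, RingQuot.mkAlgHom_rel A HRel.one, map_one]; rfl

theorem Tw_mul {d : ℕ} (w w' : W d) (h : len (w * w') = len w + len w') :
    Tw w * Tw w' = Tw (w * w') := by
  have := RingQuot.mkAlgHom_rel A (HRel.mul w w' h)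
  rw [map_mul] at this
  exact this

theorem Tw_quad {d : ℕ} (i : Fin d) :
    (Tw (s i) + 1) * (Tw (s i) - algebraMap A (H d) q) = 0 := by
  have := RingQuot.mkAlgHom_rel A (HRel.quad i)
  rw [map_mul, map_add, map_sub, map_one, map_zero, AlgHom.commutes] at this
  exact this

theorem algebraMap_q_mul {d : ℕ} : algebraMap A (H d) q * algebraMap A (H d) qInv = 1 := by
  rw [← map_mul, q_mul_qInv, map_one]

theorem isUnit_Tw_s {d : ℕ} (i : Fin d) : IsUnit (Tw (s i)) := by
  have h := Tw_quad i
  have hc : Commute (algebraMap A (H d) q) (Tw (s i)) := Algebra.commutes _ _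
  have hc' : Commute (algebraMap A (H d) qInv) (Tw (s i)) := Algebra.commutes _ _
  have h1 : Tw (s i) * (Tw (s i) - algebraMap A (H d) q + 1) = algebraMap A (H d) q := by
    have : (Tw (s i) + 1) * (Tw (s i) - algebraMap A (H d) q)
        = Tw (s i) * (Tw (s i) - algebraMap A (H d) q + 1) - algebraMap A (H d) q := by
      noncomm_ring
    rw [h] at this
    exact (sub_eq_zero.1 this.symm)
  have h2 : Tw (s i) * ((Tw (s i) - algebraMap A (H d) q + 1) * algebraMap A (H d) qInv) = 1 := by
    rw [← mul_assoc, h1, algebraMap_q_mul]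
  have hcc : Commute (Tw (s i))
      ((Tw (s i) - algebraMap A (H d) q + 1) * algebraMap A (H d) qInv) :=
    ((((Commute.refl _).sub_right hc.symm).add_right (Commute.one_right _)).mul_right hc'.symm)
  exact ⟨⟨_, _, h2, by rw [← hcc.eq]; exact h2⟩, rfl⟩

theorem isUnit_Tw {d : ℕ} (w : W d) : IsUnit (Tw w) := by
  induction hk : len w using Nat.strong_induction_on generalizing w with
  | _ k ih =>
    by_cases hw : w = 1
    · rw [hw, Tw_one]; exact isUnit_one
    · obtain ⟨i, u, h1, h2, h3⟩ := exists_left_factor w hw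
      rw [h1, ← Tw_mul _ _ (by rw [← h1]; exact h2)]
      exact (isUnit_Tw_s i).mul (ih _ (hk ▸ h3) u rfl)

/-- `T_w⁻¹`. -/
def TwInv {d : ℕ} (w : W d) : H d := ((isUnit_Tw w).unit⁻¹ : (H d)ˣ)

theorem Tw_mul_TwInv {d : ℕ} (w : W d) : Tw w * TwInv w = 1 := (isUnit_Tw w).mul_val_inv

theorem TwInv_mul_Tw {d : ℕ} (w : W d) : TwInv w * Tw w = 1 := (isUnit_Tw w).val_inv_mul

/-- The ring `H` with `v` acting as `v⁻¹`. -/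
def HBar (d : ℕ) : Type := H d

instance instRingHBar (d : ℕ) : Ring (HBar d) := instRingH d

instance instAlgebraHBar (d : ℕ) : Algebra A (HBar d) :=
  RingHom.toAlgebra' ((algebraMap A (H d)).comp barA)
    (fun c x => (instAlgebraH d).commutes' (barA c) x)

/-- The element `T_{w⁻¹}⁻¹`, the bar conjugate of `T_w`. -/
def TwBar {d : ℕ} (w : W d) : HBar d := TwInv w⁻¹

theorem barRel {d : ℕ} ⦃x y : FreeAlgebra A (W d)⦄ (h : HRel d x y) :
    FreeAlgebra.lift A (TwBar (d := d)) x
      = FreeAlgebra.lift A (TwBar (d := d)) y := by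
  have hinv : ∀ (w : W d) (x : H d), Tw w⁻¹ * x = 1 → TwInv w⁻¹ = x := by
    intro w x hx
    calc TwInv w⁻¹ = TwInv w⁻¹ * (Tw w⁻¹ * x) := by rw [hx, mul_one]
      _ = x := by rw [← mul_assoc, TwInv_mul_Tw, one_mul]
  cases h with
  | one =>
    rw [FreeAlgebra.lift_ι_apply, map_one]
    exact hinv 1 (1 : H d) (by rw [inv_one, Tw_one, one_mul])
  | mul w w' h =>
    rw [map_mul]
    simp only [FreeAlgebra.lift_ι_apply]
    have h1 : Tw w'⁻¹ * Tw w⁻¹ = Tw (w * w')⁻¹ := by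
      rw [mul_inv_rev]
      apply Tw_mul
      rw [← mul_inv_rev, len_inv, len_inv, len_inv, h, add_comm]
    symm
    apply hinv (w * w')
    rw [← h1]
    change Tw w'⁻¹ * Tw w⁻¹ * (TwInv w⁻¹ * TwInv w'⁻¹) = 1
    rw [mul_assoc, ← mul_assoc (Tw w⁻¹), Tw_mul_TwInv, one_mul, Tw_mul_TwInv]
  | quad i =>
    rw [map_mul, map_add, map_sub, map_one, map_zero, AlgHom.commutes]
    simp only [FreeAlgebra.lift_ι_apply]
    have hq : barA q = qInv := by
      simp [barA, q, qInv, vpow]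
    change (TwInv (s i)⁻¹ + 1) * (TwInv (s i)⁻¹ - algebraMap A (H d) (barA q)) = 0
    rw [hq, s_inv]
    have hc' : Commute (algebraMap A (H d) qInv) (Tw (s i)) := Algebra.commutes _ _
    have e1 : (TwInv (s i) + 1) = TwInv (s i) * (Tw (s i) + 1) := by
      rw [mul_add, TwInv_mul_Tw, mul_one, add_comm]
    have e2 : TwInv (s i) - algebraMap A (H d) qInv
        = (Tw (s i) - algebraMap A (H d) q) * -(algebraMap A (H d) qInv * TwInv (s i)) := by
      rw [sub_mul, mul_neg, mul_neg, ← mul_assoc, ← mul_assoc, algebraMap_q_mul, one_mul,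
        ← hc'.eq, mul_assoc, Tw_mul_TwInv, mul_one]
      abel
    rw [e1, e2, mul_assoc, ← mul_assoc (Tw (s i) + 1), Tw_quad, zero_mul, mul_zero]

/-- The bar involution of the Hecke algebra: `v ↦ v⁻¹`, `T_w ↦ T_{w⁻¹}⁻¹`. -/
def barH (d : ℕ) : H d →+* H d :=
  (RingQuot.liftAlgHom A (s := HRel d)
    ⟨FreeAlgebra.lift A (TwBar (d := d)), barRel⟩ : _ →ₐ[A] HBar d).toRingHom

/-! ## Compositions, parabolic subgroups and double cosets -/

instance instFintypeW (d : ℕ) : Fintype (W d) := Fintype.ofFinite _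

instance instZeroSInt (r : ℕ) : Zero (SInt r) :=
  ⟨⟨0, by rw [Finset.mem_Icc]; omega⟩⟩

/-- The parity of an index `i ∈ [-m-n..m+n]`: `0` if `|i| ≤ m` and `1` otherwise. -/
def par {m n : ℕ} (i : SInt (m + n)) : ℕ := if i.1.natAbs ≤ m then 0 else 1

/-- Weak compositions `(λ_0, …, λ_m | λ_{m+1}, …, λ_{m+n})` of `d`. -/
abbrev Comp (m n d : ℕ) : Type := {lam : Fin (m + n + 1) → ℕ // ∑ i, lam i = d}

/-- The partial sum `λ_0 + ⋯ + λ_k`. -/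
def psum {m n d : ℕ} (lam : Comp m n d) (k : ℕ) : ℕ :=
  ∑ j, if j.1 ≤ k then lam.1 j else 0

/-- The integral interval `R_i^λ`. -/
def block {m n d : ℕ} (lam : Comp m n d) (i : SInt (m + n)) : Finset (SInt d) :=
  if i.1 = 0 then Finset.univ.filter fun x => -(psum lam 0 : ℤ) ≤ x.1 ∧ x.1 ≤ psum lam 0
  else if 0 < i.1 then Finset.univ.filter fun x =>
    (psum lam (i.1.natAbs - 1) : ℤ) < x.1 ∧ x.1 ≤ psum lam i.1.natAbs
  else Finset.univ.filter fun x =>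
    (psum lam (i.1.natAbs - 1) : ℤ) < -x.1 ∧ -x.1 ≤ psum lam i.1.natAbs

/-- The simple reflection `s_i` is a generator of `W_λ`, i.e. `i` is none of the partial sums
of `λ` with index in `[0..m+n-1]`. -/
def IsGen {m n d : ℕ} (lam : Comp m n d) (i : Fin d) : Prop :=
  ∀ k, k < m + n → i.1 ≠ psum lam k

/-- The parabolic subgroup `W_λ`. -/
def WP {m n d : ℕ} (lam : Comp m n d) : Subgroup (W d) :=
  Subgroup.closure {w | ∃ i, IsGen lam i ∧ w = s i}

/-- The even part of `W_λ`. -/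
def WEven {m n d : ℕ} (lam : Comp m n d) : Subgroup (W d) :=
  Subgroup.closure {w | ∃ i, IsGen lam i ∧ i.1 < psum lam m ∧ w = s i}

/-- The odd part of `W_λ`. -/
def WOdd {m n d : ℕ} (lam : Comp m n d) : Subgroup (W d) :=
  Subgroup.closure {w | ∃ i, IsGen lam i ∧ psum lam m < i.1 ∧ w = s i}

/-- `g` is of minimal length in its double coset `W_λ g W_μ`. -/
def IsShortest {m n d : ℕ} (lam : Comp m n d) (g : W d) (mu : Comp m n d) : Prop :=
  ∀ x ∈ WP lam, ∀ y ∈ WP mu, len g ≤ len (x * g * y)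

/-- The even-odd trivial intersection property
`g⁻¹ W_{λ^(1)} g ∩ W_{μ^(0)} = g⁻¹ W_{λ^(0)} g ∩ W_{μ^(1)} = {1}`. -/
def EvenOddTrivial {m n d : ℕ} (lam : Comp m n d) (g : W d) (mu : Comp m n d) : Prop :=
  (∀ x ∈ WOdd lam, g⁻¹ * x * g ∈ WEven mu → g⁻¹ * x * g = 1) ∧
  (∀ x ∈ WEven lam, g⁻¹ * x * g ∈ WOdd mu → g⁻¹ * x * g = 1)

/-- Matrices of natural numbers with rows and columns indexed by `[-m-n..m+n]`. -/
abbrev Mat (m n : ℕ) : Type := SInt (m + n) → SInt (m + n) → ℕ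

/-- The matrix `κ(λ, g, μ) = (|R_i^λ ∩ g R_j^μ|)`. -/
def kap {m n d : ℕ} (lam : Comp m n d) (g : W d) (mu : Comp m n d) : Mat m n :=
  fun i j => (block lam i ∩ (block mu j).image g.1).card

/-- The index set `Ξ_{m|n,d}`. -/
abbrev Xi (m n d : ℕ) : Type :=
  {M : Mat m n // ∑ i, ∑ j, M i j = 2 * d + 1 ∧ (∀ i j, M i j = M (-i) (-j)) ∧
    ∀ i j, par i ≠ par j → M i j ≤ 1}

theorem finite_Xi (m n d : ℕ) : Finite (Xi m n d) := by
  have h : ∀ (M : Xi m n d) i j, M.1 i j < 2 * d + 2 := by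
    intro M i j
    have h1 : M.1 i j ≤ ∑ j, M.1 i j :=
      Finset.single_le_sum (f := fun j => M.1 i j) (fun _ _ => Nat.zero_le _) (Finset.mem_univ j)
    have h2 : ∑ j, M.1 i j ≤ ∑ i, ∑ j, M.1 i j :=
      Finset.single_le_sum (f := fun i => ∑ j, M.1 i j) (fun _ _ => Nat.zero_le _)
        (Finset.mem_univ i)
    have h3 := M.2.1
    omega
  exact Finite.of_injective
    (fun (M : Xi m n d) => fun i j => (⟨M.1 i j, h M i j⟩ : Fin (2 * d + 2)))
    (fun M N hMN => Subtype.ext (funext fun i => funext fun j =>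
      congrArg Fin.val (congrFun (congrFun hMN i) j)))

instance instFintypeXi (m n d : ℕ) : Fintype (Xi m n d) :=
  haveI := finite_Xi m n d
  Fintype.ofFinite _

/-- The index in `[-m-n..m+n]` of `k ∈ [0..m+n]`. -/
def idx {m n : ℕ} (k : Fin (m + n + 1)) : SInt (m + n) :=
  ⟨(k : ℤ), by rw [Finset.mem_Icc]; have := k.2; omega⟩

/-- The entries `a_{ij}^♮`: `(a_{00} - 1) / 2` for `(i, j) = (0, 0)`, and `a_{ij}` otherwise. -/
def nat {m n : ℕ} (M : Mat m n) (i j : SInt (m + n)) : ℕ :=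
  if i = 0 ∧ j = 0 then (M 0 0 - 1) / 2 else M i j

/-- The row vector `row(A)`. -/
def row {m n : ℕ} (M : Mat m n) (k : Fin (m + n + 1)) : ℕ :=
  if k = 0 then nat M 0 0 + ∑ j with 0 < j.1, M 0 j else ∑ j, M (idx k) j

/-- The column vector `col(A)`. -/
def col {m n : ℕ} (M : Mat m n) (k : Fin (m + n + 1)) : ℕ :=
  if k = 0 then nat M 0 0 + ∑ i with 0 < i.1, M i 0 else ∑ i, M i (idx k)

/-- `σ_{ij}(A) = ∑_{x ≤ i, y ≥ j} a_{xy}`. -/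
def sigma {m n : ℕ} (M : Mat m n) (i j : SInt (m + n)) : ℕ :=
  ∑ x with x ≤ i, ∑ y with j ≤ y, M x y

/-- The partial order `≤_alg`. -/
def algLE {m n d : ℕ} (M N : Xi m n d) : Prop :=
  row M.1 = row N.1 ∧ col M.1 = col N.1 ∧ ∀ i j, i < j → sigma M.1 i j ≤ sigma N.1 i j

/-- The strict order `<_alg`. -/
def algLT {m n d : ℕ} (M N : Xi m n d) : Prop := algLE M N ∧ M ≠ N

/-! ## The iota Schur superalgebra -/

open Classical in
/-- `x_{λ^(0)} = ∑_{w ∈ W_{λ^(0)}} T_w`. -/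
def xEven {m n d : ℕ} (lam : Comp m n d) : H d := ∑ w with w ∈ WEven lam, Tw w

open Classical in
/-- `y_{λ^(1)} = ∑_{w ∈ W_{λ^(1)}} (-q)^{-ℓ(w)} T_w`. -/
def yOdd {m n d : ℕ} (lam : Comp m n d) : H d :=
  ∑ w with w ∈ WOdd lam, negqInvPow (len w) • Tw w

/-- `[xy]_λ = x_{λ^(0)} y_{λ^(1)}`. -/
def xy {m n d : ℕ} (lam : Comp m n d) : H d := xEven lam * yOdd lam

/-- The right ideal `[xy]_λ H`. -/
abbrev xyH {m n d : ℕ} (lam : Comp m n d) : Submodule (H d)ᵐᵒᵖ (H d) :=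
  Submodule.span (H d)ᵐᵒᵖ {xy lam}

/-- The generator `[xy]_λ` of the right ideal `[xy]_λ H`. -/
def xyGen {m n d : ℕ} (lam : Comp m n d) : xyH lam :=
  ⟨xy lam, Submodule.subset_span rfl⟩

/-- The right `H`-module `⨁_λ [xy]_λ H`. -/
abbrev Perm (m n d : ℕ) : Type := ⨁ lam : Comp m n d, xyH lam

/-- The iota Schur superalgebra: the endomorphism algebra of the right `H`-module
`⨁_λ [xy]_λ H`, the multiplication being composition. -/
abbrev Schur (m n d : ℕ) : Type := Module.End (H d)ᵐᵒᵖ (Perm m n d)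

/-- The element `[xy]_λ` of the summand `[xy]_λ H` of `⨁_λ [xy]_λ H`. -/
def gen {m n d : ℕ} (lam : Comp m n d) : Perm m n d :=
  DirectSum.lof (H d)ᵐᵒᵖ (Comp m n d) (fun lam => xyH lam) lam (xyGen lam)

/-- `w` is the shortest representative of its coset `W_δ w`, where `W_δ = g⁻¹ W_μ g ∩ W_ν`. -/
def IsShortestDelta {m n d : ℕ} (mu : Comp m n d) (g : W d) (nu : Comp m n d) (w : W d) : Prop :=
  ∀ x ∈ WP nu, g * x * g⁻¹ ∈ WP mu → len w ≤ len (x * w)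

open Classical in
/-- `T_{W_μ g W_ν} = [xy]_μ T_g ∑_w (-q)^{-ℓ(w^(1))} T_w`, where `w = w^(0) w^(1) ∈ W_ν` runs over the
shortest representatives of the cosets of `W_δ = g⁻¹ W_μ g ∩ W_ν` in `W_ν`. -/
def TDouble {m n d : ℕ} (mu : Comp m n d) (g : W d) (nu : Comp m n d) : H d :=
  xy mu * Tw g * ∑ u with u ∈ WEven nu, ∑ w with w ∈ WOdd nu,
    if IsShortestDelta mu g nu (u * w) then negqInvPow (len w) • Tw (u * w) else 0

open Classical in
/-- `f` is the element `e_A` of the iota Schur superalgebra: writing `A = κ(μ, g, ν)` with `g` a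
shortest double coset representative having the even-odd trivial intersection property, `f` is the
`H`-linear map that sends `[xy]_ν` to `T_{W_μ g W_ν} ∈ [xy]_μ H` and kills the other `[xy]_λ`. -/
def IsE {m n d : ℕ} (M : Xi m n d) (f : Schur m n d) : Prop :=
  ∃ (mu : Comp m n d) (g : W d) (nu : Comp m n d),
    IsShortest mu g nu ∧ EvenOddTrivial mu g nu ∧ kap mu g nu = M.1 ∧
    ∀ lam rho : Comp m n d,
      ((f (gen lam)) rho : H d) = if lam = nu ∧ rho = mu then TDouble mu g nu else 0

/-- The element `e_A`. -/
def eElt {m n d : ℕ} (M : Xi m n d) : Schur m n d := Classical.epsilon (IsE M)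

/-- The set `I_c = ({0} × [0..m+n]) ⊔ ([1..m+n] × [-m-n..m+n])`. -/
def InIc {m n : ℕ} (i j : SInt (m + n)) : Prop := (i.1 = 0 ∧ 0 ≤ j.1) ∨ 0 < i.1

open Classical in
/-- `ℓ(A)`; the sum that is halved is even. -/
def ell {m n : ℕ} (M : Mat m n) : ℕ :=
  (∑ i, ∑ j, ∑ k, ∑ l, if InIc i j ∧ ((k < i ∧ j < l) ∨ (i < k ∧ l < j))
    then nat M i j * M k l else 0) / 2

open Classical in
/-- `ℓ°(A)`; the sum that is halved is even. -/
def ellCirc {m n : ℕ} (M : Mat m n) : ℤ :=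
  (∑ i, ∑ j, ∑ l, if InIc i j ∧ l ≠ j
    then (-1 : ℤ) ^ par i * ((nat M i j : ℤ) * (M i l : ℤ)) else 0) / 2

/-- `ℓ^(A) = ℓ(A) + ℓ°(A)`. -/
def ellHat {m n : ℕ} (M : Mat m n) : ℤ := (ell M : ℤ) + ellCirc M

/-- The matrix `A°`: the odd rows of `A`, with central entry `1` and all other entries `0`. -/
def circ {m n : ℕ} (M : Mat m n) : Mat m n := fun i j =>
  if par i = 1 then M i j else if i = 0 ∧ j = 0 then 1 else 0

/-- The standard basis element `φ_A = v^{-ℓ^(A)} e_A`. -/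
def phiElt {m n d : ℕ} (M : Xi m n d) : Schur m n d := vpow (-ellHat M.1) • eElt M

/-- The standard basis element `[A] = (-1)^{ℓ(A°)} φ_A`. -/
def bracket {m n d : ℕ} (M : Xi m n d) : Schur m n d := ((-1 : A) ^ ell (circ M.1)) • phiElt M

/-- `g` is the bar conjugate of `f`: `g` sends the (componentwise) bar conjugate of every
`x ∈ ⨁_λ [xy]_λ H` to the bar conjugate of `f x`. -/
def IsBarOf {m n d : ℕ} (f g : Schur m n d) : Prop :=
  ∀ x y : Perm m n d, (∀ lam, ((y lam : xyH lam) : H d) = barH d (x lam : H d)) →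
    ∀ lam, ((g y) lam : H d) = barH d ((f x) lam : H d)

/-- The bar involution of the iota Schur superalgebra. -/
def barS {m n d : ℕ} (f : Schur m n d) : Schur m n d := Classical.epsilon (IsBarOf f)

open Classical in
/-- The basis `b` is bar invariant and `b_A ∈ a_A + ∑_{B <_alg A} v⁻¹ℤ[v⁻¹] a_B` for all `A`. -/
def IsCanonical {m n d : ℕ} (a : Xi m n d → Schur m n d)
    (b : Module.Basis (Xi m n d) A (Schur m n d)) : Prop :=
  ∀ M, barS (b M) = b M ∧
    ∃ c : Xi m n d → A, (∀ N, c N ∈ negPart) ∧ b M = a M + ∑ N with algLT N M, c N • a N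

end IotaSchur

end

open scoped LaurentPolynomial DirectSum

noncomputable section

namespace IotaSchur

/-! ## Inversions, lengths and descents -/

section Length

variable {d : ℕ}

/-! Everything is reduced to eigenvectors. On either side of $[xy]_\lambda$, the generator $T_{s_i}$
of the parabolic subalgebra acts by the scalar `eps`, which is $q$ on even and $-1$ on odd
generators. The right ideal $[xy]_\mu\mathcal H$ is the space of all left eigenvectors for $W_\mu$
(`mem_xyH_iff`). A right eigenvector for $W_\nu$ has the form $y[xy]_\nu$, so it defines a
homomorphism by left multiplication with $y$. Hence an element of $\mathcal S$ is the same as a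
matrix of two-sided eigenvectors (`exists_schur`, `schur_ext`).

A two-sided eigenvector is determined by its coefficients at minimal double coset representatives
$g$ (`eig_eq_zero`). The coefficient at $g$ is forced to vanish if the characters of $W_\mu$ and
$W_\nu$ disagree on $W_\delta$, since $1+q^{-1}\ne 0$ in a domain. If they agree (`Compat`), the
element `dbl` has coefficient 1 at $g$ and 0 at the other minimal representatives. Agreement is
equivalent to the even-odd trivial intersection property, and also to $a_{ij}\le 1$ in the cells of
mixed parity. So the $e_A$ form a basis, and the coordinate at $e_A$ is one Hecke coefficient
(`coord`).

The bar involution multiplies $[xy]_\lambda$ by a power of $v$ (`barH_Z`), so the bar conjugate of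
$f$ is obtained by conjugating its entries and rescaling. A nonzero multiple $P\cdot$`dbl` equals
$[xy]_\mu T_g[xy]_\nu$, which makes $\overline{e_A}$ computable from $\overline{T_g}$. The latter is
supported on elements whose rank function is at most that of $g$ (`rankLE_of_coef_ne_zero`), and
rank functions become the $\sigma_{ij}$ of the matrices. Therefore $\overline{e_A}$ involves only
$e_B$ with $B\le_{\rm alg}A$. The diagonal coefficient is $v^{-2\hat\ell(A)}$, because $\ell(A)$ is
the length of $g$ and the remaining part of $\hat\ell(A)$ compares the bar scalars of $W_\mu$ and
$W_\delta$ (`ell_eq`, `ellCirc_eq`).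

After the normalisation by $v^{-\hat\ell(A)}$ the bar involution is unitriangular, and a sign $\pm1$
in front of each basis element does not affect this. The usual argument of Kazhdan–Lusztig type over
a finite poset (`existsUnique_canonical`) then gives both canonical bases. -/

theorem coe_zero {r : ℕ} : (0 : SInt r).1 = 0 := rfl

theorem sint_neg_zero {r : ℕ} : -(0 : SInt r) = 0 := Subtype.ext (by rw [coe_neg, coe_zero]; rfl)

theorem sint_neg_inj {r : ℕ} {x y : SInt r} : -x = -y ↔ x = y := by
  simp only [Subtype.ext_iff, coe_neg]; omega

theorem sint_neg_lt {r : ℕ} {x y : SInt r} : -x < -y ↔ y < x := by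
  simp only [← Subtype.coe_lt_coe, coe_neg]; omega

/-- Negation as a permutation of `[-r..r]`. -/
def negEquiv (r : ℕ) : Equiv.Perm (SInt r) := ⟨fun x => -x, fun x => -x, sint_neg_neg, sint_neg_neg⟩

theorem negEquiv_apply {r : ℕ} (x : SInt r) : negEquiv r x = -x := rfl

theorem W_neg (w : W d) (x : SInt d) : w.1 (-x) = -w.1 x := w.2 x

theorem W_zero (w : W d) : w.1 0 = 0 := by
  have h := W_neg w 0
  rw [sint_neg_zero] at h
  have := congrArg Subtype.val h
  rw [coe_neg] at this
  exact Subtype.ext (by rw [coe_zero]; omega)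

theorem W_mul_apply (u w : W d) (x : SInt d) : (u * w).1 x = u.1 (w.1 x) := rfl

theorem W_inv_apply_self (w : W d) (x : SInt d) : (w⁻¹).1 (w.1 x) = x :=
  Equiv.symm_apply_apply w.1 x

theorem W_apply_inv_self (w : W d) (x : SInt d) : w.1 ((w⁻¹).1 x) = x :=
  Equiv.apply_symm_apply w.1 x

theorem W_ext {u w : W d} (h : ∀ x, u.1 x = w.1 x) : u = w := Subtype.ext (Equiv.ext h)

theorem W_inj (w : W d) {x y : SInt d} : w.1 x = w.1 y ↔ x = y := w.1.injective.eq_iff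

theorem pt_lt_ptSucc (i : Fin d) : pt i < ptSucc i := by
  rw [← Subtype.coe_lt_coe]; simp [pt, ptSucc]

theorem coe_pt (i : Fin d) : (pt i).1 = i.1 := rfl

theorem coe_ptSucc (i : Fin d) : (ptSucc i).1 = i.1 + 1 := rfl

theorem s_val (i : Fin d) (x : SInt d) : ((s i).1 x).1 =
    if x.1 = i then (if i.1 = 0 then 0 else (i : ℤ) + 1)
    else if x.1 = (i : ℤ) + 1 then (if i.1 = 0 then -1 else (i : ℤ))
      else if x.1 = -(i : ℤ) then -(i : ℤ) - 1
      else if x.1 = -(i : ℤ) - 1 then (if i.1 = 0 then 1 else -(i : ℤ))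
      else x.1 := by
  change (simplePerm i x).1 = _
  by_cases hi : i.1 = 0
  · rw [simplePerm_zero_val i hi]
    split_ifs <;> omega
  · rw [simplePerm_pos_val i hi]
    split_ifs <;> omega

theorem s_s_apply (i : Fin d) (x : SInt d) : (s i).1 ((s i).1 x) = x :=
  congrArg (fun u : W d => u.1 x) (s_mul_self i)

theorem mul_s_mul_s (w : W d) (i : Fin d) : w * s i * s i = w := by
  rw [mul_assoc, s_mul_self, mul_one]

theorem s_mul_s_mul (i : Fin d) (w : W d) : s i * (s i * w) = w := by
  rw [← mul_assoc, s_mul_self, one_mul]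

/-- Among pairs of non-opposite points, `s i` reverses the order only of its own pair of neighbours
and of the negative of that pair. Opposite points are excluded because `s_0` also swaps $-1$ and
$1$. -/
theorem s_lt_s_iff (i : Fin d) (x y : SInt d) (hneg : x ≠ -y) :
    (s i).1 x < (s i).1 y ↔
      (x < y ∧ ¬(x = pt i ∧ y = ptSucc i) ∧ ¬(x = -ptSucc i ∧ y = -pt i)) ∨
        (x = ptSucc i ∧ y = pt i) ∨ (x = -pt i ∧ y = -ptSucc i) := by
  have hx := s_val i x
  have hy := s_val i y
  rw [ne_eq, Subtype.ext_iff] at hneg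
  rw [coe_neg] at hneg
  simp only [← Subtype.coe_lt_coe, Subtype.ext_iff, coe_neg, coe_pt, coe_ptSucc]
  generalize ((s i).1 x).1 = sx at *
  generalize ((s i).1 y).1 = sy at *
  generalize x.1 = x at *
  generalize y.1 = y at *
  generalize hk : ((i : ℕ) : ℤ) = k at *
  have hk0 : 0 ≤ k := by omega
  by_cases hi : i.1 = 0
  · have hk1 : k = 0 := by omega
    simp only [hi, if_true] at hx hy
    subst hk1
    split_ifs at hx hy <;> omega
  · have hk1 : 0 < k := by omega
    simp only [hi, if_false] at hx hy
    split_ifs at hx hy <;> omega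

/-- The propositional skeleton of `invSum_mul_s`. `S` and `L` are the orders after and before
applying `s i`, `K` is non-oppositeness, `V` is inversion by `w`, `c` is the ascent condition, and
`P₁`–`P₄` single out the four ordered pairs where `S` and `L` differ. -/
theorem ite_inversion_change {P₁ P₂ P₃ P₄ S L K V c : Prop} [Decidable P₁] [Decidable P₂]
    [Decidable P₃] [Decidable P₄] [Decidable S] [Decidable L] [Decidable K] [Decidable V]
    [Decidable c] {f e : ℤ} (h₁ : P₁ → S ∧ ¬L ∧ K ∧ (V ↔ c) ∧ f = e ∧ ¬P₂ ∧ ¬P₃ ∧ ¬P₄)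
    (h₂ : P₂ → S ∧ ¬L ∧ K ∧ (V ↔ c) ∧ f = e ∧ ¬P₃ ∧ ¬P₄)
    (h₃ : P₃ → ¬S ∧ L ∧ K ∧ (V ↔ ¬c) ∧ f = e ∧ ¬P₄) (h₄ : P₄ → ¬S ∧ L ∧ K ∧ (V ↔ ¬c) ∧ f = e)
    (h₅ : K → V → ¬P₁ → ¬P₂ → ¬P₃ → ¬P₄ → (S ↔ L)) :
    (if S ∧ K ∧ V then f else 0) = (if L ∧ K ∧ V then f else 0)
      + (if P₁ then (if c then e else 0) else 0) + (if P₂ then (if c then e else 0) else 0)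
      + (if P₃ then (if c then 0 else -e) else 0) + (if P₄ then (if c then 0 else -e) else 0) := by
  by_cases p₁ : P₁
  · obtain ⟨a, b, c', v, rfl, a2, a3, a4⟩ := h₁ p₁
    simp [p₁, a, b, c', v, a2, a3, a4]
  by_cases p₂ : P₂
  · obtain ⟨a, b, c', v, rfl, a3, a4⟩ := h₂ p₂
    simp [p₁, a, b, c', v, p₂, a3, a4]
  by_cases p₃ : P₃
  · obtain ⟨a, b, c', v, rfl, a4⟩ := h₃ p₃
    by_cases hc : c <;> simp [p₁, a, b, c', v, p₂, p₃, a4, hc]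
  by_cases p₄ : P₄
  · obtain ⟨a, b, c', v, rfl⟩ := h₄ p₄
    by_cases hc : c <;> simp [p₁, a, b, c', v, p₂, p₃, p₄, hc]
  · have h : (S ∧ K ∧ V) ↔ (L ∧ K ∧ V) := by tauto
    simp [p₁, p₂, p₃, p₄, h]

/-- The sum of `F x y` over the inversions `x < y`, `x ≠ -y`, `w x > w y` of `w`. -/
def invSum (F : SInt d → SInt d → ℤ) (w : W d) : ℤ :=
  ∑ x, ∑ y, if x < y ∧ x ≠ -y ∧ w.1 y < w.1 x then F x y else 0

theorem invSum_one (F : SInt d → SInt d → ℤ) : invSum F 1 = 0 := by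
  unfold invSum
  refine Finset.sum_eq_zero fun x _ => Finset.sum_eq_zero fun y _ => if_neg ?_
  rintro ⟨h1, -, h2⟩
  exact absurd h2 (not_lt.2 h1.le)

/-- Reindexing by `s i` leaves the summands unchanged except at the neighbours $i,i+1$ and at their
negatives. Each of the two pairs becomes, or ceases to be, an inversion, whence the factor 2.
Keeping a general weight `F` serves both the length and the count of odd inversions. -/
theorem invSum_mul_s (F : SInt d → SInt d → ℤ) (i : Fin d) (hs : ∀ x y, F x y = F y x)
    (hn : ∀ x y, F (-x) (-y) = F x y) (hi : ∀ x y, F ((s i).1 x) ((s i).1 y) = F x y) (w : W d) :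
    invSum F (w * s i) = invSum F w +
      if w.1 (pt i) < w.1 (ptSucc i) then 2 * F (pt i) (ptSucc i)
      else -(2 * F (pt i) (ptSucc i)) := by
  have h1 : invSum F (w * s i) = ∑ x, ∑ y,
      if (s i).1 x < (s i).1 y ∧ x ≠ -y ∧ w.1 y < w.1 x then F x y else 0 := by
    unfold invSum
    rw [← Equiv.sum_comp (s i).1]
    refine Finset.sum_congr rfl fun x _ => ?_
    rw [← Equiv.sum_comp (s i).1]
    refine Finset.sum_congr rfl fun y _ => ?_
    rw [W_mul_apply, W_mul_apply, s_s_apply, s_s_apply, hi]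
    simp only [← W_neg, ne_eq, W_inj]
  have h2 : ∀ x y : SInt d,
      (if (s i).1 x < (s i).1 y ∧ x ≠ -y ∧ w.1 y < w.1 x then F x y else 0)
      = (if x < y ∧ x ≠ -y ∧ w.1 y < w.1 x then F x y else 0)
      + (if x = ptSucc i ∧ y = pt i then
            (if w.1 (pt i) < w.1 (ptSucc i) then F (pt i) (ptSucc i) else 0) else 0)
      + (if x = -pt i ∧ y = -ptSucc i then
            (if w.1 (pt i) < w.1 (ptSucc i) then F (pt i) (ptSucc i) else 0) else 0)
      + (if x = pt i ∧ y = ptSucc i then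
            (if w.1 (pt i) < w.1 (ptSucc i) then 0 else -F (pt i) (ptSucc i)) else 0)
      + (if x = -ptSucc i ∧ y = -pt i then
            (if w.1 (pt i) < w.1 (ptSucc i) then 0 else -F (pt i) (ptSucc i)) else 0) := by
    intro x y
    have hlt := pt_lt_ptSucc i
    have hne : pt i ≠ ptSucc i := hlt.ne
    have hne2 : pt i ≠ -ptSucc i := by
      simp only [ne_eq, Subtype.ext_iff, coe_neg, coe_pt, coe_ptSucc]; omega
    have hne3 : ptSucc i ≠ -pt i := by
      simp only [ne_eq, Subtype.ext_iff, coe_neg, coe_pt, coe_ptSucc]; omega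
    have hne4 : ptSucc i ≠ -ptSucc i := by
      simp only [ne_eq, Subtype.ext_iff, coe_neg, coe_ptSucc]; omega
    have hnlt : -ptSucc i < -pt i := sint_neg_lt.2 hlt
    have hw : w.1 (ptSucc i) < w.1 (pt i) ↔ ¬ w.1 (pt i) < w.1 (ptSucc i) := by
      rw [not_lt, le_iff_lt_or_eq, or_iff_left]
      intro h
      exact hne ((W_inj w).1 h.symm)
    have hnn : ∀ a b : SInt d, w.1 (-a) < w.1 (-b) ↔ w.1 b < w.1 a := fun a b => by
      rw [W_neg, W_neg, sint_neg_lt]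
    have key : ∀ x y : SInt d, x ≠ -y → _ := s_lt_s_iff i
    apply ite_inversion_change
    · rintro ⟨rfl, rfl⟩
      exact ⟨(key _ _ hne3).2 (Or.inr (Or.inl ⟨rfl, rfl⟩)), not_lt.2 hlt.le, hne3,
        Iff.rfl, hs _ _, fun h => hne3 h.1, fun h => hne h.2, fun h => hne4 h.1⟩
    · rintro ⟨rfl, rfl⟩
      refine ⟨(key _ _ ?_).2 (Or.inr (Or.inr ⟨rfl, rfl⟩)), not_lt.2 hnlt.le, ?_,
        hnn _ _, hn _ _, fun h => hne4 h.2.symm, fun h => hnlt.ne' h.1⟩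
      · rw [sint_neg_neg]; exact hne3.symm
      · rw [sint_neg_neg]; exact hne3.symm
    · rintro ⟨rfl, rfl⟩
      refine ⟨fun h => ?_, hlt, hne2, hw, rfl, fun h => hne2 h.1⟩
      rcases (key _ _ hne2).1 h with ⟨-, h, -⟩ | h | h
      · exact h ⟨rfl, rfl⟩
      · exact hne h.1
      · exact hne4 h.2
    · rintro ⟨rfl, rfl⟩
      have e : -ptSucc i ≠ -(-pt i) := by rw [sint_neg_neg]; exact hne2.symm
      refine ⟨fun h => ?_, hnlt, e, (hnn _ _).trans hw, by rw [hn, hs]⟩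
      rcases (key _ _ e).1 h with ⟨-, -, h⟩ | h | h
      · exact h ⟨rfl, rfl⟩
      · exact hne4 h.1.symm
      · exact hnlt.ne h.1
    · intro hK _ h1 h2 h3 h4
      rw [key x y hK]
      exact ⟨fun h => h.elim (fun h => h.1) fun h => (h.elim h1 h2).elim,
        fun h => Or.inl ⟨h, h3, h4⟩⟩
  rw [h1]
  simp only [h2, Finset.sum_add_distrib, ite_and]
  simp only [Finset.sum_ite_irrel, Finset.sum_const_zero, Finset.sum_ite_eq', Finset.mem_univ,
    if_true]
  unfold invSum
  simp only [ite_and]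
  split_ifs <;> ring

theorem W_pt_ne (w : W d) (i : Fin d) : w.1 (pt i) ≠ w.1 (ptSucc i) :=
  fun h => (pt_lt_ptSucc i).ne ((W_inj w).1 h)

theorem exists_descent (w : W d) (hw : w ≠ 1) : ∃ i, w.1 (ptSucc i) < w.1 (pt i) := by
  by_contra! hc
  apply hw
  apply eq_one_of_no_descent
  intro i
  have h1 := sum_mul_s w i
  have h2 := Subtype.coe_le_coe.2 (hc i)
  split_ifs at h1 with hi
  · have h3 : pt i = 0 := Subtype.ext (by rw [coe_pt, hi]; rfl)
    rw [h3, W_zero, coe_zero] at h2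
    omega
  · omega

theorem len_one : len (1 : W d) = 0 := Nat.le_zero.1 (len_le (d := d) [])

/-- Inversions $(x,y)$ and $(-y,-x)$ come in pairs, and they are distinct since opposite points are
left out. Each letter of a word changes the count by $\pm2$, which gives one inequality; removing
descents until the identity is reached gives the other. -/
theorem two_len (w : W d) : 2 * (len w : ℤ) = invSum (fun _ _ => 1) w := by
  have step : ∀ (w : W d) (i : Fin d), _ := fun w i =>
    invSum_mul_s (fun _ _ => 1) i (fun _ _ => rfl) (fun _ _ => rfl) (fun _ _ => rfl) w
  have h1 : ∀ l : List (Fin d), invSum (fun _ _ => 1) (l.map s).prod ≤ 2 * (l.length : ℤ) := by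
    intro l
    induction l using List.reverseRecOn with
    | nil => simp [invSum_one]
    | append_singleton l i ih =>
      rw [List.map_append, List.prod_append, List.map_singleton, List.prod_singleton, step,
        List.length_append, List.length_singleton]
      push_cast
      split_ifs <;> omega
  have h2 : ∀ n : ℕ, ∀ w : W d, invSum (fun _ _ => 1) w < n →
      2 * (len w : ℤ) ≤ invSum (fun _ _ => 1) w := by
    intro n
    induction n with
    | zero =>
      intro w hw
      exfalso
      have : 0 ≤ invSum (fun _ _ => 1) w := by
        unfold invSum
        exact Finset.sum_nonneg fun x _ => Finset.sum_nonneg fun y _ => by split_ifs <;> simp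
      push_cast at hw
      omega
    | succ n ih =>
      intro w hw
      by_cases h : w = 1
      · rw [h, len_one, invSum_one]; simp
      · obtain ⟨i, hi⟩ := exists_descent w h
        have h3 := step w i
        rw [if_neg (not_lt.2 hi.le)] at h3
        have h4 := ih (w * s i) (by push_cast at hw; omega)
        have h5 := len_mul_le (w * s i) (s i)
        rw [mul_s_mul_s] at h5
        have h6 : len (s i) ≤ 1 := by simpa using len_le [i]
        omega
  apply le_antisymm (h2 ((invSum (fun _ _ => 1) w).toNat + 1) w (by push_cast; omega))
  obtain ⟨l, hl, hlw⟩ := len_spec w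
  have := h1 l
  rw [hlw, hl] at this
  exact this

theorem len_mul_s (w : W d) (i : Fin d) : (len (w * s i) : ℤ) =
    len w + if w.1 (pt i) < w.1 (ptSucc i) then 1 else -1 := by
  have h := invSum_mul_s (fun _ _ => 1) i (fun _ _ => rfl) (fun _ _ => rfl) (fun _ _ => rfl) w
  rw [← two_len, ← two_len] at h
  simp only [mul_one] at h
  split_ifs at h ⊢ <;> omega

theorem len_lt_mul_s {w : W d} {i : Fin d} : len w < len (w * s i) ↔
    w.1 (pt i) < w.1 (ptSucc i) := by
  have := len_mul_s w i
  split_ifs at this <;> constructor <;> intro <;>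
    first | assumption | contradiction | omega

theorem len_mul_s_of_lt {w : W d} {i : Fin d} (h : w.1 (pt i) < w.1 (ptSucc i)) :
    len (w * s i) = len w + 1 := by
  have := len_mul_s w i
  rw [if_pos h] at this
  exact_mod_cast this

theorem len_mul_s_of_gt {w : W d} {i : Fin d} (h : w.1 (ptSucc i) < w.1 (pt i)) :
    len w = len (w * s i) + 1 := by
  have := len_mul_s w i
  rw [if_neg (not_lt.2 h.le)] at this
  omega

theorem len_s_mul (w : W d) (i : Fin d) : len (s i * w) = len (w⁻¹ * s i) := by
  rw [← len_inv, mul_inv_rev, s_inv]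

theorem len_lt_s_mul {w : W d} {i : Fin d} : len w < len (s i * w) ↔
    (w⁻¹).1 (pt i) < (w⁻¹).1 (ptSucc i) := by
  rw [← len_lt_mul_s, len_s_mul, len_inv]

theorem len_s_mul_of_lt {w : W d} {i : Fin d} (h : len w < len (s i * w)) :
    len (s i * w) = len w + 1 := by
  rw [len_s_mul, len_mul_s_of_lt (len_lt_s_mul.1 h), len_inv]

theorem len_s_mul_of_not_lt {w : W d} {i : Fin d} (h : ¬ len w < len (s i * w)) :
    len w = len (s i * w) + 1 := by
  have h1 := len_mul_s w⁻¹ i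
  rw [← len_s_mul, len_inv] at h1
  split_ifs at h1 <;> omega

theorem len_mul_s_of_not_lt {w : W d} {i : Fin d} (h : ¬ len w < len (w * s i)) :
    len w = len (w * s i) + 1 := by
  have h1 := len_mul_s w i
  split_ifs at h1 <;> omega

theorem len_mul_s_of_len_lt {w : W d} {i : Fin d} (h : len w < len (w * s i)) :
    len (w * s i) = len w + 1 := len_mul_s_of_lt (len_lt_mul_s.1 h)

theorem len_s (i : Fin d) : len (s i) = 1 := by
  have := len_mul_s_of_lt (w := (1 : W d)) (i := i) (pt_lt_ptSucc i)
  rwa [one_mul, len_one] at this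

theorem eq_one_of_len {w : W d} (h : len w = 0) : w = 1 := by
  obtain ⟨l, hl, rfl⟩ := len_spec w
  rw [h, List.length_eq_zero_iff] at hl
  rw [hl]; rfl

theorem s_ne_one (i : Fin d) : s i ≠ 1 := by
  intro h
  have := len_s i
  rw [h, len_one] at this
  omega

/-- If `w` maps the pair of `s_j` to that of `s_i`, up to order and sign, then it conjugates `s_j`
to `s_i`. -/
theorem s_mul_eq_mul_s {w : W d} {i j : Fin d}
    (h : (w.1 (pt j) = pt i ∧ w.1 (ptSucc j) = ptSucc i) ∨
      (w.1 (pt j) = ptSucc i ∧ w.1 (ptSucc j) = pt i) ∨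
      (w.1 (pt j) = -pt i ∧ w.1 (ptSucc j) = -ptSucc i) ∨
      (w.1 (pt j) = -ptSucc i ∧ w.1 (ptSucc j) = -pt i)) :
    s i * w = w * s j := by
  -- The point 0 is fixed by `w`, so the pair containing 0 can only go to the pair containing 0.
  have h0 : j.1 = 0 ↔ i.1 = 0 := by
    have e0 : ∀ x : SInt d, (w.1 x).1 = 0 ↔ x.1 = 0 := by
      intro x
      have : w.1 x = 0 ↔ x = 0 := by
        conv_lhs => rw [← W_zero w]
        exact W_inj w
      simpa only [Subtype.ext_iff, coe_zero] using this
    have e1 := e0 (pt j)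
    have e2 := e0 (ptSucc j)
    simp only [Subtype.ext_iff, coe_neg, coe_pt, coe_ptSucc] at h e1 e2
    omega
  symm
  rw [← mul_inv_eq_iff_eq_mul]
  apply Subtype.ext
  change w.1 * simplePerm j * w.1⁻¹ = simplePerm i
  have hsw : ∀ x y : SInt d, w.1 * Equiv.swap x y * w.1⁻¹ = Equiv.swap (w.1 x) (w.1 y) :=
    fun x y => (Equiv.swap_apply_apply w.1 x y).symm
  by_cases hj : j.1 = 0
  · have hi := h0.1 hj
    rw [simplePerm, simplePerm, if_pos hi, if_pos hj, hsw, W_neg]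
    have hz : ∀ k : Fin d, k.1 = 0 → pt k = 0 := fun k hk => Subtype.ext (by rw [coe_pt, hk]; rfl)
    have hne : ∀ k : Fin d, ptSucc k ≠ 0 := fun k hk => by
      have := congrArg Subtype.val hk
      rw [coe_ptSucc, coe_zero] at this
      omega
    rw [hz i hi, hz j hj, W_zero, sint_neg_zero] at h
    rcases h with ⟨-, h⟩ | ⟨h, -⟩ | ⟨-, h⟩ | ⟨h, -⟩
    · rw [h]
    · exact absurd h.symm (hne i)
    · rw [h, sint_neg_neg, Equiv.swap_comm]
    · exact absurd (sint_neg_inj.1 (h.symm.trans sint_neg_zero.symm)) (hne i)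
  · have hi : i.1 ≠ 0 := fun hi => hj (h0.2 hi)
    rw [simplePerm, simplePerm, if_neg hi, if_neg hj]
    have e : w.1 * (Equiv.swap (pt j) (ptSucc j) * Equiv.swap (-pt j) (-ptSucc j)) * w.1⁻¹ =
        Equiv.swap (w.1 (pt j)) (w.1 (ptSucc j)) *
          Equiv.swap (w.1 (-pt j)) (w.1 (-ptSucc j)) := by
      rw [← hsw, ← hsw]; group
    have hc : Equiv.swap (-pt i) (-ptSucc i) * Equiv.swap (pt i) (ptSucc i) =
        Equiv.swap (pt i) (ptSucc i) * Equiv.swap (-pt i) (-ptSucc i) := by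
      apply Equiv.Perm.Disjoint.commute
      intro x
      by_cases hx : x.1 < 0
      · right
        apply Equiv.swap_apply_of_ne_of_ne <;>
          simp only [ne_eq, Subtype.ext_iff, coe_pt, coe_ptSucc] <;> omega
      · left
        apply Equiv.swap_apply_of_ne_of_ne <;>
          simp only [ne_eq, Subtype.ext_iff, coe_neg, coe_pt, coe_ptSucc] <;> omega
    rw [e, W_neg, W_neg]
    rcases h with ⟨h1, h2⟩ | ⟨h1, h2⟩ | ⟨h1, h2⟩ | ⟨h1, h2⟩ <;> rw [h1, h2]
    · rw [Equiv.swap_comm, Equiv.swap_comm (-ptSucc i)]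
    · rw [sint_neg_neg, sint_neg_neg, hc]
    · rw [sint_neg_neg, sint_neg_neg, Equiv.swap_comm, Equiv.swap_comm (ptSucc i), hc]

/-- The exchange condition. Whether `s i` lengthens is decided by the order of the preimages of $i$
and $i+1$. Passing from `w` to `w * s j` changes this order only if these preimages are the pair of
`s j` up to sign, and then `w` conjugates `s j` to `s i`. -/
theorem s_mul_eq_mul_s_of_exchange {w : W d} {i j : Fin d}
    (h : ¬(len w < len (s i * w) ↔ len (w * s j) < len (s i * (w * s j)))) :
    s i * w = w * s j := by
  rw [len_lt_s_mul, len_lt_s_mul, mul_inv_rev, s_inv, W_mul_apply, W_mul_apply] at h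
  have hneg : (w⁻¹).1 (pt i) ≠ -(w⁻¹).1 (ptSucc i) := by
    rw [← W_neg, ne_eq, W_inj]
    simp only [Subtype.ext_iff, coe_neg, coe_pt, coe_ptSucc]; omega
  rw [s_lt_s_iff j _ _ hneg] at h
  apply s_mul_eq_mul_s
  have key : ∀ a b : SInt d, (w⁻¹).1 a = b → w.1 b = a := by
    rintro a b rfl; exact W_apply_inv_self w a
  have hn : ∀ a b : SInt d, w.1 (-a) = b → w.1 a = -b := by
    rintro a b rfl; rw [W_neg, sint_neg_neg]
  have cases4 : ((w⁻¹).1 (pt i) = pt j ∧ (w⁻¹).1 (ptSucc i) = ptSucc j) ∨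
      ((w⁻¹).1 (pt i) = -ptSucc j ∧ (w⁻¹).1 (ptSucc i) = -pt j) ∨
      ((w⁻¹).1 (pt i) = ptSucc j ∧ (w⁻¹).1 (ptSucc i) = pt j) ∨
      ((w⁻¹).1 (pt i) = -pt j ∧ (w⁻¹).1 (ptSucc i) = -ptSucc j) := by tauto
  rcases cases4 with ⟨h1, h2⟩ | ⟨h1, h2⟩ | ⟨h1, h2⟩ | ⟨h1, h2⟩
  · exact Or.inl ⟨key _ _ h1, key _ _ h2⟩
  · exact Or.inr (Or.inr (Or.inr ⟨hn _ _ (key _ _ h2), hn _ _ (key _ _ h1)⟩))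
  · exact Or.inr (Or.inl ⟨key _ _ h2, key _ _ h1⟩)
  · exact Or.inr (Or.inr (Or.inl ⟨hn _ _ (key _ _ h1), hn _ _ (key _ _ h2)⟩))

end Length

/-! ## Symmetric interval partitions and their parabolic subgroups -/

/-- A partition of `[-d..d]` into intervals, symmetric under negation, given by a monotone odd
labelling, together with a set of odd blocks. -/
structure Lab (d : ℕ) where
  f : SInt d → ℤ
  mono : Monotone f
  neg : ∀ x, f (-x) = -f x
  odd : SInt d → Prop
  odd_neg : ∀ x, odd (-x) ↔ odd x
  odd_congr : ∀ x y, f x = f y → (odd x ↔ odd y)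

namespace Lab

variable {d : ℕ} (b : Lab d)

/-- The group of signed permutations preserving all blocks. -/
def grp : Subgroup (W d) where
  carrier := {w | ∀ x, b.f (w.1 x) = b.f x}
  one_mem' := fun _ => rfl
  mul_mem' := by
    intro u w hu hw x
    rw [W_mul_apply, hu, hw]
  inv_mem' := by
    intro w hw x
    rw [← hw, W_apply_inv_self]

theorem mem_grp {w : W d} : w ∈ b.grp ↔ ∀ x, b.f (w.1 x) = b.f x := Iff.rfl

/-- `s_i` preserves the blocks. -/
def gen (i : Fin d) : Prop := b.f (pt i) = b.f (ptSucc i)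

/-- `w` is increasing on the blocks. -/
def Inc (w : W d) : Prop := ∀ x y, x < y → b.f x = b.f y → w.1 x < w.1 y

theorem f_zero : b.f 0 = 0 := by
  have := b.neg 0
  rw [sint_neg_zero] at this
  omega

theorem s_mem {i : Fin d} (h : b.gen i) : s i ∈ b.grp := by
  intro x
  have h1 := s_val i x
  have e : ∀ a c : SInt d, a.1 = c.1 → b.f a = b.f c := fun a c h => by rw [Subtype.ext h]
  have n1 := b.neg (pt i)
  have n2 := b.neg (ptSucc i)
  unfold gen at h
  by_cases hi : i.1 = 0
  · have hz : b.f (pt i) = 0 := by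
      rw [e (pt i) 0 (by rw [coe_pt, hi]; rfl), f_zero]
    simp only [hi, if_true, Nat.cast_zero] at h1
    split_ifs at h1 with c1 c2 c3 c4
    · rw [e _ x (by rw [h1, c1])]
    · rw [e x (ptSucc i) (by rw [coe_ptSucc]; omega),
        e _ (-ptSucc i) (by rw [coe_neg, coe_ptSucc]; omega)]; omega
    · omega
    · rw [e x (-ptSucc i) (by rw [coe_neg, coe_ptSucc]; omega),
        e _ (ptSucc i) (by rw [coe_ptSucc]; omega)]; omega
    · rw [e _ x h1]
  · simp only [hi, if_false] at h1
    split_ifs at h1 with c1 c2 c3 c4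
    · rw [e x (pt i) c1, e _ (ptSucc i) h1, h]
    · rw [e x (ptSucc i) c2, e _ (pt i) h1, h]
    · rw [e x (-pt i) c3, e _ (-ptSucc i) (by rw [coe_neg, coe_ptSucc]; omega)]; omega
    · rw [e x (-ptSucc i) (by rw [coe_neg, coe_ptSucc]; omega), e _ (-pt i) h1]; omega
    · rw [e _ x h1]

/-- Blocks are intervals, so comparing neighbours suffices. Neighbours in the negative half are
moved to the positive half, where the simple reflections live, by oddness. -/
theorem strictMono_on_blocks {φ : SInt d → ℤ} (hφ : ∀ x, φ (-x) = -φ x)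
    (h : ∀ i, b.gen i → φ (pt i) < φ (ptSucc i)) :
    ∀ x y, x < y → b.f x = b.f y → φ x < φ y := by
  have adj : ∀ x y : SInt d, y.1 = x.1 + 1 → b.f x = b.f y → φ x < φ y := by
    intro x y hxy hb
    have hx := Finset.mem_Icc.1 x.2
    have hy := Finset.mem_Icc.1 y.2
    by_cases hx0 : 0 ≤ x.1
    · have e1 : x = pt ⟨x.1.toNat, by omega⟩ := Subtype.ext (by rw [coe_pt]; simp; omega)
      have e2 : y = ptSucc ⟨x.1.toNat, by omega⟩ :=
        Subtype.ext (by rw [coe_ptSucc]; simp; omega)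
      have h1 := h ⟨x.1.toNat, by omega⟩
      unfold gen at h1
      rw [← e1, ← e2] at h1
      exact h1 hb
    · have e1 : -y = pt ⟨(-y.1).toNat, by omega⟩ :=
        Subtype.ext (by rw [coe_pt, coe_neg]; simp; omega)
      have e2 : -x = ptSucc ⟨(-y.1).toNat, by omega⟩ :=
        Subtype.ext (by rw [coe_ptSucc, coe_neg]; simp; omega)
      have h1 := h ⟨(-y.1).toNat, by omega⟩
      unfold gen at h1
      rw [← e1, ← e2, b.neg, b.neg, hφ, hφ] at h1
      have := h1 (by rw [hb])
      omega
  have key : ∀ n : ℕ, ∀ x y : SInt d, y.1 = x.1 + n + 1 → b.f x = b.f y → φ x < φ y := by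
    intro n
    induction n with
    | zero => intro x y hxy hb; exact adj x y (by simpa using hxy) hb
    | succ n ih =>
      intro x y hxy hb
      have hx := Finset.mem_Icc.1 x.2
      have hy := Finset.mem_Icc.1 y.2
      push_cast at hxy
      let z : SInt d := ⟨y.1 - 1, by rw [Finset.mem_Icc]; omega⟩
      have hz : z.1 = y.1 - 1 := rfl
      have h1 : b.f x ≤ b.f z := b.mono (Subtype.coe_le_coe.1 (by omega))
      have h2 : b.f z ≤ b.f y := b.mono (Subtype.coe_le_coe.1 (by omega))
      exact (ih x z (by omega) (by omega)).trans (adj z y (by omega) (by omega))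
  intro x y hxy hb
  have := Subtype.coe_lt_coe.2 hxy
  exact key (y.1 - x.1 - 1).toNat x y (by omega) hb

theorem inc_iff {w : W d} : b.Inc w ↔ ∀ i, b.gen i → w.1 (pt i) < w.1 (ptSucc i) := by
  refine ⟨fun h i hi => h _ _ (pt_lt_ptSucc i) hi, fun h x y hxy hb => ?_⟩
  exact b.strictMono_on_blocks (φ := fun x => (w.1 x).1) (fun x => by rw [W_neg, coe_neg])
    (fun i hi => h i hi) x y hxy hb

theorem inc_iff_len {w : W d} : b.Inc w ↔ ∀ i, b.gen i → len w < len (w * s i) := by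
  rw [inc_iff]
  simp only [len_lt_mul_s]

theorem inc_inv_iff_len {w : W d} : b.Inc w⁻¹ ↔ ∀ i, b.gen i → len w < len (s i * w) := by
  rw [inc_iff]
  simp only [len_lt_s_mul]

/-- Every descent of a block-preserving permutation is a generator, because two points in different
blocks cannot change their order. This makes induction along reduced words inside the subgroup
possible. -/
theorem exists_gen_descent {w : W d} (hw : w ∈ b.grp) (h1 : w ≠ 1) :
    ∃ i, b.gen i ∧ w.1 (ptSucc i) < w.1 (pt i) := by
  obtain ⟨i, hi⟩ := exists_descent w h1
  refine ⟨i, ?_, hi⟩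
  have h2 := b.mono hi.le
  rw [hw, hw] at h2
  exact le_antisymm (b.mono (pt_lt_ptSucc i).le) h2

/-- Induction along reduced words of elements of a subgroup all of whose descents lie in it. -/
theorem induct_of_descents {G : Subgroup (W d)} {g : Fin d → Prop}
    (hG : ∀ i, g i → s i ∈ G) (hd : ∀ w ∈ G, w ≠ 1 → ∃ i, g i ∧ w.1 (ptSucc i) < w.1 (pt i))
    {motive : W d → Prop} (one : motive 1)
    (mul : ∀ w ∈ G, ∀ i, g i → w.1 (pt i) < w.1 (ptSucc i) → motive w → motive (w * s i)) :
    ∀ w ∈ G, motive w := by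
  intro w hw
  induction hk : len w using Nat.strong_induction_on generalizing w with
  | _ k ih =>
    by_cases h1 : w = 1
    · rw [h1]; exact one
    · obtain ⟨i, hi, hlt⟩ := hd w hw h1
      have h2 := len_mul_s_of_gt hlt
      have h3 : w * s i ∈ G := G.mul_mem hw (hG i hi)
      have h4 := mul (w * s i) h3 i hi (by
        rw [← len_lt_mul_s, mul_s_mul_s]; omega) (ih _ (by omega) _ h3 rfl)
      rwa [mul_s_mul_s] at h4

theorem induct {motive : W d → Prop} (one : motive 1)
    (mul : ∀ w ∈ b.grp, ∀ i, b.gen i → w.1 (pt i) < w.1 (ptSucc i) → motive w →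
      motive (w * s i)) : ∀ w ∈ b.grp, motive w :=
  induct_of_descents (fun _ => b.s_mem) (fun _ => b.exists_gen_descent) one mul

/-- An ascent of `u` at a generator compares two points of one block, and `w` is increasing there;
hence it remains an ascent of `w * u`. -/
theorem len_mul {w u : W d} (hw : b.Inc w) (hu : u ∈ b.grp) :
    len (w * u) = len w + len u := by
  refine b.induct (motive := fun u => len (w * u) = len w + len u) ?_ ?_ u hu
  · rw [mul_one, len_one, add_zero]
  · intro u hu i hi hlt ih
    have h1 : (w * u).1 (pt i) < (w * u).1 (ptSucc i) :=
      hw _ _ hlt (by rw [hu, hu]; exact hi)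
    rw [← mul_assoc, len_mul_s_of_lt h1, len_mul_s_of_lt hlt, ih, add_assoc]

theorem len_mul_left {w u : W d} (hw : b.Inc w⁻¹) (hu : u ∈ b.grp) :
    len (u * w) = len u + len w := by
  rw [← len_inv, mul_inv_rev, b.len_mul hw (b.grp.inv_mem hu), len_inv, len_inv, add_comm]

/-- Uniqueness of the minimal coset representative: additivity of length applied to `w * u` and back
again forces `u` to have length 0. -/
theorem eq_one_of_inc {w u : W d} (hw : b.Inc w) (hu : u ∈ b.grp) (h : b.Inc (w * u)) : u = 1 := by
  have h1 := b.len_mul hw hu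
  have h2 := b.len_mul h (b.grp.inv_mem hu)
  rw [mul_inv_cancel_right, len_inv] at h2
  exact eq_one_of_len (by omega)

theorem eq_one_of_inc_left {w u : W d} (hw : b.Inc w⁻¹) (hu : u ∈ b.grp) (h : b.Inc (u * w)⁻¹) :
    u = 1 := by
  rw [mul_inv_rev] at h
  exact inv_eq_one.1 (b.eq_one_of_inc hw (b.grp.inv_mem hu) h)

/-! ### The sign character -/

open Classical in
/-- The indicator of pairs in the same odd block. -/
def oddPair (x y : SInt d) : ℤ := if b.odd x ∧ b.f x = b.f y then 1 else 0

theorem odd_apply {w : W d} (hw : w ∈ b.grp) (x : SInt d) : b.odd (w.1 x) ↔ b.odd x :=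
  b.odd_congr _ _ (hw x)

theorem oddPair_comm (x y : SInt d) : b.oddPair x y = b.oddPair y x := by
  unfold oddPair
  congr 1
  apply propext
  constructor
  · rintro ⟨h1, h2⟩; exact ⟨(b.odd_congr _ _ h2).1 h1, h2.symm⟩
  · rintro ⟨h1, h2⟩; exact ⟨(b.odd_congr _ _ h2).1 h1, h2.symm⟩

theorem oddPair_neg (x y : SInt d) : b.oddPair (-x) (-y) = b.oddPair x y := by
  unfold oddPair
  congr 1
  rw [b.odd_neg, b.neg, b.neg, neg_inj]

theorem oddPair_apply {w : W d} (hw : w ∈ b.grp) (x y : SInt d) :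
    b.oddPair (w.1 x) (w.1 y) = b.oddPair x y := by
  unfold oddPair
  congr 1
  rw [b.odd_apply hw, hw x, hw y]

theorem oddPair_nonneg (x y : SInt d) : 0 ≤ b.oddPair x y := by
  unfold oddPair; split_ifs <;> simp

/-- The coefficient of `T_w` in the element `[xy]`. -/
def chi (w : W d) : A := (-qInv) ^ (invSum b.oddPair w / 2).toNat

open Classical in
/-- The factor by which `chi` changes along `s_i`. -/
def eta (i : Fin d) : A := if b.odd (pt i) then -qInv else 1

theorem chi_one : b.chi 1 = 1 := by
  unfold chi
  rw [invSum_one]; simp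

theorem chi_mul_s {w : W d} {i : Fin d} (hi : b.gen i) (h : w.1 (pt i) < w.1 (ptSucc i)) :
    b.chi (w * s i) = b.chi w * b.eta i := by
  have h1 := invSum_mul_s b.oddPair i b.oddPair_comm b.oddPair_neg
    (b.oddPair_apply (b.s_mem hi)) w
  rw [if_pos h] at h1
  have h0 : 0 ≤ invSum b.oddPair w := by
    unfold invSum
    exact Finset.sum_nonneg fun x _ => Finset.sum_nonneg fun y _ => by
      split_ifs
      · exact b.oddPair_nonneg x y
      · exact le_rfl
  unfold chi eta
  rw [h1]
  by_cases ho : b.odd (pt i)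
  · have : b.oddPair (pt i) (ptSucc i) = 1 := if_pos ⟨ho, hi⟩
    rw [this, if_pos ho, ← pow_succ]
    congr 1
    omega
  · have : b.oddPair (pt i) (ptSucc i) = 0 := if_neg (fun hh => ho hh.1)
    rw [this, if_neg ho, mul_zero, add_zero, mul_one]

theorem invSum_inv {F : SInt d → SInt d → ℤ} (hs : ∀ x y, F x y = F y x) {w : W d}
    (hw : ∀ x y, F (w.1 x) (w.1 y) = F x y) : invSum F w⁻¹ = invSum F w := by
  unfold invSum
  rw [Finset.sum_comm, ← Equiv.sum_comp w.1]
  refine Finset.sum_congr rfl fun x _ => ?_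
  rw [← Equiv.sum_comp w.1]
  refine Finset.sum_congr rfl fun y _ => ?_
  rw [W_inv_apply_self, W_inv_apply_self, hw, hs y x]
  congr 1
  apply propext
  rw [← W_neg, ne_eq, ne_eq, W_inj]
  have : y = -x ↔ x = -y := by
    simp only [Subtype.ext_iff, coe_neg]; omega
  rw [this]
  tauto

theorem chi_inv {w : W d} (hw : w ∈ b.grp) : b.chi w⁻¹ = b.chi w := by
  unfold chi
  rw [invSum_inv b.oddPair_comm (b.oddPair_apply hw)]

theorem chi_s_mul {w : W d} (hw : w ∈ b.grp) {i : Fin d} (hi : b.gen i)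
    (h : len w < len (s i * w)) : b.chi (s i * w) = b.eta i * b.chi w := by
  have h1 := b.chi_mul_s hi (len_lt_s_mul.1 h)
  rw [← b.chi_inv (b.grp.mul_mem (b.s_mem hi) hw), mul_inv_rev, s_inv, h1, b.chi_inv hw, mul_comm]

theorem chi_mul_of_len {u w : W d} (hw : w ∈ b.grp)
    (h : len (u * w) = len u + len w) : b.chi (u * w) = b.chi u * b.chi w := by
  have key : ∀ w ∈ b.grp, len (u * w) = len u + len w → b.chi (u * w) = b.chi u * b.chi w := by
    refine b.induct (motive := fun w => len (u * w) = len u + len w →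
      b.chi (u * w) = b.chi u * b.chi w) ?_ ?_
    · intro _; rw [mul_one, chi_one, mul_one]
    · intro w hw i hi hlt ih h
      have h1 := len_mul_s_of_lt hlt
      have h2 := len_mul_le u w
      have h3 := len_mul_le (u * w) (s i)
      rw [len_s] at h3
      rw [← mul_assoc] at h ⊢
      rw [b.chi_mul_s hi (len_lt_mul_s.1 (by omega)), b.chi_mul_s hi hlt, ih (by omega), mul_assoc]
  exact key w hw h

end Lab

/-! ## The standard basis of the Hecke algebra -/

section HeckeBasis

variable {d : ℕ}

/-- Left multiplication by `T_{s_i}` in terms of coefficients. -/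
def lamOp (i : Fin d) : Module.End A (W d → A) where
  toFun c w := if len w < len (s i * w) then q * c (s i * w) else c (s i * w) + (q - 1) * c w
  map_add' c c' := by
    funext w; simp only [Pi.add_apply]; split_ifs <;> ring
  map_smul' a c := by
    funext w; simp only [Pi.smul_apply, smul_eq_mul, RingHom.id_apply]; split_ifs <;> ring

/-- Right multiplication by `T_{s_i}` in terms of coefficients. -/
def rhoOp (i : Fin d) : Module.End A (W d → A) where
  toFun c w := if len w < len (w * s i) then q * c (w * s i) else c (w * s i) + (q - 1) * c w
  map_add' c c' := by
    funext w; simp only [Pi.add_apply]; split_ifs <;> ring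
  map_smul' a c := by
    funext w; simp only [Pi.smul_apply, smul_eq_mul, RingHom.id_apply]; split_ifs <;> ring

theorem lamOp_apply (i : Fin d) (c : W d → A) (w : W d) : lamOp i c w =
    if len w < len (s i * w) then q * c (s i * w) else c (s i * w) + (q - 1) * c w := rfl

theorem rhoOp_apply (i : Fin d) (c : W d → A) (w : W d) : rhoOp i c w =
    if len w < len (w * s i) then q * c (w * s i) else c (w * s i) + (q - 1) * c w := rfl

theorem len_s_mul_not_lt {w : W d} {i : Fin d} :
    len (s i * w) < len (s i * (s i * w)) ↔ ¬ len w < len (s i * w) := by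
  rw [s_mul_s_mul]
  by_cases h : len w < len (s i * w)
  · omega
  · have := len_s_mul_of_not_lt h; omega

theorem len_mul_s_not_lt {w : W d} {i : Fin d} :
    len (w * s i) < len (w * s i * s i) ↔ ¬ len w < len (w * s i) := by
  rw [mul_s_mul_s]
  by_cases h : len w < len (w * s i)
  · omega
  · have := len_mul_s_of_not_lt h; omega

/-- The key to the linear independence of the `T_w`: commuting left and right operators turn the
space of functions on `W d` into a faithful model. -/
theorem lamOp_rhoOp_comm (i j : Fin d) : Commute (lamOp i) (rhoOp j) := by
  apply LinearMap.ext
  intro c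
  funext w
  change lamOp i (rhoOp j c) w = rhoOp j (lamOp i c) w
  simp only [lamOp_apply, rhoOp_apply]
  rw [mul_assoc (s i) w (s j)]
  -- When the two products coincide, both sides are the same expression. Otherwise, by exchange,
  -- multiplication on one side does not affect the ascent condition on the other, and both sides
  -- expand alike.
  by_cases hex : s i * w = w * s j
  · have e1 : s i * (w * s j) = w := by rw [← hex, s_mul_s_mul]
    rw [hex, e1]
  · have h1 : len w < len (s i * w) ↔ len (w * s j) < len (s i * (w * s j)) := by
      by_contra h; exact hex (s_mul_eq_mul_s_of_exchange h)
    have h2 : len w < len (w * s j) ↔ len (s i * w) < len (s i * (w * s j)) := by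
      have l1 := len_mul_s w j
      have l2 := len_s_mul w i
      by_cases a : len w < len (s i * w) <;> by_cases b : len w < len (w * s j)
      · have := len_s_mul_of_lt a
        have := len_s_mul_of_lt (h1.1 a)
        omega
      · have := len_s_mul_of_lt a
        have := len_s_mul_of_lt (h1.1 a)
        have := len_mul_s_of_not_lt b
        omega
      · have := len_s_mul_of_not_lt a
        have := len_s_mul_of_not_lt (fun h => a (h1.2 h))
        have := len_mul_s_of_len_lt b
        omega
      · have := len_s_mul_of_not_lt a
        have := len_s_mul_of_not_lt (fun h => a (h1.2 h))
        have := len_mul_s_of_not_lt b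
        omega
    simp only [← h1, ← h2]
    split_ifs <;> ring

open Classical in
/-- The coefficient function of `T_w`. -/
def dl (w : W d) : W d → A := fun u => if u = w then 1 else 0

theorem lamOp_dl {w : W d} {i : Fin d} (h : len w < len (s i * w)) :
    lamOp i (dl w) = dl (s i * w) := by
  funext u
  rw [lamOp_apply]
  unfold dl
  by_cases hu : u = s i * w
  · subst hu
    rw [if_neg (by rw [len_s_mul_not_lt]; exact fun hh => hh h), s_mul_s_mul, if_pos rfl,
      if_pos rfl, if_neg, mul_zero, add_zero]
    intro hh; rw [hh] at h; exact lt_irrefl _ h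
  · have h1 : s i * u ≠ w := fun hh => hu (by rw [← hh, s_mul_s_mul])
    rw [if_neg hu, if_neg h1]
    split_ifs with c1 c2
    · simp
    · subst c2; exact absurd h c1
    · simp

theorem rhoOp_dl {w : W d} {i : Fin d} (h : len w < len (w * s i)) :
    rhoOp i (dl w) = dl (w * s i) := by
  funext u
  rw [rhoOp_apply]
  unfold dl
  by_cases hu : u = w * s i
  · subst hu
    rw [if_neg (by rw [len_mul_s_not_lt]; exact fun hh => hh h), mul_s_mul_s, if_pos rfl,
      if_pos rfl, if_neg, mul_zero, add_zero]
    intro hh; rw [hh] at h; exact lt_irrefl _ h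
  · have h1 : u * s i ≠ w := fun hh => hu (by rw [← hh, mul_s_mul_s])
    rw [if_neg hu, if_neg h1]
    split_ifs with c1 c2
    · simp
    · subst c2; exact absurd h c1
    · simp

theorem sum_dl (c : W d → A) : c = ∑ w, c w • dl w := by
  funext u
  rw [Finset.sum_apply]
  simp [dl]

theorem W_induct {motive : W d → Prop} (one : motive 1)
    (mul : ∀ w, ∀ i, len w < len (w * s i) → motive w → motive (w * s i)) :
    ∀ w, motive w := fun w =>
  Lab.induct_of_descents (G := ⊤) (g := fun _ => True) (fun _ _ => Subgroup.mem_top _)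
    (fun w _ h => (exists_descent w h).imp fun _ hi => ⟨trivial, hi⟩) one
    (fun w _ i _ h hm => mul w i (len_lt_mul_s.2 h) hm) w (Subgroup.mem_top w)

theorem W_induct_left {motive : W d → Prop} (one : motive 1)
    (mul : ∀ w, ∀ i, len w < len (s i * w) → motive w → motive (s i * w)) :
    ∀ w, motive w := fun w => by
  have := W_induct (motive := fun w => motive w⁻¹) (by rwa [inv_one]) (fun w i h hm => by
    rw [mul_inv_rev, s_inv]
    apply mul _ _ _ hm
    rw [len_s_mul, inv_inv, len_inv]
    exact h) w⁻¹
  rwa [inv_inv] at this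

/-- Operators commuting with right multiplication are determined by their value at `1`. -/
theorem eq_of_comm_rhoOp {f g : Module.End A (W d → A)} (hf : ∀ i, Commute f (rhoOp i))
    (hg : ∀ i, Commute g (rhoOp i)) (h : f (dl 1) = g (dl 1)) : f = g := by
  have key : ∀ w : W d, f (dl w) = g (dl w) := by
    refine W_induct (motive := fun w => f (dl w) = g (dl w)) h ?_
    intro w i hw ih
    rw [← rhoOp_dl hw]
    have h1 := LinearMap.congr_fun (hf i).eq (dl w)
    have h2 := LinearMap.congr_fun (hg i).eq (dl w)
    simp only [Module.End.mul_apply] at h1 h2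
    rw [h1, h2, ih]
  apply LinearMap.ext
  intro c
  rw [sum_dl c, map_sum, map_sum]
  refine Finset.sum_congr rfl fun w _ => ?_
  rw [map_smul, map_smul, key]

theorem prod_lamOp_comm (l : List (Fin d)) (j : Fin d) : Commute (l.map lamOp).prod (rhoOp j) := by
  induction l with
  | nil => exact Commute.one_left _
  | cons i l ih =>
    rw [List.map_cons, List.prod_cons]
    exact (lamOp_rhoOp_comm i j).mul_left ih

theorem prod_lamOp_dl (l : List (Fin d)) (w : W d)
    (h : len ((l.map s).prod * w) = l.length + len w) :
    (l.map lamOp).prod (dl w) = dl ((l.map s).prod * w) := by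
  induction l with
  | nil => simp
  | cons i l ih =>
    rw [List.map_cons, List.prod_cons, List.length_cons, mul_assoc] at h
    rw [List.map_cons, List.prod_cons, List.map_cons, List.prod_cons, mul_assoc]
    have h1 := len_mul_le (l.map s).prod w
    have h2 := len_le l
    have h3 := len_mul_le (s i) ((l.map s).prod * w)
    rw [len_s] at h3
    rw [Module.End.mul_apply, ih (by omega), lamOp_dl (by omega)]

/-- Left multiplication by `T_w` in terms of coefficients. -/
def lamW (w : W d) : Module.End A (W d → A) :=
  ((Classical.choose (len_spec w)).map lamOp).prod

theorem lamW_comm (w : W d) (j : Fin d) : Commute (lamW w) (rhoOp j) := prod_lamOp_comm _ j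

theorem lamW_dl {u w : W d} (h : len (u * w) = len u + len w) : lamW u (dl w) = dl (u * w) := by
  obtain ⟨h1, h2⟩ := Classical.choose_spec (len_spec u)
  have := prod_lamOp_dl (Classical.choose (len_spec u)) w (by rw [h1, h2, h])
  rw [h2] at this
  exact this

theorem lamW_s (i : Fin d) : lamW (s i) = lamOp i := by
  apply eq_of_comm_rhoOp (lamW_comm _) (lamOp_rhoOp_comm i)
  rw [lamW_dl (by rw [mul_one, len_one, add_zero]), lamOp_dl]
  rw [mul_one, len_one, len_s]; exact one_pos

theorem lamOp_quad (i : Fin d) :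
    (lamOp i + 1) * (lamOp i - algebraMap A (Module.End A (W d → A)) q) = 0 := by
  apply LinearMap.ext
  intro c
  funext w
  simp only [Module.End.mul_apply, LinearMap.add_apply, LinearMap.sub_apply, Module.End.one_apply,
    Module.algebraMap_end_apply, LinearMap.zero_apply, Pi.add_apply, Pi.sub_apply, lamOp_apply,
    Pi.zero_apply, Pi.smul_apply, smul_eq_mul, s_mul_s_mul]
  by_cases h : len w < len (s i * w)
  · have h2 : ¬ len (s i * w) < len w := by omega
    simp only [h, h2, if_true, if_false]; ring
  · have h2 : len (s i * w) < len w := by have := len_s_mul_of_not_lt h; omega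
    simp only [h, h2, if_true, if_false]; ring

/-- For the first two relations all operators involved commute with right multiplications, so they
may be tested on `dl 1` alone. In particular the choice of reduced words in `lamW` is immaterial. -/
theorem lamRel ⦃x y : FreeAlgebra A (W d)⦄ (h : HRel d x y) :
    FreeAlgebra.lift A (lamW (d := d)) x = FreeAlgebra.lift A (lamW (d := d)) y := by
  cases h with
  | one =>
    rw [FreeAlgebra.lift_ι_apply, map_one]
    apply eq_of_comm_rhoOp (lamW_comm _) (fun i => Commute.one_left _)
    rw [lamW_dl (by rw [mul_one, len_one]), mul_one]; rfl
  | mul w w' h =>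
    rw [map_mul]
    simp only [FreeAlgebra.lift_ι_apply]
    apply eq_of_comm_rhoOp (fun i => (lamW_comm _ i).mul_left (lamW_comm _ i)) (lamW_comm _)
    rw [Module.End.mul_apply, lamW_dl (w := 1) (by rw [mul_one, len_one, add_zero]), mul_one,
      lamW_dl h, lamW_dl (w := 1) (by rw [mul_one, len_one, add_zero]), mul_one]
  | quad i =>
    rw [map_mul, map_add, map_sub, map_one, map_zero, AlgHom.commutes]
    simp only [FreeAlgebra.lift_ι_apply]
    rw [lamW_s, lamOp_quad]

/-- The regular representation of the Hecke algebra. -/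
def rep (d : ℕ) : H d →ₐ[A] Module.End A (W d → A) :=
  RingQuot.liftAlgHom A (s := HRel d) ⟨FreeAlgebra.lift A (lamW (d := d)), lamRel⟩

theorem rep_Tw (w : W d) : rep d (Tw w) = lamW w := by
  unfold rep Tw
  refine (RingQuot.liftAlgHom_mkAlgHom_apply A (s := HRel d) _ lamRel _).trans ?_
  rw [FreeAlgebra.lift_ι_apply]

/-- The coefficients of an element of the Hecke algebra with respect to the `T_w`. -/
def coef : H d →ₗ[A] (W d → A) where
  toFun z := rep d z (dl 1)
  map_add' z z' := by rw [map_add, LinearMap.add_apply]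
  map_smul' a z := by rw [map_smul, LinearMap.smul_apply, RingHom.id_apply]

theorem coef_apply (z : H d) : coef z = rep d z (dl 1) := rfl

theorem coef_Tw (w : W d) : coef (Tw w) = dl w := by
  rw [coef_apply, rep_Tw, lamW_dl (by rw [mul_one, len_one, add_zero]), mul_one]

theorem coef_s_mul (i : Fin d) (z : H d) : coef (Tw (s i) * z) = lamOp i (coef z) := by
  rw [coef_apply, map_mul, rep_Tw, lamW_s, Module.End.mul_apply, coef_apply]

theorem Tw_s_sq (i : Fin d) : Tw (s i) * Tw (s i) = (q - 1) • Tw (s i) + q • (1 : H d) := by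
  have h := Tw_quad i
  have e : (Tw (s i) + 1) * (Tw (s i) - algebraMap A (H d) q) =
      Tw (s i) * Tw (s i) - (Tw (s i) * algebraMap A (H d) q - Tw (s i) + algebraMap A (H d) q) := by
    noncomm_ring
  rw [e, sub_eq_zero] at h
  rw [h, sub_smul, one_smul, Algebra.smul_def, Algebra.smul_def, mul_one, Algebra.commutes]

theorem Tw_s_mul_of_lt {w : W d} {i : Fin d} (h : len w < len (s i * w)) :
    Tw (s i) * Tw w = Tw (s i * w) := by
  apply Tw_mul
  rw [len_s_mul_of_lt h, len_s, add_comm]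

theorem Tw_mul_s_of_lt {w : W d} {i : Fin d} (h : len w < len (w * s i)) :
    Tw w * Tw (s i) = Tw (w * s i) := by
  apply Tw_mul
  rw [len_mul_s_of_len_lt h, len_s]

theorem Tw_s_mul_of_not_lt {w : W d} {i : Fin d} (h : ¬ len w < len (s i * w)) :
    Tw (s i) * Tw w = (q - 1) • Tw w + q • Tw (s i * w) := by
  have h1 : Tw (s i) * Tw (s i * w) = Tw w := by
    rw [Tw_s_mul_of_lt (len_s_mul_not_lt.2 h), s_mul_s_mul]
  rw [← h1, ← mul_assoc, Tw_s_sq, add_mul, smul_mul_assoc, smul_mul_assoc, one_mul]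

/-- The span contains $T_1=1$ and is stable under left multiplication by each `Tw (s i)`, hence by
each `Tw w` along a reduced word, hence by the whole algebra. -/
theorem span_Tw : Submodule.span A (Set.range (Tw (d := d))) = ⊤ := by
  have hs : ∀ i : Fin d, ∀ z ∈ Submodule.span A (Set.range (Tw (d := d))),
      Tw (s i) * z ∈ Submodule.span A (Set.range (Tw (d := d))) := by
    intro i z hz
    induction hz using Submodule.span_induction with
    | mem x hx =>
      obtain ⟨w, rfl⟩ := hx
      by_cases h : len w < len (s i * w)
      · rw [Tw_s_mul_of_lt h]; exact Submodule.subset_span ⟨_, rfl⟩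
      · rw [Tw_s_mul_of_not_lt h]
        exact Submodule.add_mem _ (Submodule.smul_mem _ _ (Submodule.subset_span ⟨_, rfl⟩))
          (Submodule.smul_mem _ _ (Submodule.subset_span ⟨_, rfl⟩))
    | zero => rw [mul_zero]; exact Submodule.zero_mem _
    | add x y _ _ hx hy => rw [mul_add]; exact Submodule.add_mem _ hx hy
    | smul a x _ hx => rw [mul_smul_comm]; exact Submodule.smul_mem _ _ hx
  have hw : ∀ w : W d, ∀ z ∈ Submodule.span A (Set.range (Tw (d := d))),
      Tw w * z ∈ Submodule.span A (Set.range (Tw (d := d))) := by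
    refine W_induct_left (motive := fun w => ∀ z ∈ Submodule.span A (Set.range (Tw (d := d))),
      Tw w * z ∈ Submodule.span A (Set.range (Tw (d := d)))) ?_ ?_
    · intro z hz; rwa [Tw_one, one_mul]
    · intro w i h ih z hz
      rw [← Tw_s_mul_of_lt h, mul_assoc]
      exact hs i _ (ih z hz)
  rw [eq_top_iff]
  rintro z -
  let mk : FreeAlgebra A (W d) →ₐ[A] H d := RingQuot.mkAlgHom A (HRel d)
  obtain ⟨x, rfl⟩ : ∃ x, mk x = z := RingQuot.mkAlgHom_surjective A (HRel d) z
  have key : ∀ x : FreeAlgebra A (W d), ∀ z ∈ Submodule.span A (Set.range (Tw (d := d))),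
      mk x * z ∈ Submodule.span A (Set.range (Tw (d := d))) := by
    intro x
    induction x using FreeAlgebra.induction with
    | grade0 r =>
      intro z hz
      rw [AlgHom.commutes, ← Algebra.smul_def]
      exact Submodule.smul_mem _ _ hz
    | grade1 w => exact hw w
    | mul a b ha hb =>
      intro z hz
      rw [map_mul, mul_assoc]
      exact ha _ (hb _ hz)
    | add a b ha hb =>
      intro z hz
      rw [map_add, add_mul]
      exact Submodule.add_mem _ (ha _ hz) (hb _ hz)
  have := key x (Tw 1) (Submodule.subset_span ⟨1, rfl⟩)
  rwa [Tw_one, mul_one] at this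

theorem sum_coef (z : H d) : z = ∑ w, coef z w • Tw w := by
  have hz : z ∈ Submodule.span A (Set.range (Tw (d := d))) := by rw [span_Tw]; trivial
  induction hz using Submodule.span_induction with
  | mem x hx =>
    obtain ⟨w, rfl⟩ := hx
    rw [coef_Tw]
    simp [dl]
  | zero => simp
  | add x y _ _ hx hy =>
    simp only [map_add, Pi.add_apply, add_smul, Finset.sum_add_distrib]
    rw [← hx, ← hy]
  | smul a x _ hx =>
    simp only [map_smul, Pi.smul_apply, smul_assoc, ← Finset.smul_sum]
    rw [← hx]

theorem coef_injective : Function.Injective (coef (d := d)) := by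
  intro z z' h
  rw [sum_coef z, sum_coef z', h]

theorem H_ext {z z' : H d} (h : ∀ w, coef z w = coef z' w) : z = z' :=
  coef_injective (funext h)

theorem coef_sum_smul (c : W d → A) : coef (∑ w, c w • Tw w) = c := by
  rw [map_sum]
  conv_rhs => rw [sum_dl c]
  simp only [map_smul, coef_Tw]

/-- `lamOp i` and `rhoOp i` agree on `dl 1`, and `rhoOp i` can be pulled out past `rep d z`, a
combination of operators commuting with it. -/
theorem coef_mul_s (i : Fin d) (z : H d) : coef (z * Tw (s i)) = rhoOp i (coef z) := by
  have h1 : lamOp i (dl 1) = rhoOp i (dl 1) := by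
    have h : 0 < len (s i) := by rw [len_s]; exact one_pos
    rw [lamOp_dl (by rwa [mul_one, len_one]), rhoOp_dl (by rwa [one_mul, len_one]), mul_one,
      one_mul]
  have hc : Commute (rep d z) (rhoOp i) := by
    rw [sum_coef z, map_sum]
    refine Commute.sum_left _ _ _ fun w _ => ?_
    rw [map_smul, rep_Tw]
    exact (lamW_comm w i).smul_left _
  rw [coef_apply, map_mul, rep_Tw, lamW_s, Module.End.mul_apply, h1, ← Module.End.mul_apply, hc.eq]
  rfl

end HeckeBasis

/-! ## Eigenvectors of parabolic subalgebras -/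

theorem q_mul_cancel {a c : A} (h : q * a = q * c) : a = c := by
  have h1 := congrArg (fun x => qInv * x) h
  simpa only [← mul_assoc, mul_comm qInv q, q_mul_qInv, one_mul] using h1

namespace Lab

variable {d : ℕ} (b : Lab d)

/-- The scalar by which `T_{s_i}` acts on `[xy]`. -/
def eps (i : Fin d) : A := q * b.eta i

/-- This says that `eps i` is a root of the quadratic relation of `T_{s_i}`. -/
theorem eta_quad (i : Fin d) : 1 + (q - 1) * b.eta i = q * b.eta i * b.eta i := by
  have h := q_mul_qInv
  unfold eta
  split_ifs
  · linear_combination (-1 - qInv) * h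
  · ring

/-- `z` is an eigenvector for left multiplication by the parabolic subalgebra. -/
def LeftEig (z : H d) : Prop := ∀ i, b.gen i → Tw (s i) * z = b.eps i • z

/-- `z` is an eigenvector for right multiplication by the parabolic subalgebra. -/
def RightEig (z : H d) : Prop := ∀ i, b.gen i → z * Tw (s i) = b.eps i • z

/-- The equations at the elements lengthened by `s i` give the stated recursion after cancelling
`q`; those at the remaining elements follow from it by `eta_quad`. -/
theorem leftEig_iff {z : H d} : b.LeftEig z ↔
    ∀ i, b.gen i → ∀ w, len w < len (s i * w) → coef z (s i * w) = b.eta i * coef z w := by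
  refine forall_congr' fun i => forall_congr' fun hi => ?_
  constructor
  · intro h w hw
    have h1 := congrFun (congrArg coef h) w
    rw [coef_s_mul, lamOp_apply, if_pos hw, map_smul, Pi.smul_apply, smul_eq_mul, eps,
      mul_assoc] at h1
    exact q_mul_cancel h1
  · intro h
    apply H_ext
    intro w
    rw [coef_s_mul, lamOp_apply, map_smul, Pi.smul_apply, smul_eq_mul, eps]
    split_ifs with hw
    · rw [h w hw, mul_assoc]
    · have h1 := h (s i * w) (len_s_mul_not_lt.2 hw)
      rw [s_mul_s_mul] at h1
      rw [h1]
      linear_combination coef z (s i * w) * b.eta_quad i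

theorem rightEig_iff {z : H d} : b.RightEig z ↔
    ∀ i, b.gen i → ∀ w, len w < len (w * s i) → coef z (w * s i) = b.eta i * coef z w := by
  refine forall_congr' fun i => forall_congr' fun hi => ?_
  constructor
  · intro h w hw
    have h1 := congrFun (congrArg coef h) w
    rw [coef_mul_s, rhoOp_apply, if_pos hw, map_smul, Pi.smul_apply, smul_eq_mul, eps,
      mul_assoc] at h1
    exact q_mul_cancel h1
  · intro h
    apply H_ext
    intro w
    rw [coef_mul_s, rhoOp_apply, map_smul, Pi.smul_apply, smul_eq_mul, eps]
    split_ifs with hw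
    · rw [h w hw, mul_assoc]
    · have h1 := h (w * s i) (len_mul_s_not_lt.2 hw)
      rw [mul_s_mul_s] at h1
      rw [h1]
      linear_combination coef z (w * s i) * b.eta_quad i

variable {b}

theorem LeftEig.mul_right {z : H d} (h : b.LeftEig z) (y : H d) : b.LeftEig (z * y) := by
  intro i hi
  rw [← mul_assoc, h i hi, smul_mul_assoc]

theorem RightEig.mul_left {z : H d} (h : b.RightEig z) (y : H d) : b.RightEig (y * z) := by
  intro i hi
  rw [mul_assoc, h i hi, mul_smul_comm]

theorem LeftEig.sub {z z' : H d} (h : b.LeftEig z) (h' : b.LeftEig z') : b.LeftEig (z - z') := by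
  intro i hi
  rw [mul_sub, h i hi, h' i hi, smul_sub]

theorem RightEig.sub {z z' : H d} (h : b.RightEig z) (h' : b.RightEig z') :
    b.RightEig (z - z') := by
  intro i hi
  rw [sub_mul, h i hi, h' i hi, smul_sub]

theorem LeftEig.smul {z : H d} (h : b.LeftEig z) (a : A) : b.LeftEig (a • z) := by
  intro i hi
  rw [mul_smul_comm, h i hi, smul_comm]

theorem RightEig.smul {z : H d} (h : b.RightEig z) (a : A) : b.RightEig (a • z) := by
  intro i hi
  rw [smul_mul_assoc, h i hi, smul_comm]

theorem leftEig_zero : b.LeftEig 0 := by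
  intro i _
  rw [mul_zero, smul_zero]

theorem rightEig_zero : b.RightEig 0 := by
  intro i _
  rw [zero_mul, smul_zero]

/-- A one-sided or two-sided eigenvector vanishing at the minimal coset representatives vanishes. -/
theorem eig_eq_zero {b' : Lab d} {z : H d} (h : b.LeftEig z) (h' : b'.RightEig z)
    (h0 : ∀ w, b.Inc w⁻¹ → b'.Inc w → coef z w = 0) : z = 0 := by
  apply H_ext
  intro w
  rw [map_zero, Pi.zero_apply]
  induction hk : len w using Nat.strong_induction_on generalizing w with
  | _ k ih =>
    by_cases h1 : b.Inc w⁻¹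
    · by_cases h2 : b'.Inc w
      · exact h0 w h1 h2
      · rw [inc_iff_len] at h2
        push Not at h2
        obtain ⟨i, hi, hle⟩ := h2
        have h3 := len_mul_s_of_not_lt (not_lt.2 hle)
        have h4 := b'.rightEig_iff.1 h' i hi (w * s i) (len_mul_s_not_lt.2 (not_lt.2 hle))
        rw [mul_s_mul_s, ih _ (by omega) (w * s i) rfl, mul_zero] at h4
        exact h4
    · rw [inc_inv_iff_len] at h1
      push Not at h1
      obtain ⟨i, hi, hle⟩ := h1
      have h3 := len_s_mul_of_not_lt (not_lt.2 hle)
      have h4 := b.leftEig_iff.1 h i hi (s i * w) (len_s_mul_not_lt.2 (not_lt.2 hle))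
      rw [s_mul_s_mul, ih _ (by omega) (s i * w) rfl, mul_zero] at h4
      exact h4

variable (d) in
/-- The partition into singletons. -/
def discrete : Lab d where
  f x := x.1
  mono _ _ h := h
  neg _ := rfl
  odd _ := False
  odd_neg _ := Iff.rfl
  odd_congr _ _ _ := Iff.rfl

theorem discrete_not_gen (i : Fin d) : ¬ (discrete d).gen i := by
  intro h
  have : (pt i).1 = (ptSucc i).1 := h
  rw [coe_pt, coe_ptSucc] at this
  omega

/-- The discrete partition has no generators, so every element is an eigenvector for it and the
two-sided statement specialises. -/
theorem LeftEig.eq_zero {z : H d} (h : b.LeftEig z) (h0 : ∀ w, b.Inc w⁻¹ → coef z w = 0) :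
    z = 0 :=
  eig_eq_zero (b' := discrete d) h (fun i hi => absurd hi (discrete_not_gen i))
    (fun w hw _ => h0 w hw)

theorem RightEig.eq_zero {z : H d} (h : b.RightEig z) (h0 : ∀ w, b.Inc w → coef z w = 0) :
    z = 0 :=
  eig_eq_zero (b := discrete d) (fun i hi => absurd hi (discrete_not_gen i)) h
    (fun w _ hw => h0 w hw)

variable (b)

open Classical in
/-- The element `[xy]`. -/
def Z : H d := ∑ w with w ∈ b.grp, b.chi w • Tw w

open Classical in
theorem Z_eq : b.Z = ∑ w, (if w ∈ b.grp then b.chi w else 0) • Tw w := by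
  unfold Z
  rw [Finset.sum_filter]
  refine Finset.sum_congr rfl fun w _ => ?_
  split_ifs
  · rfl
  · rw [zero_smul]

open Classical in
theorem coef_Z (w : W d) : coef b.Z w = if w ∈ b.grp then b.chi w else 0 := by
  rw [Z_eq, coef_sum_smul]

theorem coef_Z_one : coef b.Z 1 = 1 := by
  rw [coef_Z, if_pos b.grp.one_mem, chi_one]

theorem leftEig_Z : b.LeftEig b.Z := by
  rw [leftEig_iff]
  intro i hi w hw
  rw [coef_Z, coef_Z]
  by_cases h : w ∈ b.grp
  · rw [if_pos h, if_pos (b.grp.mul_mem (b.s_mem hi) h), b.chi_s_mul h hi hw]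
  · rw [if_neg h, if_neg, mul_zero]
    rwa [b.grp.mul_mem_cancel_left (b.s_mem hi)]

theorem rightEig_Z : b.RightEig b.Z := by
  rw [rightEig_iff]
  intro i hi w hw
  rw [coef_Z, coef_Z]
  by_cases h : w ∈ b.grp
  · rw [if_pos h, if_pos (b.grp.mul_mem h (b.s_mem hi)), b.chi_mul_s hi (len_lt_mul_s.1 hw),
      mul_comm]
  · rw [if_neg h, if_neg, mul_zero]
    rwa [b.grp.mul_mem_cancel_right (b.s_mem hi)]

open Classical in
theorem Z_mul_Tw {g : W d} (hg : b.Inc g⁻¹) :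
    b.Z * Tw g = ∑ u with u ∈ b.grp, b.chi u • Tw (u * g) := by
  unfold Z
  rw [Finset.sum_mul]
  refine Finset.sum_congr rfl fun u hu => ?_
  rw [smul_mul_assoc, Tw_mul _ _ (b.len_mul_left hg (Finset.mem_filter.1 hu).2)]

open Classical in
theorem Tw_mul_Z {g : W d} (hg : b.Inc g) :
    Tw g * b.Z = ∑ u with u ∈ b.grp, b.chi u • Tw (g * u) := by
  unfold Z
  rw [Finset.mul_sum]
  refine Finset.sum_congr rfl fun u hu => ?_
  rw [mul_smul_comm, Tw_mul _ _ (b.len_mul hg (Finset.mem_filter.1 hu).2)]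

open Classical in
theorem coef_Tw' (u w : W d) : coef (Tw u) w = if w = u then 1 else 0 := by
  rw [coef_Tw]; rfl

/-- The product is a combination of `Tw (u * g)` with `u` in the subgroup, and only `u = 1` gives a
minimal coset representative. -/
theorem coef_Z_mul_Tw {g w : W d} (hg : b.Inc g⁻¹) (hw : b.Inc w⁻¹) :
    coef (b.Z * Tw g) w = coef (Tw g) w := by
  classical
  rw [b.Z_mul_Tw hg, map_sum, Finset.sum_apply, Finset.sum_eq_single 1]
  · rw [chi_one, one_smul, one_mul]
  · intro u hu hu1
    rw [map_smul, Pi.smul_apply, coef_Tw', if_neg, smul_zero]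
    rintro rfl
    exact hu1 (b.eq_one_of_inc_left hg (Finset.mem_filter.1 hu).2 hw)
  · intro h
    exact absurd (Finset.mem_filter.2 ⟨Finset.mem_univ _, b.grp.one_mem⟩) h

theorem coef_Tw_mul_Z {g w : W d} (hg : b.Inc g) (hw : b.Inc w) :
    coef (Tw g * b.Z) w = coef (Tw g) w := by
  classical
  rw [b.Tw_mul_Z hg, map_sum, Finset.sum_apply, Finset.sum_eq_single 1]
  · rw [chi_one, one_smul, mul_one]
  · intro u hu hu1
    rw [map_smul, Pi.smul_apply, coef_Tw', if_neg, smul_zero]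
    rintro rfl
    exact hu1 (b.eq_one_of_inc hg (Finset.mem_filter.1 hu).2 hw)
  · intro h
    exact absurd (Finset.mem_filter.2 ⟨Finset.mem_univ _, b.grp.one_mem⟩) h

variable {b}

-- The products `b.Z * Tw g`, with `g` minimal, are eigenvectors dual to evaluation at the minimal
-- representatives, and such evaluations determine an eigenvector.
open Classical in
theorem LeftEig.eq_Z_mul {z : H d} (h : b.LeftEig z) :
    z = b.Z * ∑ g with b.Inc g⁻¹, coef z g • Tw g := by
  rw [← sub_eq_zero]
  apply (h.sub (b.leftEig_Z.mul_right _)).eq_zero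
  intro w hw
  rw [Finset.mul_sum, map_sub, map_sum, Pi.sub_apply, Finset.sum_apply, sub_eq_zero]
  rw [Finset.sum_eq_single_of_mem w (Finset.mem_filter.2 ⟨Finset.mem_univ _, hw⟩)]
  · rw [mul_smul_comm, map_smul, Pi.smul_apply, b.coef_Z_mul_Tw hw hw, coef_Tw', if_pos rfl,
      smul_eq_mul, mul_one]
  · intro g hg hne
    rw [mul_smul_comm, map_smul, Pi.smul_apply, b.coef_Z_mul_Tw (Finset.mem_filter.1 hg).2 hw,
      coef_Tw', if_neg hne.symm, smul_zero]

theorem LeftEig.exists_eq {z : H d} (h : b.LeftEig z) : ∃ y, z = b.Z * y := ⟨_, h.eq_Z_mul⟩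

theorem RightEig.exists_eq {z : H d} (h : b.RightEig z) : ∃ y, z = y * b.Z := by
  classical
  refine ⟨∑ g with b.Inc g, coef z g • Tw g, ?_⟩
  rw [← sub_eq_zero]
  apply (h.sub (b.rightEig_Z.mul_left _)).eq_zero
  intro w hw
  rw [Finset.sum_mul, map_sub, map_sum, Pi.sub_apply, Finset.sum_apply, sub_eq_zero]
  rw [Finset.sum_eq_single_of_mem w (Finset.mem_filter.2 ⟨Finset.mem_univ _, hw⟩)]
  · rw [smul_mul_assoc, map_smul, Pi.smul_apply, b.coef_Tw_mul_Z hw hw, coef_Tw', if_pos rfl,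
      smul_eq_mul, mul_one]
  · intro g hg hne
    rw [smul_mul_assoc, map_smul, Pi.smul_apply, b.coef_Tw_mul_Z (Finset.mem_filter.1 hg).2 hw,
      coef_Tw', if_neg hne.symm, smul_zero]

/-! ### Supports -/

variable (b)

/-- Left multiplication by the parabolic subalgebra preserves supports closed under the group. -/
theorem coef_Tw_mul_eq_zero {S : Set (W d)} (hS : ∀ u ∈ b.grp, ∀ w, u * w ∈ S → w ∈ S) :
    ∀ u ∈ b.grp, ∀ z : H d, (∀ w, w ∉ S → coef z w = 0) → ∀ w, w ∉ S → coef (Tw u * z) w = 0 := by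
  refine b.induct (motive := fun u => ∀ z : H d, (∀ w, w ∉ S → coef z w = 0) →
    ∀ w, w ∉ S → coef (Tw u * z) w = 0) ?_ ?_
  · intro z hz w hw
    rw [Tw_one, one_mul, hz w hw]
  · intro u _ i hi hlt ih z hz w hw
    rw [← Tw_mul_s_of_lt (len_lt_mul_s.2 hlt), mul_assoc]
    refine ih _ (fun w hw => ?_) w hw
    have h1 : s i * w ∉ S := fun h => hw (hS _ (b.s_mem hi) _ h)
    rw [coef_s_mul, lamOp_apply, hz w hw, hz _ h1]
    simp

theorem coef_mul_Tw_eq_zero {S : Set (W d)} (hS : ∀ u ∈ b.grp, ∀ w, w * u ∈ S → w ∈ S) :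
    ∀ u ∈ b.grp, ∀ z : H d, (∀ w, w ∉ S → coef z w = 0) → ∀ w, w ∉ S → coef (z * Tw u) w = 0 := by
  refine b.induct (motive := fun u => ∀ z : H d, (∀ w, w ∉ S → coef z w = 0) →
    ∀ w, w ∉ S → coef (z * Tw u) w = 0) ?_ ?_
  · intro z hz w hw
    rw [Tw_one, mul_one, hz w hw]
  · intro u _ i hi hlt ih z hz w hw
    have h1 : w * s i ∉ S := fun h => hw (hS _ (b.s_mem hi) _ h)
    rw [← Tw_mul_s_of_lt (len_lt_mul_s.2 hlt), ← mul_assoc, coef_mul_s, rhoOp_apply,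
      ih z hz w hw, ih z hz _ h1]
    simp

theorem coef_Z_mul_eq_zero {S : Set (W d)} (hS : ∀ u ∈ b.grp, ∀ w, u * w ∈ S → w ∈ S)
    {z : H d} (hz : ∀ w, w ∉ S → coef z w = 0) {w : W d} (hw : w ∉ S) :
    coef (b.Z * z) w = 0 := by
  classical
  unfold Z
  rw [Finset.sum_mul, map_sum, Finset.sum_apply]
  refine Finset.sum_eq_zero fun u hu => ?_
  rw [smul_mul_assoc, map_smul, Pi.smul_apply,
    b.coef_Tw_mul_eq_zero hS u (Finset.mem_filter.1 hu).2 z hz w hw, smul_zero]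

theorem coef_mul_Z_eq_zero {S : Set (W d)} (hS : ∀ u ∈ b.grp, ∀ w, w * u ∈ S → w ∈ S)
    {z : H d} (hz : ∀ w, w ∉ S → coef z w = 0) {w : W d} (hw : w ∉ S) :
    coef (z * b.Z) w = 0 := by
  classical
  unfold Z
  rw [Finset.mul_sum, map_sum, Finset.sum_apply]
  refine Finset.sum_eq_zero fun u hu => ?_
  rw [mul_smul_comm, map_smul, Pi.smul_apply,
    b.coef_mul_Tw_eq_zero hS u (Finset.mem_filter.1 hu).2 z hz w hw, smul_zero]

/-- A left eigenvector supported on the parabolic subgroup is a multiple of `Z`. -/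
theorem eq_smul_Z {z : H d} (h : b.LeftEig z) (hz : ∀ w, w ∉ b.grp → coef z w = 0) :
    z = coef z 1 • b.Z := by
  rw [← sub_eq_zero]
  apply (h.sub (b.leftEig_Z.smul _)).eq_zero
  intro w hw
  rw [map_sub, Pi.sub_apply, map_smul, Pi.smul_apply, smul_eq_mul]
  by_cases hg : w ∈ b.grp
  · have h1 : b.Inc (1 : W d)⁻¹ := by rw [inv_one]; exact fun _ _ h _ => h
    have : w = 1 := b.eq_one_of_inc_left h1 hg (by rwa [mul_one])
    rw [this, coef_Z_one, mul_one, sub_self]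
  · rw [hz w hg, coef_Z, if_neg hg, mul_zero, sub_zero]

end Lab

/-! ## Double cosets -/

/-- Evaluation at `v = 1`. -/
def evalOne : A →+* ℤ := LaurentPolynomial.eval₂ (RingHom.id ℤ) 1

theorem evalOne_vpow (k : ℤ) : evalOne (vpow k) = 1 := by
  unfold evalOne vpow
  rw [LaurentPolynomial.eval₂_T]; simp

theorem evalOne_q : evalOne q = 1 := evalOne_vpow 2

theorem evalOne_qInv : evalOne qInv = 1 := evalOne_vpow (-2)

theorem H_smul_cancel {d : ℕ} {a : A} (ha : a ≠ 0) {z z' : H d} (h : a • z = a • z') : z = z' := by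
  apply H_ext
  intro w
  have h1 := congrFun (congrArg coef h) w
  simp only [map_smul, Pi.smul_apply, smul_eq_mul] at h1
  exact mul_left_cancel₀ ha h1

namespace Lab

variable {d : ℕ} (b : Lab d)

open Classical in
/-- The scalar with `Z * Z = P • Z`. -/
def P : A := ∑ w with w ∈ b.grp, b.chi w * (q ^ len w * b.chi w)

/-- At $v=1$ every summand becomes the square of a sign, so `P` specialises to the order of the
subgroup. This permits division by `P` later on. -/
theorem P_ne_zero : b.P ≠ 0 := by
  classical
  intro h
  have h1 := congrArg evalOne h
  unfold P at h1
  rw [map_sum, map_zero] at h1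
  have h2 : ∀ w, evalOne (b.chi w * (q ^ len w * b.chi w)) = 1 := by
    intro w
    unfold chi
    simp only [map_mul, map_pow, map_neg, evalOne_q, evalOne_qInv, one_pow, one_mul]
    rw [← mul_pow]; simp
  simp only [h2, Finset.sum_const, nsmul_eq_mul, mul_one] at h1
  have h3 : (Finset.univ.filter fun w => w ∈ b.grp).card = 0 := by exact_mod_cast h1
  rw [Finset.card_eq_zero] at h3
  have : (1 : W d) ∈ (Finset.univ.filter fun w => w ∈ b.grp) :=
    Finset.mem_filter.2 ⟨Finset.mem_univ _, b.grp.one_mem⟩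
  rw [h3] at this
  exact absurd this (Finset.notMem_empty _)

variable {b} in
theorem RightEig.mul_Tw {z : H d} (h : b.RightEig z) :
    ∀ u ∈ b.grp, z * Tw u = (q ^ len u * b.chi u) • z := by
  refine b.induct (motive := fun u => z * Tw u = (q ^ len u * b.chi u) • z) ?_ ?_
  · rw [Tw_one, mul_one, len_one, chi_one, pow_zero, one_mul, one_smul]
  · intro u _ i hi hlt ih
    rw [← Tw_mul_s_of_lt (len_lt_mul_s.2 hlt), ← mul_assoc, ih, smul_mul_assoc, h i hi, smul_smul,
      len_mul_s_of_lt hlt, b.chi_mul_s hi hlt, eps]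
    have : q ^ len u * b.chi u * (q * b.eta i) = q ^ (len u + 1) * (b.chi u * b.eta i) := by
      generalize b.chi u = x
      generalize b.eta i = y
      ring
    rw [this]

variable {b} in
theorem RightEig.mul_Z {z : H d} (h : b.RightEig z) : z * b.Z = b.P • z := by
  classical
  unfold Z P
  rw [Finset.mul_sum, Finset.sum_smul]
  refine Finset.sum_congr rfl fun u hu => ?_
  rw [mul_smul_comm, h.mul_Tw u (Finset.mem_filter.1 hu).2, smul_smul]

/-! ### The partition belonging to $W_\delta$, and two-sided eigenvectors -/

variable (a : Lab d)

/-- `M` bounds the labels. -/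
theorem exists_bound : ∃ M : ℤ, ∀ x, -M ≤ a.f x ∧ a.f x ≤ M := by
  refine ⟨∑ x, |a.f x|, fun x => ?_⟩
  have h := Finset.single_le_sum (f := fun x => |a.f x|) (fun _ _ => abs_nonneg _)
    (Finset.mem_univ x)
  exact abs_le.1 h

/-- A bound for the labels. -/
def bound : ℤ := Classical.choose a.exists_bound

theorem le_bound (x : SInt d) : -a.bound ≤ a.f x ∧ a.f x ≤ a.bound :=
  Classical.choose_spec a.exists_bound x

/-- Pairs of labels are encoded lexicographically in one integer: with the second label in
$[-M..M]$, the factor $2M+1$ makes the first label dominate, and negation is respected. -/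
theorem meet_aux {M y y' z z' : ℤ} (h1 : -M ≤ y ∧ y ≤ M) (h2 : -M ≤ y' ∧ y' ≤ M) (h : z < z') :
    (2 * M + 1) * z + y < (2 * M + 1) * z' + y' := by
  nlinarith

theorem meet_f_eq {M y y' z z' : ℤ} (h1 : -M ≤ y ∧ y ≤ M) (h2 : -M ≤ y' ∧ y' ≤ M) :
    (2 * M + 1) * z + y = (2 * M + 1) * z' + y' ↔ z = z' ∧ y = y' := by
  constructor
  · intro h
    rcases lt_trichotomy z z' with hz | hz | hz
    · have := meet_aux h1 h2 hz; omega
    · subst hz; exact ⟨rfl, by omega⟩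
    · have := meet_aux h2 h1 hz; omega
  · rintro ⟨rfl, rfl⟩; rfl

/-- The common refinement of `b` and of the preimage of `a` under `g`. -/
def meet (g : W d) (hg : b.Inc g) : Lab d where
  f x := (2 * a.bound + 1) * b.f x + a.f (g.1 x)
  mono := by
    intro x y hxy
    rcases hxy.lt_or_eq with hlt | rfl
    · rcases (b.mono hxy).lt_or_eq with hb | hb
      · exact (meet_aux (a.le_bound _) (a.le_bound _) hb).le
      -- Inside a block of `b` the element `g` is increasing, so the refinement again consists of
      -- intervals.
      · have := a.mono (hg x y hlt hb).le
        dsimp only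
        rw [hb]; omega
    · exact le_rfl
  neg x := by rw [W_neg, a.neg, b.neg]; ring
  odd := b.odd
  odd_neg := b.odd_neg
  odd_congr x y h := b.odd_congr x y ((meet_f_eq (a.le_bound _) (a.le_bound _)).1 h).1

variable {a b} {g : W d} {hg : b.Inc g}

theorem meet_eq_iff {x y : SInt d} : (b.meet a g hg).f x = (b.meet a g hg).f y ↔
    b.f x = b.f y ∧ a.f (g.1 x) = a.f (g.1 y) :=
  meet_f_eq (a.le_bound _) (a.le_bound _)

theorem mem_meet_grp {w : W d} : w ∈ (b.meet a g hg).grp ↔ w ∈ b.grp ∧ g * w * g⁻¹ ∈ a.grp := by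
  simp only [mem_grp, meet_eq_iff]
  rw [forall_and]
  apply and_congr Iff.rfl
  constructor
  · intro h x
    have := h ((g⁻¹).1 x)
    rwa [W_apply_inv_self] at this
  · intro h x
    have := h (g.1 x)
    rwa [W_mul_apply, W_mul_apply, W_inv_apply_self] at this

theorem meet_gen {i : Fin d} : (b.meet a g hg).gen i ↔ b.gen i ∧
    a.f (g.1 (pt i)) = a.f (g.1 (ptSucc i)) := meet_eq_iff

theorem meet_eta (i : Fin d) : (b.meet a g hg).eta i = b.eta i := rfl

/-- A simple reflection of `W_δ` is conjugate under a minimal `g` to a simple reflection. -/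
theorem exists_conj (hg' : a.Inc g⁻¹) {i : Fin d} (hi : (b.meet a g hg).gen i) :
    ∃ j, a.gen j ∧ s j * g = g * s i ∧ (a.odd (pt j) ↔ a.odd (g.1 (pt i))) := by
  obtain ⟨hb, ha⟩ := meet_gen.1 hi
  have hlt := hg _ _ (pt_lt_ptSucc i) hb
  -- A point strictly between the images would lie in the same block of `a`, and by minimality of
  -- `g` on that side its preimage would lie strictly between $i$ and $i+1$.
  have hsucc : (g.1 (ptSucc i)).1 = (g.1 (pt i)).1 + 1 := by
    have h1 := Subtype.coe_lt_coe.2 hlt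
    by_contra hne
    have hx := Finset.mem_Icc.1 (g.1 (pt i)).2
    have hy := Finset.mem_Icc.1 (g.1 (ptSucc i)).2
    let z : SInt d := ⟨(g.1 (pt i)).1 + 1, by rw [Finset.mem_Icc]; omega⟩
    have z1 : g.1 (pt i) < z := Subtype.coe_lt_coe.1 (by change _ < (g.1 (pt i)).1 + 1; omega)
    have z2 : z < g.1 (ptSucc i) :=
      Subtype.coe_lt_coe.1 (by change (g.1 (pt i)).1 + 1 < _; omega)
    have a1 := a.mono z1.le
    have a2 := a.mono z2.le
    have h2 := hg' _ _ z1 (by omega)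
    have h3 := hg' _ _ z2 (by omega)
    rw [W_inv_apply_self] at h2 h3
    have h4 := Subtype.coe_lt_coe.2 h2
    have h5 := Subtype.coe_lt_coe.2 h3
    rw [coe_pt] at h4
    rw [coe_ptSucc] at h5
    omega
  have hx := Finset.mem_Icc.1 (g.1 (pt i)).2
  have hy := Finset.mem_Icc.1 (g.1 (ptSucc i)).2
  by_cases h0 : 0 ≤ (g.1 (pt i)).1
  · have e1 : g.1 (pt i) = pt ⟨(g.1 (pt i)).1.toNat, by omega⟩ :=
      Subtype.ext (by rw [coe_pt]; simp; omega)
    have e2 : g.1 (ptSucc i) = ptSucc ⟨(g.1 (pt i)).1.toNat, by omega⟩ :=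
      Subtype.ext (by rw [coe_ptSucc]; simp; omega)
    refine ⟨⟨(g.1 (pt i)).1.toNat, by omega⟩, ?_, s_mul_eq_mul_s (Or.inl ⟨e1, e2⟩), ?_⟩
    · unfold gen; rw [← e1, ← e2]; exact ha
    · rw [← e1]
  -- If the image pair lies in the negative half, its negative is the pair of a simple reflection,
  -- in reversed order.
  · have e1 : -g.1 (ptSucc i) = pt ⟨(-(g.1 (ptSucc i)).1).toNat, by omega⟩ :=
      Subtype.ext (by rw [coe_pt, coe_neg]; simp; omega)
    have e2 : -g.1 (pt i) = ptSucc ⟨(-(g.1 (ptSucc i)).1).toNat, by omega⟩ :=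
      Subtype.ext (by rw [coe_ptSucc, coe_neg]; simp; omega)
    refine ⟨⟨(-(g.1 (ptSucc i)).1).toNat, by omega⟩, ?_,
      s_mul_eq_mul_s (Or.inr (Or.inr (Or.inr ⟨?_, ?_⟩))), ?_⟩
    · unfold gen; rw [← e1, ← e2, a.neg, a.neg, ha]
    · rw [← e2, sint_neg_neg]
    · rw [← e1, sint_neg_neg]
    · rw [← e1, a.odd_neg]; exact (a.odd_congr _ _ ha).symm

variable (a b g) in
/-- `g` is minimal in its double coset. -/
def DMin : Prop := a.Inc g⁻¹ ∧ b.Inc g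

variable (a b g hg) in
/-- The characters of the two parabolic subgroups agree on `W_δ`. -/
def Compat : Prop := ∀ i, (b.meet a g hg).gen i → (b.odd (pt i) ↔ a.odd (g.1 (pt i)))

/-- $T_gT_{s_i}=T_{s_j}T_g$ for the conjugate generator $s_j$ of $W_\mu$, and compatibility says
that both generators act by the same scalar. -/
theorem rightEig_Z_mul_Tw (hg' : a.Inc g⁻¹) (hc : b.Compat a g hg) :
    (b.meet a g hg).RightEig (a.Z * Tw g) := by
  intro i hi
  obtain ⟨j, hj, hs, ho⟩ := exists_conj hg' hi
  have h1 : len g < len (g * s i) := b.inc_iff_len.1 hg i (meet_gen.1 hi).1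
  have h2 : len g < len (s j * g) := by rw [hs]; exact h1
  have h3 : a.eps j = (b.meet a g hg).eps i := by
    unfold eps
    congr 1
    rw [meet_eta]
    unfold eta
    have := hc i hi
    congr 1
    rw [eq_iff_iff]
    exact ho.trans this.symm
  rw [mul_assoc, Tw_mul_s_of_lt h1, ← hs, ← Tw_s_mul_of_lt h2, ← mul_assoc, a.rightEig_Z j hj,
    smul_mul_assoc, h3]

variable (a b g hg) in
open Classical in
/-- The element `T_{W_a g W_b}`. -/
def dbl : H d :=
  a.Z * Tw g * ∑ v with v ∈ b.grp ∧ (b.meet a g hg).Inc v⁻¹, b.chi v • Tw v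

theorem meet_Z_mul : b.Z = (b.meet a g hg).Z *
    open Classical in ∑ v with v ∈ b.grp ∧ (b.meet a g hg).Inc v⁻¹, b.chi v • Tw v := by
  classical
  have h1 : (b.meet a g hg).LeftEig b.Z := fun i hi => b.leftEig_Z i (meet_gen.1 hi).1
  conv_lhs => rw [h1.eq_Z_mul]
  congr 1
  rw [Finset.sum_filter, Finset.sum_filter]
  refine Finset.sum_congr rfl fun w _ => ?_
  rw [coef_Z]
  by_cases c1 : w ∈ b.grp <;> by_cases c2 : (b.meet a g hg).Inc w⁻¹ <;> simp [c1, c2]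

/-- `b.Z` factors as the element `Z` of $W_\delta$ times the sum over minimal coset representatives,
and `a.Z * Tw g` absorbs the first factor at the cost of `P`. The symmetric right side shows the
right eigenvector property and makes the bar conjugate accessible. -/
theorem P_smul_dbl (hg' : a.Inc g⁻¹) (hc : b.Compat a g hg) :
    (b.meet a g hg).P • b.dbl a g hg = a.Z * Tw g * b.Z := by
  conv_rhs => rw [meet_Z_mul (a := a) (g := g) (hg := hg)]
  rw [← mul_assoc, (rightEig_Z_mul_Tw hg' hc).mul_Z, smul_mul_assoc]
  rfl

theorem leftEig_dbl : a.LeftEig (b.dbl a g hg) := by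
  unfold dbl
  rw [mul_assoc]
  exact a.leftEig_Z.mul_right _

theorem rightEig_dbl (hg' : a.Inc g⁻¹) (hc : b.Compat a g hg) : b.RightEig (b.dbl a g hg) := by
  intro i hi
  apply H_smul_cancel (b.meet a g hg).P_ne_zero
  rw [← smul_mul_assoc, P_smul_dbl hg' hc, smul_comm, P_smul_dbl hg' hc, mul_assoc, b.rightEig_Z i hi,
    mul_smul_comm]

/-- Take two points of an `a`-block. If their preimages under `g` share a `b`-block, minimality of
`v` for $W_\delta$ applies; otherwise `v` preserves the order of the two `b`-blocks. -/
theorem inc_mul_inv (hg' : a.Inc g⁻¹) {v : W d} (hv : v ∈ b.grp)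
    (hv' : (b.meet a g hg).Inc v⁻¹) : a.Inc (g * v)⁻¹ := by
  intro x y hxy ha
  rw [mul_inv_rev, W_mul_apply, W_mul_apply]
  have h1 := hg' x y hxy ha
  by_cases hb : b.f ((g⁻¹).1 x) = b.f ((g⁻¹).1 y)
  · exact hv' _ _ h1 (meet_eq_iff.2 ⟨hb, by rwa [W_apply_inv_self, W_apply_inv_self]⟩)
  · by_contra hle
    have h2 := b.mono (not_lt.1 hle)
    rw [b.grp.inv_mem hv, b.grp.inv_mem hv] at h2
    exact hb (le_antisymm (b.mono h1.le) h2)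

-- Each `g * v` in the expansion is minimal for the left subgroup, so `a.Z * Tw (g * v)` meets a
-- minimal `w` only if `w = g * v`; minimality of `w` on the right then forces `v = 1`.
open Classical in
theorem coef_dbl (hg' : a.Inc g⁻¹) {w : W d} (hw : b.DMin a w) :
    coef (b.dbl a g hg) w = if w = g then 1 else 0 := by
  unfold dbl
  rw [Finset.mul_sum, map_sum, Finset.sum_apply]
  have key : ∀ v, v ∈ b.grp ∧ (b.meet a g hg).Inc v⁻¹ →
      coef (a.Z * Tw g * b.chi v • Tw v) w = if w = g * v then b.chi v else 0 := by
    rintro v ⟨hv, hv'⟩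
    rw [mul_smul_comm, mul_assoc, Tw_mul _ _ (b.len_mul hg hv), map_smul, Pi.smul_apply,
      a.coef_Z_mul_Tw (inc_mul_inv hg' hv hv') hw.1, coef_Tw']
    split_ifs <;> simp
  have h1 : (b.meet a g hg).Inc (1 : W d)⁻¹ := by rw [inv_one]; exact fun _ _ h _ => h
  rw [Finset.sum_eq_single 1]
  · rw [key 1 ⟨b.grp.one_mem, h1⟩, mul_one, chi_one]
  · intro v hv hv1
    have hv := (Finset.mem_filter.1 hv).2
    rw [key v hv, if_neg]
    rintro rfl
    exact hv1 (b.eq_one_of_inc hg hv.1 hw.2)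
  · intro h
    exact absurd (Finset.mem_filter.2 ⟨Finset.mem_univ _, b.grp.one_mem, h1⟩) h

/-- At a generator where the characters disagree, the coefficient at $gs_i=s_jg$ is both $1$ and
$-q^{-1}$ times the coefficient at $g$, so $1+q^{-1}$ kills the latter. -/
theorem coef_eq_zero_of_not_compat (hg' : a.Inc g⁻¹) (hc : ¬ b.Compat a g hg) {z : H d}
    (hz : a.LeftEig z) (hz' : b.RightEig z) : coef z g = 0 := by
  unfold Compat at hc
  push Not at hc
  obtain ⟨i, hi, hne⟩ := hc
  obtain ⟨j, hj, hs, ho⟩ := exists_conj hg' hi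
  have h1 : len g < len (g * s i) := b.inc_iff_len.1 hg i (meet_gen.1 hi).1
  have e1 := b.rightEig_iff.1 hz' i (meet_gen.1 hi).1 g h1
  have e2 := a.leftEig_iff.1 hz j hj g (by rw [hs]; exact h1)
  rw [hs, e1] at e2
  unfold eta at e2
  have hq : (1 + qInv : A) ≠ 0 := by
    intro h
    have := congrArg evalOne h
    rw [map_add, map_one, evalOne_qInv, map_zero] at this
    omega
  have h3 : (1 + qInv) * coef z g = 0 := by
    have := ho
    split_ifs at e2
    · tauto
    · linear_combination -e2
    · linear_combination e2
    · tauto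
  exact (mul_eq_zero.1 h3).resolve_left hq

theorem eq_zero_of_compat {z : H d} (hz : a.LeftEig z) (hz' : b.RightEig z)
    (h0 : ∀ g (hg : b.Inc g), a.Inc g⁻¹ → b.Compat a g hg → coef z g = 0) : z = 0 := by
  apply eig_eq_zero hz hz'
  intro g hg' hg
  by_cases hc : b.Compat a g hg
  · exact h0 g hg hg' hc
  · exact coef_eq_zero_of_not_compat hg' hc hz hz'

end Lab

/-! ## Compositions as symmetric interval partitions -/

section Comp

variable {m n d : ℕ}

theorem psum_mono (lam : Comp m n d) : Monotone (psum lam) := by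
  intro k l hkl
  unfold psum
  refine Finset.sum_le_sum fun j _ => ?_
  split_ifs <;> omega

theorem psum_last (lam : Comp m n d) {k : ℕ} (hk : m + n ≤ k) : psum lam k = d := by
  refine Eq.trans ?_ lam.2
  unfold psum
  exact Finset.sum_congr rfl fun j _ => if_pos (by omega)

/-- The index of the block containing `x`, for `0 ≤ x ≤ d`. -/
def blockIdx (lam : Comp m n d) (x : ℕ) : ℕ :=
  ((Finset.range (m + n)).filter fun k => psum lam k < x).card

theorem blockIdx_le (lam : Comp m n d) (x : ℕ) : blockIdx lam x ≤ m + n := by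
  unfold blockIdx
  exact (Finset.card_filter_le _ _).trans (Finset.card_range _).le

/-- Partial sums increase, so the indices whose partial sum is below `x` form an initial segment,
and its cardinality is the index of the block. -/
theorem blockIdx_le_iff (lam : Comp m n d) {x k : ℕ} (hx : x ≤ d) :
    blockIdx lam x ≤ k ↔ x ≤ psum lam k := by
  by_cases hk : m + n ≤ k
  · rw [psum_last lam hk]
    exact iff_of_true ((blockIdx_le lam x).trans hk) hx
  · push Not at hk
    unfold blockIdx
    constructor
    · intro h
      by_contra hlt
      push Not at hlt
      have h1 : Finset.range (k + 1) ⊆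
          (Finset.range (m + n)).filter fun k => psum lam k < x := by
        intro j hj
        rw [Finset.mem_range] at hj
        rw [Finset.mem_filter, Finset.mem_range]
        exact ⟨by omega, (psum_mono lam (by omega)).trans_lt hlt⟩
      have := Finset.card_le_card h1
      rw [Finset.card_range] at this
      omega
    · intro h
      have h1 : ((Finset.range (m + n)).filter fun k => psum lam k < x) ⊆ Finset.range k := by
        intro j hj
        rw [Finset.mem_filter] at hj
        rw [Finset.mem_range]
        by_contra hjk
        have := psum_mono lam (not_lt.1 hjk)
        omega
      have := Finset.card_le_card h1
      rwa [Finset.card_range] at this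

theorem blockIdx_mono (lam : Comp m n d) : Monotone (blockIdx lam) := by
  intro x y hxy
  unfold blockIdx
  refine Finset.card_le_card fun j hj => ?_
  rw [Finset.mem_filter] at hj ⊢
  exact ⟨hj.1, hj.2.trans_le hxy⟩

theorem blockIdx_zero (lam : Comp m n d) : blockIdx lam 0 = 0 := by
  unfold blockIdx
  simp

theorem natAbs_le (x : SInt d) : x.1.natAbs ≤ d := by
  have := Finset.mem_Icc.1 x.2
  omega

/-- The interval partition of a composition. -/
def Lab.of (lam : Comp m n d) : Lab d where
  f x := if 0 ≤ x.1 then (blockIdx lam x.1.natAbs : ℤ) else -(blockIdx lam x.1.natAbs : ℤ)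
  mono := by
    intro x y hxy
    have hxy := Subtype.coe_le_coe.2 hxy
    dsimp only
    split_ifs with h1 h2
    · exact_mod_cast blockIdx_mono lam (by omega)
    · omega
    · omega
    · have : blockIdx lam y.1.natAbs ≤ blockIdx lam x.1.natAbs := blockIdx_mono lam (by omega)
      omega
  neg x := by
    have h0 := blockIdx_zero lam
    rw [coe_neg, Int.natAbs_neg]
    by_cases hx : x.1 = 0
    · simp [hx, h0]
    · split_ifs <;> omega
  odd x := m < blockIdx lam x.1.natAbs
  odd_neg x := by rw [coe_neg, Int.natAbs_neg]
  odd_congr x y h := by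
    have : blockIdx lam x.1.natAbs = blockIdx lam y.1.natAbs := by
      split_ifs at h <;> omega
    rw [this]

theorem Lab.of_f (lam : Comp m n d) (x : SInt d) : (Lab.of lam).f x =
    if 0 ≤ x.1 then (blockIdx lam x.1.natAbs : ℤ) else -(blockIdx lam x.1.natAbs : ℤ) := rfl

theorem Lab.of_odd (lam : Comp m n d) (x : SInt d) :
    (Lab.of lam).odd x ↔ m < ((Lab.of lam).f x).natAbs := by
  rw [Lab.of_f]
  change m < _ ↔ _
  split_ifs
  · rw [Int.natAbs_natCast]
  · rw [Int.natAbs_neg, Int.natAbs_natCast]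

theorem mem_block (lam : Comp m n d) (i : SInt (m + n)) (x : SInt d) :
    x ∈ block lam i ↔ (Lab.of lam).f x = i.1 := by
  have hx := natAbs_le x
  have h1 := fun k => blockIdx_le_iff lam (k := k) hx
  have h0 := blockIdx_zero lam
  have hz : x.1 = 0 → blockIdx lam x.1.natAbs = 0 := fun h => by rw [h]; exact h0
  rw [Lab.of_f]
  unfold block
  have k1 := h1 i.1.natAbs
  have k2 := h1 (i.1.natAbs - 1)
  split_ifs with c1 c2 c3 c4 <;> rw [Finset.mem_filter] <;>
    simp only [Finset.mem_univ, true_and]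
  · rw [c1] at k1 ⊢; simp only [Int.natAbs_zero] at k1; omega
  · rw [c1] at k1 ⊢; simp only [Int.natAbs_zero] at k1; omega
  · by_cases hx0 : x.1 = 0
    · have := hz hx0; omega
    · omega
  · omega
  · by_cases hx0 : x.1 = 0
    · have := hz hx0; omega
    · omega
  · omega

theorem Lab.of_pt (lam : Comp m n d) (i : Fin d) :
    (Lab.of lam).f (pt i) = blockIdx lam i.1 := by
  rw [Lab.of_f, coe_pt, if_pos (by omega), Int.natAbs_natCast]

theorem Lab.of_ptSucc (lam : Comp m n d) (i : Fin d) :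
    (Lab.of lam).f (ptSucc i) = blockIdx lam (i.1 + 1) := by
  rw [Lab.of_f, coe_ptSucc, if_pos (by omega)]
  rfl

theorem isGen_iff (lam : Comp m n d) (i : Fin d) : IsGen lam i ↔ (Lab.of lam).gen i := by
  unfold Lab.gen
  rw [Lab.of_pt, Lab.of_ptSucc]
  have hi := i.2
  have h1 := fun k => blockIdx_le_iff lam (x := i.1) (k := k) (by omega)
  have h2 := fun k => blockIdx_le_iff lam (x := i.1 + 1) (k := k) (by omega)
  have hm : blockIdx lam i.1 ≤ blockIdx lam (i.1 + 1) := blockIdx_mono lam (by omega)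
  have hb := blockIdx_le lam (i.1 + 1)
  constructor
  · intro h
    by_cases hk : m + n ≤ blockIdx lam i.1
    · omega
    · have h3 := h (blockIdx lam i.1) (by omega)
      have h4 := (h1 (blockIdx lam i.1)).1 le_rfl
      have h5 := (h2 (blockIdx lam i.1)).2 (by omega)
      omega
  · intro h k _ he
    have h3 := (h1 k).2 he.le
    have h4 := (h2 k).1 (by omega)
    omega

theorem odd_pt_iff (lam : Comp m n d) (i : Fin d) :
    (Lab.of lam).odd (pt i) ↔ psum lam m < i.1 := by
  rw [Lab.of_odd, Lab.of_pt, Int.natAbs_natCast]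
  have := blockIdx_le_iff lam (x := i.1) (k := m) (by omega)
  omega

/-- The inequality is strict because for a generator $i$ and $i+1$ lie in the same block, so the
parity may be read at $i+1$. -/
theorem not_odd_pt_iff (lam : Comp m n d) {i : Fin d} (hi : (Lab.of lam).gen i) :
    ¬ (Lab.of lam).odd (pt i) ↔ i.1 < psum lam m := by
  rw [(Lab.of lam).odd_congr _ _ hi, Lab.of_odd, Lab.of_ptSucc, Int.natAbs_natCast]
  have := blockIdx_le_iff lam (x := i.1 + 1) (k := m) (by omega)
  omega

/-- Connects the subgroups given by generators with those given by preserved blocks: if descents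
never leave `G`, every element is a product of the allowed reflections. -/
theorem closure_eq_of_descents {G : Subgroup (W d)} {g : Fin d → Prop} (hG : ∀ i, g i → s i ∈ G)
    (hd : ∀ w ∈ G, w ≠ 1 → ∃ i, g i ∧ w.1 (ptSucc i) < w.1 (pt i)) :
    Subgroup.closure {w | ∃ i, g i ∧ w = s i} = G := by
  apply le_antisymm
  · rw [Subgroup.closure_le]
    rintro w ⟨i, hi, rfl⟩
    exact hG i hi
  · exact Lab.induct_of_descents hG hd (Subgroup.one_mem _) (fun w _ i hi _ ih =>
      Subgroup.mul_mem _ ih (Subgroup.subset_closure ⟨i, hi, rfl⟩))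

theorem WP_eq (lam : Comp m n d) : WP lam = (Lab.of lam).grp := by
  rw [← closure_eq_of_descents (fun _ => (Lab.of lam).s_mem)
    (fun _ => (Lab.of lam).exists_gen_descent)]
  unfold WP
  simp only [isGen_iff]

/-! ### Even and odd parts of a parabolic subgroup -/

namespace Lab

variable (b : Lab d)

/-- The elements of the parabolic subgroup fixing the points outside a union of blocks. -/
def sub (p : SInt d → Prop) : Subgroup (W d) where
  carrier := {w | w ∈ b.grp ∧ ∀ x, ¬ p x → w.1 x = x}
  one_mem' := ⟨b.grp.one_mem, fun _ _ => rfl⟩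
  mul_mem' := by
    rintro u w ⟨hu, hu'⟩ ⟨hw, hw'⟩
    exact ⟨b.grp.mul_mem hu hw, fun x hx => by rw [W_mul_apply, hw' x hx, hu' x hx]⟩
  inv_mem' := by
    rintro w ⟨hw, hw'⟩
    refine ⟨b.grp.inv_mem hw, fun x hx => ?_⟩
    conv_lhs => rw [← hw' x hx]
    exact W_inv_apply_self w x

theorem s_mem_sub {p : SInt d → Prop} (hn : ∀ x, p (-x) ↔ p x)
    (hp : ∀ x y, b.f x = b.f y → (p x ↔ p y)) {i : Fin d} (hi : b.gen i) (hpi : p (pt i)) :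
    s i ∈ b.sub p := by
  refine ⟨b.s_mem hi, fun x hx => ?_⟩
  have h1 : x ≠ pt i := by rintro rfl; exact hx hpi
  have h2 : x ≠ ptSucc i := by rintro rfl; exact hx ((hp _ _ hi).1 hpi)
  have h3 : x ≠ -pt i := by rintro rfl; exact hx ((hn _).2 hpi)
  have h4 : x ≠ -ptSucc i := by rintro rfl; exact hx ((hn _).2 ((hp _ _ hi).1 hpi))
  have := s_val i x
  simp only [ne_eq, Subtype.ext_iff, coe_neg, coe_pt, coe_ptSucc] at h1 h2 h3 h4
  rw [if_neg h1, if_neg h2, if_neg h3, if_neg (by omega)] at this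
  exact Subtype.ext this

theorem sub_descent {p : SInt d → Prop} (hp : ∀ x y, b.f x = b.f y → (p x ↔ p y)) {w : W d}
    (hw : w ∈ b.sub p) (h1 : w ≠ 1) :
    ∃ i, (b.gen i ∧ p (pt i)) ∧ w.1 (ptSucc i) < w.1 (pt i) := by
  obtain ⟨i, hi, hlt⟩ := b.exists_gen_descent hw.1 h1
  refine ⟨i, ⟨hi, ?_⟩, hlt⟩
  by_contra hpi
  rw [hw.2 _ hpi, hw.2 _ (fun h => hpi ((hp _ _ hi).2 h))] at hlt
  exact lt_asymm hlt (pt_lt_ptSucc i)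

theorem sub_induct {p : SInt d → Prop} (hn : ∀ x, p (-x) ↔ p x)
    (hp : ∀ x y, b.f x = b.f y → (p x ↔ p y)) {motive : W d → Prop} (one : motive 1)
    (mul : ∀ w ∈ b.sub p, ∀ i, b.gen i ∧ p (pt i) → w.1 (pt i) < w.1 (ptSucc i) → motive w →
      motive (w * s i)) : ∀ w ∈ b.sub p, motive w :=
  induct_of_descents (fun _ h => b.s_mem_sub hn hp h.1 h.2) (fun _ => b.sub_descent hp) one mul

/-- The even part of the parabolic subgroup. -/
def even : Subgroup (W d) := b.sub fun x => ¬ b.odd x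

/-- The odd part of the parabolic subgroup. -/
def oddSub : Subgroup (W d) := b.sub b.odd

theorem even_induct {motive : W d → Prop} (one : motive 1)
    (mul : ∀ w ∈ b.even, ∀ i, b.gen i ∧ ¬ b.odd (pt i) → w.1 (pt i) < w.1 (ptSucc i) → motive w →
      motive (w * s i)) : ∀ w ∈ b.even, motive w :=
  b.sub_induct (fun x => not_congr (b.odd_neg x)) (fun x y h => not_congr (b.odd_congr x y h))
    one mul

theorem odd_induct {motive : W d → Prop} (one : motive 1)
    (mul : ∀ w ∈ b.oddSub, ∀ i, b.gen i ∧ b.odd (pt i) → w.1 (pt i) < w.1 (ptSucc i) → motive w →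
      motive (w * s i)) : ∀ w ∈ b.oddSub, motive w :=
  b.sub_induct b.odd_neg b.odd_congr one mul

theorem even_apply {u : W d} (hu : u ∈ b.even) {x : SInt d} (hx : b.odd x) : u.1 x = x :=
  hu.2 x (fun h => h hx)

theorem oddSub_apply {u : W d} (hu : u ∈ b.oddSub) {x : SInt d} (hx : ¬ b.odd x) : u.1 x = x :=
  hu.2 x hx

theorem even_odd_commute {u w : W d} (hu : u ∈ b.even) (hw : w ∈ b.oddSub) : u * w = w * u := by
  apply W_ext
  intro x
  rw [W_mul_apply, W_mul_apply]
  by_cases hx : b.odd x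
  · rw [b.even_apply hu hx, b.even_apply hu ((b.odd_apply hw.1 x).2 hx)]
  · rw [b.oddSub_apply hw hx, b.oddSub_apply hw (fun h => hx ((b.odd_apply hu.1 x).1 h))]

/-- The even factor fixes all odd points, so it does not disturb the ascents of the odd factor. -/
theorem len_even_mul_odd {u w : W d} (hu : u ∈ b.even) (hw : w ∈ b.oddSub) :
    len (u * w) = len u + len w := by
  refine b.odd_induct (motive := fun w => len (u * w) = len u + len w) ?_ ?_ w hw
  · rw [mul_one, len_one, add_zero]
  · intro w hw i hi hlt ih
    have h2 : b.odd (ptSucc i) := (b.odd_congr _ _ hi.1).1 hi.2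
    have h1 : (u * w).1 (pt i) < (u * w).1 (ptSucc i) := by
      rw [W_mul_apply, W_mul_apply, b.even_apply hu ((b.odd_apply hw.1 _).2 hi.2),
        b.even_apply hu ((b.odd_apply hw.1 _).2 h2)]
      exact hlt
    rw [← mul_assoc, len_mul_s_of_lt h1, len_mul_s_of_lt hlt, ih, add_assoc]

theorem chi_even : ∀ u ∈ b.even, b.chi u = 1 := by
  refine b.even_induct (motive := fun u => b.chi u = 1) b.chi_one ?_
  intro w _ i hi hlt ih
  rw [b.chi_mul_s hi.1 hlt, ih, eta, if_neg hi.2, mul_one]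

theorem chi_odd : ∀ u ∈ b.oddSub, b.chi u = negqInvPow (len u) := by
  refine b.odd_induct (motive := fun u => b.chi u = negqInvPow (len u)) ?_ ?_
  · rw [b.chi_one, len_one, negqInvPow, pow_zero]
  · intro w _ i hi hlt ih
    rw [b.chi_mul_s hi.1 hlt, ih, eta, if_pos hi.2, len_mul_s_of_lt hlt, negqInvPow, negqInvPow,
      pow_succ]

theorem chi_even_mul_odd {u w : W d} (hu : u ∈ b.even) (hw : w ∈ b.oddSub) :
    b.chi (u * w) = negqInvPow (len w) := by
  rw [b.chi_mul_of_len hw.1 (b.len_even_mul_odd hu hw), b.chi_even u hu, b.chi_odd w hw, one_mul]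

theorem exists_even_mul_odd : ∀ v ∈ b.grp, ∃ u ∈ b.even, ∃ w ∈ b.oddSub, v = u * w := by
  refine b.induct (motive := fun v => ∃ u ∈ b.even, ∃ w ∈ b.oddSub, v = u * w) ?_ ?_
  · exact ⟨1, Subgroup.one_mem _, 1, Subgroup.one_mem _, (mul_one 1).symm⟩
  · rintro v _ i hi _ ⟨u, hu, w, hw, rfl⟩
    by_cases ho : b.odd (pt i)
    · have : s i ∈ b.oddSub := b.s_mem_sub b.odd_neg b.odd_congr hi ho
      exact ⟨u, hu, w * s i, b.oddSub.mul_mem hw this, mul_assoc _ _ _⟩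
    · have : s i ∈ b.even := b.s_mem_sub (fun x => not_congr (b.odd_neg x))
        (fun x y h => not_congr (b.odd_congr x y h)) hi ho
      refine ⟨u * s i, b.even.mul_mem hu this, w, hw, ?_⟩
      rw [mul_assoc, mul_assoc, b.even_odd_commute this hw]

open Classical in
theorem sum_even_odd {M : Type*} [AddCommMonoid M] (F : W d → M) :
    ∑ u with u ∈ b.even, ∑ w with w ∈ b.oddSub, F (u * w) = ∑ v with v ∈ b.grp, F v := by
  rw [← Finset.sum_product']
  refine Finset.sum_bij (fun p _ => p.1 * p.2) ?_ ?_ ?_ (fun _ _ => rfl)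
  · rintro ⟨u, w⟩ h
    simp only [Finset.mem_product, Finset.mem_filter, Finset.mem_univ, true_and] at h ⊢
    exact b.grp.mul_mem h.1.1 h.2.1
  · rintro ⟨u, w⟩ h ⟨u', w'⟩ h' he
    simp only [Finset.mem_product, Finset.mem_filter, Finset.mem_univ, true_and] at h h' he
    have h1 : ∀ x, u.1 x = u'.1 x := by
      intro x
      by_cases hx : b.odd x
      · rw [b.even_apply h.1 hx, b.even_apply h'.1 hx]
      · have := congrArg (fun v : W d => v.1 x) he
        simpa only [W_mul_apply, b.oddSub_apply h.2 hx, b.oddSub_apply h'.2 hx] using this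
    have h2 : u = u' := W_ext h1
    subst h2
    exact Prod.ext rfl (mul_left_cancel he)
  · intro v hv
    obtain ⟨u, hu, w, hw, rfl⟩ := b.exists_even_mul_odd v (Finset.mem_filter.1 hv).2
    exact ⟨(u, w), by simpa using ⟨hu, hw⟩, rfl⟩

theorem inc_inv_iff_shortest {w : W d} : b.Inc w⁻¹ ↔ ∀ x ∈ b.grp, len w ≤ len (x * w) := by
  constructor
  · intro h x hx
    rw [b.len_mul_left h hx]
    omega
  · intro h
    rw [inc_inv_iff_len]
    intro i hi
    have h1 := h _ (b.s_mem hi)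
    by_contra h2
    have := len_s_mul_of_not_lt h2
    omega

end Lab

theorem WEven_eq (lam : Comp m n d) : WEven lam = (Lab.of lam).even := by
  have h := closure_eq_of_descents (G := (Lab.of lam).even)
    (g := fun i => (Lab.of lam).gen i ∧ ¬ (Lab.of lam).odd (pt i))
    (fun i h => (Lab.of lam).s_mem_sub (fun x => not_congr ((Lab.of lam).odd_neg x))
      (fun x y h => not_congr ((Lab.of lam).odd_congr x y h)) h.1 h.2)
    (fun _ => (Lab.of lam).sub_descent (fun x y h => not_congr ((Lab.of lam).odd_congr x y h)))
  rw [← h]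
  unfold WEven
  congr 1
  ext w
  refine exists_congr fun i => ?_
  rw [isGen_iff, ← and_assoc]
  apply and_congr_left'
  apply and_congr_right
  intro hi
  rw [not_odd_pt_iff lam hi]

theorem WOdd_eq (lam : Comp m n d) : WOdd lam = (Lab.of lam).oddSub := by
  have h := closure_eq_of_descents (G := (Lab.of lam).oddSub)
    (g := fun i => (Lab.of lam).gen i ∧ (Lab.of lam).odd (pt i))
    (fun i h => (Lab.of lam).s_mem_sub (Lab.of lam).odd_neg (Lab.of lam).odd_congr h.1 h.2)
    (fun _ => (Lab.of lam).sub_descent (Lab.of lam).odd_congr)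
  rw [← h]
  unfold WOdd
  congr 1
  ext w
  refine exists_congr fun i => ?_
  rw [isGen_iff, odd_pt_iff, and_assoc]

theorem xy_eq (lam : Comp m n d) : xy lam = (Lab.of lam).Z := by
  classical
  unfold xy xEven yOdd Lab.Z
  rw [Finset.sum_mul, ← Lab.sum_even_odd]
  simp only [WEven_eq, WOdd_eq]
  refine Finset.sum_congr rfl fun u hu => ?_
  rw [Finset.mul_sum]
  refine Finset.sum_congr rfl fun w hw => ?_
  rw [Finset.mem_filter] at hu hw
  rw [mul_smul_comm, Tw_mul _ _ ((Lab.of lam).len_even_mul_odd hu.2 hw.2),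
    (Lab.of lam).chi_even_mul_odd hu.2 hw.2]

theorem isShortestDelta_iff (mu nu : Comp m n d) {g : W d} (hg : (Lab.of nu).Inc g) (w : W d) :
    IsShortestDelta mu g nu w ↔ ((Lab.of nu).meet (Lab.of mu) g hg).Inc w⁻¹ := by
  rw [Lab.inc_inv_iff_shortest]
  unfold IsShortestDelta
  simp only [Lab.mem_meet_grp, WP_eq, and_imp]

theorem TDouble_eq (mu nu : Comp m n d) {g : W d} (hg : (Lab.of nu).Inc g) :
    TDouble mu g nu = (Lab.of nu).dbl (Lab.of mu) g hg := by
  classical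
  unfold TDouble Lab.dbl
  rw [xy_eq]
  congr 1
  have h1 : (∑ v with v ∈ (Lab.of nu).grp ∧ ((Lab.of nu).meet (Lab.of mu) g hg).Inc v⁻¹,
      (Lab.of nu).chi v • Tw v) = ∑ v with v ∈ (Lab.of nu).grp,
        if ((Lab.of nu).meet (Lab.of mu) g hg).Inc v⁻¹ then (Lab.of nu).chi v • Tw v else 0 := by
    rw [← Finset.sum_filter, Finset.filter_filter]
  rw [h1, ← Lab.sum_even_odd]
  simp only [WEven_eq, WOdd_eq]
  refine Finset.sum_congr rfl fun u hu => ?_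
  refine Finset.sum_congr rfl fun w hw => ?_
  rw [Finset.mem_filter] at hu hw
  simp only [isShortestDelta_iff mu nu hg, (Lab.of nu).chi_even_mul_odd hu.2 hw.2]

theorem IsShortest.dMin {mu nu : Comp m n d} {g : W d} (h : IsShortest mu g nu) :
    (Lab.of nu).DMin (Lab.of mu) g := by
  unfold IsShortest at h
  rw [WP_eq, WP_eq] at h
  constructor
  · rw [Lab.inc_inv_iff_shortest]
    intro x hx
    simpa using h x hx 1 (Subgroup.one_mem _)
  · have h1 : (Lab.of nu).Inc (g⁻¹)⁻¹ := by
      rw [Lab.inc_inv_iff_shortest]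
      intro x hx
      have := h 1 (Subgroup.one_mem _) x⁻¹ (Subgroup.inv_mem _ hx)
      rw [one_mul, ← len_inv (g * x⁻¹), mul_inv_rev, inv_inv] at this
      rwa [len_inv]
    rwa [inv_inv] at h1

/-- In terms of the parabolic subgroup `W_δ`, the even-odd trivial intersection property says that
the two characters agree on it. -/
theorem evenOddTrivial_iff {mu nu : Comp m n d} {g : W d} (hg : (Lab.of nu).Inc g)
    (hg' : (Lab.of mu).Inc g⁻¹) :
    EvenOddTrivial mu g nu ↔ (Lab.of nu).Compat (Lab.of mu) g hg := by
  set a := Lab.of mu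
  set b := Lab.of nu
  unfold EvenOddTrivial
  rw [WEven_eq, WEven_eq, WOdd_eq, WOdd_eq]
  change (∀ x ∈ a.oddSub, _ ∈ b.even → _) ∧ (∀ x ∈ a.even, _ ∈ b.oddSub → _) ↔ _
  constructor
  -- A generator of $W_\delta$ with different parities on the two sides would be a nontrivial
  -- element of one of the two forbidden intersections.
  · rintro ⟨h1, h2⟩ i hi
    obtain ⟨j, hj, hs, ho⟩ := Lab.exists_conj hg' hi
    have hgi := (Lab.meet_gen.1 hi).1
    have he : g⁻¹ * s j * g = s i := by rw [mul_assoc, hs, inv_mul_cancel_left]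
    rw [← ho]
    by_contra hne
    by_cases c : b.odd (pt i)
    · have c' : ¬ a.odd (pt j) := fun hh => hne ⟨fun _ => hh, fun _ => c⟩
      have e1 : s j ∈ a.even := a.s_mem_sub (fun x => not_congr (a.odd_neg x))
        (fun x y h => not_congr (a.odd_congr x y h)) hj c'
      have e2 : s i ∈ b.oddSub := b.s_mem_sub b.odd_neg b.odd_congr hgi c
      exact s_ne_one i (by rw [← he]; exact h2 _ e1 (by rw [he]; exact e2))
    · have c' : a.odd (pt j) := by
        by_contra hh
        exact hne ⟨fun h => absurd h c, fun h => absurd h hh⟩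
      have e1 : s i ∈ b.even := b.s_mem_sub (fun x => not_congr (b.odd_neg x))
        (fun x y h => not_congr (b.odd_congr x y h)) hgi c
      have e2 : s j ∈ a.oddSub := a.s_mem_sub a.odd_neg a.odd_congr hj c'
      exact s_ne_one i (by rw [← he]; exact h1 _ e2 (by rw [he]; exact e1))
  · intro hc
    -- A nontrivial element of $W_\delta$ has a descent at one of its generators, so it moves an
    -- endpoint `k` of that generator, where compatibility equates the parities. An even element
    -- moves no odd point and conversely, which excludes the forbidden intersections.
    have key : ∀ x ∈ a.grp, g⁻¹ * x * g ∈ b.grp → g⁻¹ * x * g ≠ 1 →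
        ∃ k, (b.odd k ↔ a.odd (g.1 k)) ∧ ¬ x.1 (g.1 k) = g.1 k ∧
          ¬ (g⁻¹ * x * g).1 k = k := by
      intro x hx hu hne
      set u := g⁻¹ * x * g with hudef
      have hgu : g * u = x * g := by rw [hudef]; group
      have hud : u ∈ (b.meet a g hg).grp := by
        rw [Lab.mem_meet_grp]
        refine ⟨hu, ?_⟩
        rw [hgu, mul_inv_cancel_right]; exact hx
      obtain ⟨i, hi, hlt⟩ := (b.meet a g hg).exists_gen_descent hud hne
      have hfix : ∃ k, (k = pt i ∨ k = ptSucc i) ∧ ¬ u.1 k = k := by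
        by_contra! hh
        rw [hh _ (Or.inl rfl), hh _ (Or.inr rfl)] at hlt
        exact lt_asymm hlt (pt_lt_ptSucc i)
      obtain ⟨k, hk, hfk⟩ := hfix
      have hgk : ∀ k, x.1 (g.1 k) = g.1 k ↔ u.1 k = k := by
        intro k
        have := congrArg (fun v : W d => v.1 k) hgu
        simp only [W_mul_apply] at this
        rw [← this, W_inj]
      refine ⟨k, ?_, fun h => hfk ((hgk _).1 h), hfk⟩
      rcases hk with rfl | rfl
      · exact hc i hi
      · obtain ⟨hb, ha⟩ := Lab.meet_gen.1 hi
        rw [← b.odd_congr _ _ hb, ← a.odd_congr _ _ ha]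
        exact hc i hi
    constructor
    · intro x hx hu
      by_contra hne
      obtain ⟨i, h1, h2, h3⟩ := key x hx.1 hu.1 hne
      by_cases c : b.odd i
      · exact h3 (b.even_apply hu c)
      · exact h2 (a.oddSub_apply hx (fun h => c (h1.2 h)))
    · intro x hx hu
      by_contra hne
      obtain ⟨i, h1, h2, h3⟩ := key x hx.1 hu.1 hne
      by_cases c : b.odd i
      · exact h2 (a.even_apply hx (h1.1 c))
      · exact h3 (b.oddSub_apply hu c)

end Comp

/-! ## The entries of an element of the iota Schur superalgebra -/

section Entries

variable {m n d : ℕ}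

instance instFiniteComp : Finite (Comp m n d) := by
  have h : ∀ (lam : Comp m n d) i, lam.1 i < d + 1 := by
    intro lam i
    have := Finset.single_le_sum (f := lam.1) (fun _ _ => Nat.zero_le _) (Finset.mem_univ i)
    have := lam.2
    omega
  exact Finite.of_injective
    (fun (lam : Comp m n d) => fun i => (⟨lam.1 i, h lam i⟩ : Fin (d + 1)))
    (fun M N hMN => Subtype.ext (funext fun i => congrArg Fin.val (congrFun hMN i)))

instance instFintypeComp : Fintype (Comp m n d) := Fintype.ofFinite _

/-- Membership in the right ideal becomes a condition stable under the bar involution and testable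
on coefficients. -/
theorem mem_xyH_iff {lam : Comp m n d} {z : H d} : z ∈ xyH lam ↔ (Lab.of lam).LeftEig z := by
  unfold xyH
  rw [Submodule.mem_span_singleton, xy_eq]
  constructor
  · rintro ⟨a, rfl⟩
    exact (Lab.of lam).leftEig_Z.mul_right a.unop
  · intro h
    obtain ⟨y, rfl⟩ := h.exists_eq
    exact ⟨MulOpposite.op y, rfl⟩

theorem mem_xyH_iff_exists {lam : Comp m n d} {z : H d} : z ∈ xyH lam ↔ ∃ y, z = xy lam * y := by
  rw [mem_xyH_iff, xy_eq]
  exact ⟨fun h => h.exists_eq, by rintro ⟨y, rfl⟩; exact (Lab.of lam).leftEig_Z.mul_right y⟩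

/-- The component in `[xy]_μ H` of the image of `[xy]_ν`. -/
def entry (f : Schur m n d) (nu mu : Comp m n d) : H d := ((f (gen nu)) mu : H d)

theorem leftEig_entry (f : Schur m n d) (nu mu : Comp m n d) :
    (Lab.of mu).LeftEig (entry f nu mu) := mem_xyH_iff.1 ((f (gen nu)) mu).2

theorem coe_gen_self (nu : Comp m n d) : ((gen nu) nu : H d) = xy nu := by
  unfold gen
  rw [DirectSum.lof_apply]; rfl

theorem gen_of_ne {nu mu : Comp m n d} (h : mu ≠ nu) : (gen nu) mu = 0 := by
  unfold gen
  rw [DirectSum.lof_eq_of, DirectSum.of_eq_of_ne _ _ _ h]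

theorem eq_sum_gen (x : Perm m n d) (h : Comp m n d → H d)
    (hx : ∀ nu, (x nu : H d) = xy nu * h nu) : x = ∑ nu, MulOpposite.op (h nu) • gen nu := by
  apply DFinsupp.ext
  intro mu
  apply Subtype.ext
  have e1 : (∑ nu, MulOpposite.op (h nu) • gen nu) mu =
      ∑ nu, (MulOpposite.op (h nu) • gen nu) mu := DFinsupp.finsetSum_apply _ _ _
  rw [hx, e1, Finset.sum_eq_single mu]
  · rw [DFinsupp.smul_apply, Submodule.coe_smul, coe_gen_self]; rfl
  · intro nu _ hne
    rw [DFinsupp.smul_apply, gen_of_ne hne.symm, smul_zero]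
  · intro hh; exact absurd (Finset.mem_univ _) hh

theorem apply_eq_sum (f : Schur m n d) (x : Perm m n d) (h : Comp m n d → H d)
    (hx : ∀ nu, (x nu : H d) = xy nu * h nu) (mu : Comp m n d) :
    ((f x) mu : H d) = ∑ nu, entry f nu mu * h nu := by
  rw [eq_sum_gen x h hx, map_sum]
  have e1 : (∑ nu, f (MulOpposite.op (h nu) • gen nu)) mu =
      ∑ nu, (f (MulOpposite.op (h nu) • gen nu)) mu := DFinsupp.finsetSum_apply _ _ _
  rw [e1, AddSubmonoidClass.coe_finsetSum]
  refine Finset.sum_congr rfl fun nu _ => ?_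
  rw [map_smul, DFinsupp.smul_apply, Submodule.coe_smul]; rfl

theorem exists_coords (x : Perm m n d) : ∃ h : Comp m n d → H d, ∀ nu, (x nu : H d) = xy nu * h nu := by
  have := fun nu => mem_xyH_iff_exists.1 (x nu).2
  choose h hh using this
  exact ⟨h, hh⟩

theorem schur_ext {f g : Schur m n d} (h : ∀ nu mu, entry f nu mu = entry g nu mu) : f = g := by
  apply LinearMap.ext
  intro x
  obtain ⟨c, hc⟩ := exists_coords x
  apply DFinsupp.ext
  intro mu
  apply Subtype.ext
  rw [apply_eq_sum f x c hc, apply_eq_sum g x c hc]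
  simp only [h]

/-- `T_{s_i}` acts on the generator from the right as a scalar, and `f` is right linear. -/
theorem rightEig_entry (f : Schur m n d) (nu mu : Comp m n d) :
    (Lab.of nu).RightEig (entry f nu mu) := by
  intro i hi
  have h1 : MulOpposite.op (Tw (s i)) • gen nu =
      MulOpposite.op (algebraMap A (H d) ((Lab.of nu).eps i)) • gen nu := by
    apply DFinsupp.ext
    intro rho
    apply Subtype.ext
    rw [DFinsupp.smul_apply, DFinsupp.smul_apply, Submodule.coe_smul, Submodule.coe_smul]
    by_cases h : rho = nu
    · subst h
      rw [coe_gen_self, xy_eq, MulOpposite.smul_eq_mul_unop, MulOpposite.smul_eq_mul_unop,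
        MulOpposite.unop_op, MulOpposite.unop_op, (Lab.of rho).rightEig_Z i hi, Algebra.smul_def,
        Algebra.commutes]
    · rw [gen_of_ne h]; simp
  have h2 := congrArg (fun x => ((f x) mu : H d)) h1
  simp only [map_smul] at h2
  rw [Algebra.smul_def, Algebra.commutes]
  exact h2

theorem entry_add (f g : Schur m n d) (nu mu : Comp m n d) :
    entry (f + g) nu mu = entry f nu mu + entry g nu mu := rfl

theorem entry_smul (a : A) (f : Schur m n d) (nu mu : Comp m n d) :
    entry (a • f) nu mu = a • entry f nu mu := rfl

/-- Left multiplication as a map of right modules. -/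
def mulLeftHom (nu mu : Comp m n d) (k : H d) (hk : (Lab.of mu).LeftEig (k * xy nu)) :
    xyH nu →ₗ[(H d)ᵐᵒᵖ] xyH mu where
  toFun x := ⟨k * x.1, by
    obtain ⟨y, hy⟩ := mem_xyH_iff_exists.1 x.2
    rw [hy, ← mul_assoc, mem_xyH_iff]
    exact hk.mul_right y⟩
  map_add' x y := Subtype.ext (mul_add _ _ _)
  map_smul' a x := Subtype.ext (mul_assoc _ _ _).symm

/-- A right eigenvector is `k * xy nu` for some `k`. Left multiplication by `k` maps
$[xy]_\nu\mathcal H$ into $[xy]_\mu\mathcal H$, since the image of the generator is a left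
eigenvector. -/
theorem exists_schur (h : Comp m n d → Comp m n d → H d)
    (hl : ∀ nu mu, (Lab.of mu).LeftEig (h nu mu)) (hr : ∀ nu mu, (Lab.of nu).RightEig (h nu mu)) :
    ∃ f : Schur m n d, ∀ nu mu, entry f nu mu = h nu mu := by
  have := fun nu mu => (hr nu mu).exists_eq
  choose k hk using this
  simp only [← xy_eq] at hk
  let φ : ∀ nu, xyH nu →ₗ[(H d)ᵐᵒᵖ] Perm m n d := fun nu =>
    ∑ mu, (DirectSum.lof (H d)ᵐᵒᵖ (Comp m n d) (fun lam => xyH lam) mu).comp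
      (mulLeftHom nu mu (k nu mu) (by rw [← hk]; exact hl nu mu))
  refine ⟨DirectSum.toModule (H d)ᵐᵒᵖ (Comp m n d) (Perm m n d) φ, fun nu mu => ?_⟩
  unfold entry gen
  rw [DirectSum.toModule_lof]
  simp only [φ, LinearMap.sum_apply, LinearMap.comp_apply]
  rw [DFinsupp.finsetSum_apply, Finset.sum_eq_single mu]
  · rw [DirectSum.lof_apply]
    exact (hk nu mu).symm
  · intro rho _ hne
    rw [DirectSum.lof_eq_of, DirectSum.of_eq_of_ne _ _ _ hne.symm]
  · intro hh; exact absurd (Finset.mem_univ _) hh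

end Entries

/-! ## Matrices and double cosets -/

/-- A monotone function on a finite linear order is determined by the sizes of its fibres. -/
theorem eq_of_monotoneOn_of_card {X L : Type*} [LinearOrder X] [LinearOrder L] [DecidableEq L]
    {t : Finset X}
    {F G : X → L} (hF : MonotoneOn F t) (hG : MonotoneOn G t)
    (h : ∀ l, (t.filter fun x => F x = l).card = (t.filter fun x => G x = l).card) :
    ∀ x ∈ t, F x = G x := by
  have hle : ∀ l, (t.filter fun x => F x ≤ l).card = (t.filter fun x => G x ≤ l).card := by
    intro l
    have key : ∀ F' : X → L, (t.image F' ⊆ t.image F ∪ t.image G) →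
        (t.filter fun x => F' x ≤ l).card =
        ∑ k ∈ (t.image F ∪ t.image G).filter (· ≤ l), (t.filter fun x => F' x = k).card := by
      intro F' hF'
      rw [Finset.card_eq_sum_card_fiberwise (f := F')
        (t := (t.image F ∪ t.image G).filter (· ≤ l))]
      · refine Finset.sum_congr rfl fun k hk => ?_
        rw [Finset.filter_filter]
        congr 1
        apply Finset.filter_congr
        intro x _
        have := (Finset.mem_filter.1 hk).2
        exact ⟨fun hh => hh.2, fun hh => ⟨hh ▸ this, hh⟩⟩
      · intro x hx
        rw [Finset.mem_coe, Finset.mem_filter] at hx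
        rw [Finset.mem_coe, Finset.mem_filter]
        exact ⟨hF' (Finset.mem_image_of_mem _ hx.1), hx.2⟩
    rw [key F Finset.subset_union_left, key G Finset.subset_union_right]
    exact Finset.sum_congr rfl fun k _ => h k
  have hset : ∀ l, (t.filter fun x => F x ≤ l) = (t.filter fun x => G x ≤ l) := by
    intro l
    -- Sublevel sets of monotone functions are initial segments, so two of them are nested, and
    -- equal cardinalities make them equal.
    have hor : (t.filter fun x => F x ≤ l) ⊆ (t.filter fun x => G x ≤ l) ∨
        (t.filter fun x => G x ≤ l) ⊆ (t.filter fun x => F x ≤ l) := by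
      by_contra! hc
      rw [Finset.not_subset, Finset.not_subset] at hc
      obtain ⟨⟨x, hx, hx'⟩, y, hy, hy'⟩ := hc
      rw [Finset.mem_filter] at hx hx' hy hy'
      have hx'' : ¬ G x ≤ l := fun hh => hx' ⟨hx.1, hh⟩
      have hy'' : ¬ F y ≤ l := fun hh => hy' ⟨hy.1, hh⟩
      rcases le_total x y with hxy | hxy
      · exact hx'' ((hG hx.1 hy.1 hxy).trans hy.2)
      · exact hy'' ((hF hy.1 hx.1 hxy).trans hx.2)
    rcases hor with h1 | h1
    · exact Finset.eq_of_subset_of_card_le h1 (hle l).ge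
    · exact (Finset.eq_of_subset_of_card_le h1 (hle l).le).symm
  intro x hx
  have key : ∀ l, F x ≤ l ↔ G x ≤ l := by
    intro l
    have := Finset.ext_iff.1 (hset l) x
    rw [Finset.mem_filter, Finset.mem_filter] at this
    exact ⟨fun hh => (this.1 ⟨hx, hh⟩).2, fun hh => (this.2 ⟨hx, hh⟩).2⟩
  exact le_antisymm ((key _).2 le_rfl) ((key _).1 le_rfl)

/-- Weights on a finite linear order whose sum is `|X|` are the fibre sizes of a monotone
function. -/
theorem exists_monotone_of_card {X L : Type*} [LinearOrder X] [Fintype X] [LinearOrder L]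
    [Fintype L] [DecidableEq L] (a : L → ℕ) (h : ∑ l, a l = Fintype.card X) :
    ∃ F : X → L, Monotone F ∧ ∀ l, (Finset.univ.filter fun x => F x = l).card = a l := by
  -- The concatenation of chains of lengths `a l`; the order isomorphism from `X` followed by the
  -- projection to `L` is the function wanted.
  let S := Σₗ l : L, Fin (a l)
  let _ : Fintype S := Fintype.ofEquiv (Σ l : L, Fin (a l)) toLex
  have hc : Fintype.card S = Fintype.card X := by
    rw [← h, ← Fintype.card_congr (toLex : (Σ l : L, Fin (a l)) ≃ S), Fintype.card_sigma]
    simp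
  let e : X ≃o S := (Fintype.orderIsoFinOfCardEq X rfl).symm.trans
    (Fintype.orderIsoFinOfCardEq S hc)
  refine ⟨fun x => (ofLex (e x)).1, ?_, fun l => ?_⟩
  · intro x y hxy
    have h1 := e.monotone hxy
    rcases (Sigma.Lex.le_def.1 h1) with h2 | ⟨h2, -⟩
    · exact h2.le
    · exact h2.le
  · have h1 : (Finset.univ.filter fun x => (ofLex (e x)).1 = l).card =
        (Finset.univ.image fun k : Fin (a l) => e.symm (toLex (⟨l, k⟩ : Σ l : L, Fin (a l)))).card := by
      congr 1
      ext x
      simp only [Finset.mem_filter, Finset.mem_univ, true_and, Finset.mem_image]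
      constructor
      · rintro rfl
        exact ⟨(ofLex (e x)).2, e.symm_apply_apply x⟩
      · rintro ⟨k, rfl⟩
        rw [e.apply_symm_apply]; rfl
    rw [h1, Finset.card_image_of_injective, Finset.card_univ, Fintype.card_fin]
    intro k k' hk
    have := toLex.injective (e.symm.injective hk)
    simpa using this

theorem card_SInt (r : ℕ) : Fintype.card (SInt r) = 2 * r + 1 := by
  rw [Fintype.card_coe, Int.card_Icc]; omega

theorem ptSucc_pos {r : ℕ} (k : Fin r) : 0 < (ptSucc k).1 := by rw [coe_ptSucc]; omega

theorem sum_pos_eq {r : ℕ} {M : Type*} [AddCommMonoid M] (h : SInt r → M) :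
    ∑ x with 0 < x.1, h x = ∑ k : Fin r, h (ptSucc k) := by
  symm
  refine Finset.sum_bij (fun k _ => ptSucc k) ?_ ?_ ?_ (fun _ _ => rfl)
  · intro k _; exact Finset.mem_filter.2 ⟨Finset.mem_univ _, ptSucc_pos k⟩
  · intro k _ l _ hkl
    have := congrArg Subtype.val hkl
    rw [coe_ptSucc, coe_ptSucc] at this
    exact Fin.ext (by omega)
  · intro x hx
    have h0 := (Finset.mem_filter.1 hx).2
    have h1 := Finset.mem_Icc.1 x.2
    exact ⟨⟨(x.1 - 1).toNat, by omega⟩, Finset.mem_univ _,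
      Subtype.ext (by rw [coe_ptSucc]; simp; omega)⟩

theorem sum_eq_zero_add_pos {r : ℕ} {M : Type*} [AddCommMonoid M] (h : SInt r → M) :
    ∑ x, h x = h 0 + ∑ x with 0 < x.1, (h x + h (-x)) := by
  rw [Finset.sum_add_distrib]
  have e1 : ∑ x with 0 < x.1, h (-x) = ∑ x with x.1 < 0, h x := by
    rw [Finset.sum_filter, Finset.sum_filter, ← Equiv.sum_comp (negEquiv r)]
    refine Finset.sum_congr rfl fun x _ => ?_
    rw [negEquiv_apply, sint_neg_neg, coe_neg]
    simp
  rw [e1, ← Finset.sum_filter_add_sum_filter_not Finset.univ (fun x : SInt r => 0 < x.1) h,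
    ← Finset.sum_filter_add_sum_filter_not
      (Finset.univ.filter (fun x : SInt r => ¬ 0 < x.1)) (fun x : SInt r => x.1 < 0) h,
    Finset.filter_filter, Finset.filter_filter]
  have e2 : (Finset.univ.filter fun x : SInt r => ¬ 0 < x.1 ∧ x.1 < 0) =
      Finset.univ.filter fun x => x.1 < 0 := by
    apply Finset.filter_congr; intro x _; omega
  have e3 : (Finset.univ.filter fun x : SInt r => ¬ 0 < x.1 ∧ ¬ x.1 < 0) = {0} := by
    ext x
    simp only [Finset.mem_filter, Finset.mem_univ, true_and, Finset.mem_singleton,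
      Subtype.ext_iff, coe_zero]
    omega
  rw [e2, e3, Finset.sum_singleton]
  abel

theorem sum_even_fun {r : ℕ} (h : SInt r → ℕ) (hh : ∀ x, h (-x) = h x) :
    ∑ x, h x = h 0 + 2 * ∑ x with 0 < x.1, h x := by
  rw [sum_eq_zero_add_pos, Finset.mul_sum]
  simp only [hh, two_mul]

/-- An odd function can be sorted by a signed permutation. -/
theorem exists_sort {d : ℕ} (ρ : SInt d → ℤ) (hρ : ∀ x, ρ (-x) = -ρ x) :
    ∃ w : W d, Monotone fun x => ρ (w.1 x) := by
  -- Rearrangement: a signed permutation maximising $\sum_x x\,\rho(w(x))$ sorts `ρ`, since swapping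
  -- a descent would increase the sum.
  obtain ⟨w, -, hw⟩ := Set.exists_max_image (Set.univ : Set (W d))
    (fun w => ∑ x, x.1 * ρ (w.1 x)) (Set.toFinite _) ⟨1, trivial⟩
  refine ⟨w, ?_⟩
  set φ : SInt d → ℤ := fun x => ρ (w.1 x) with hφ
  have hn : ∀ x, φ (-x) = -φ x := fun x => by rw [hφ, ← hρ, ← W_neg]
  have h0 : φ 0 = 0 := by
    have := hn 0
    rw [sint_neg_zero] at this
    omega
  have hstep : ∀ i : Fin d, φ (pt i) ≤ φ (ptSucc i) := by
    intro i
    have h1 := hw (w * s i) trivial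
    have h2 : ∑ x, x.1 * ρ ((w * s i).1 x) = ∑ x, ((s i).1 x).1 * φ x := by
      rw [← Equiv.sum_comp (s i).1]
      refine Finset.sum_congr rfl fun x _ => ?_
      rw [W_mul_apply, s_s_apply]
    have h3 : ∑ x, ((s i).1 x).1 * φ x - ∑ x, x.1 * φ x ≤ 0 := by
      rw [← h2]; exact sub_nonpos.2 h1
    rw [← Finset.sum_sub_distrib] at h3
    simp only [← sub_mul, s_val_sub] at h3
    by_cases hi : i.1 = 0
    · simp only [if_pos hi, add_mul, ite_mul, zero_mul, Finset.sum_add_distrib,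
        Finset.sum_ite_eq', Finset.mem_univ, if_true, hn] at h3
      have h4 : pt i = 0 := Subtype.ext (by rw [coe_pt, hi]; rfl)
      rw [h4, h0]
      linarith
    · simp only [if_neg hi, add_mul, ite_mul, zero_mul, Finset.sum_add_distrib,
        Finset.sum_ite_eq', Finset.mem_univ, if_true, hn] at h3
      linarith
  let b : Lab d := ⟨fun _ => 0, fun _ _ _ => le_rfl, fun _ => rfl, fun _ => False,
    fun _ => Iff.rfl, fun _ _ _ => Iff.rfl⟩
  -- With a single block, adding the position makes the weakly increasing `φ` strictly increasing.
  -- Positions differ by at most $2d$, so the factor $2d+1$ lets the weak inequality be recovered.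
  have h4 := b.strictMono_on_blocks (φ := fun x => (2 * (d : ℤ) + 1) * φ x + x.1)
    (fun x => by rw [hn, coe_neg]; ring) (fun i _ => by
      have := hstep i
      rw [coe_pt, coe_ptSucc]
      nlinarith)
  intro x y hxy
  rcases hxy.lt_or_eq with hlt | rfl
  · have h5 := h4 x y hlt rfl
    have hx := Finset.mem_Icc.1 x.2
    have hy := Finset.mem_Icc.1 y.2
    change φ x ≤ φ y
    by_contra hc
    nlinarith
  · exact le_rfl

/-! ### Compatibility on pairs of points, and uniqueness of minimal representatives -/

namespace Lab

variable {d : ℕ} {a b : Lab d}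

theorem exists_gen_of_lt {x y : SInt d} (hxy : x < y) (h : b.f x = b.f y) :
    ∃ i, b.gen i ∧ (x = pt i ∨ -x = ptSucc i) := by
  have hlt := Subtype.coe_lt_coe.2 hxy
  have hx := Finset.mem_Icc.1 x.2
  have hy := Finset.mem_Icc.1 y.2
  let z : SInt d := ⟨x.1 + 1, by rw [Finset.mem_Icc]; omega⟩
  have hz : b.f x = b.f z := by
    have h1 : x ≤ z := Subtype.coe_le_coe.1 (by change x.1 ≤ x.1 + 1; omega)
    have h2 : z ≤ y := Subtype.coe_le_coe.1 (by change x.1 + 1 ≤ y.1; omega)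
    have := b.mono h1
    have := b.mono h2
    omega
  by_cases h0 : 0 ≤ x.1
  · have e1 : x = pt ⟨x.1.toNat, by omega⟩ := Subtype.ext (by rw [coe_pt]; simp; omega)
    have e2 : z = ptSucc ⟨x.1.toNat, by omega⟩ :=
      Subtype.ext (by rw [coe_ptSucc]; change x.1 + 1 = _; simp; omega)
    exact ⟨_, by unfold gen; rw [← e1, ← e2]; exact hz, Or.inl e1⟩
  · have e1 : -z = pt ⟨(-x.1 - 1).toNat, by omega⟩ :=
      Subtype.ext (by rw [coe_pt, coe_neg]; change -(x.1 + 1) = _; simp; omega)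
    have e2 : -x = ptSucc ⟨(-x.1 - 1).toNat, by omega⟩ :=
      Subtype.ext (by rw [coe_ptSucc, coe_neg]; simp; omega)
    exact ⟨_, by unfold gen; rw [← e1, ← e2, b.neg, b.neg, hz], Or.inr e2⟩

/-- Two distinct points in a common cell lie in an interval of the refinement, which then contains a
generator with the same parities, up to sign. -/
theorem compat_iff {g : W d} {hg : b.Inc g} : b.Compat a g hg ↔
    ∀ x y, x ≠ y → b.f x = b.f y → a.f (g.1 x) = a.f (g.1 y) → (b.odd x ↔ a.odd (g.1 x)) := by
  constructor
  · intro hc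
    have key : ∀ x y, x < y → b.f x = b.f y → a.f (g.1 x) = a.f (g.1 y) →
        (b.odd x ↔ a.odd (g.1 x)) := by
      intro x y hxy hb ha
      obtain ⟨i, hi, hx⟩ := exists_gen_of_lt (b := b.meet a g hg) hxy (meet_eq_iff.2 ⟨hb, ha⟩)
      have h1 := hc i hi
      rcases hx with rfl | hx
      · exact h1
      · obtain ⟨e1, e2⟩ := meet_gen.1 hi
        rw [b.odd_congr _ _ e1, a.odd_congr _ _ e2, ← hx, W_neg, b.odd_neg, a.odd_neg] at h1
        exact h1
    intro x y hne hb ha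
    rcases lt_or_gt_of_ne hne with h | h
    · exact key x y h hb ha
    · rw [b.odd_congr _ _ hb, a.odd_congr _ _ ha]
      exact key y x h hb.symm ha.symm
  · intro h i hi
    obtain ⟨e1, e2⟩ := meet_gen.1 hi
    exact h _ _ (pt_lt_ptSucc i).ne e1 e2

/-- A minimal double coset representative is determined by its cell sizes. -/
theorem DMin.eq {g g' : W d} (hg : b.DMin a g) (hg' : b.DMin a g')
    (h : ∀ i j : ℤ, (Finset.univ.filter fun x => b.f x = j ∧ a.f (g.1 x) = i).card =
      (Finset.univ.filter fun x => b.f x = j ∧ a.f (g'.1 x) = i).card) : g = g' := by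
  -- On a block of `a` the label of the preimage is monotone, and its fibres are the cells, so the
  -- cell sizes determine it. Hence `g` and `g'` differ by an element of the `b`-subgroup, which is
  -- trivial because both are minimal.
  have key : ∀ y, b.f ((g⁻¹).1 y) = b.f ((g'⁻¹).1 y) := by
    intro y
    have hm : ∀ g : W d, b.DMin a g → MonotoneOn (fun z => b.f ((g⁻¹).1 z))
        (Finset.univ.filter fun z => a.f z = a.f y : Finset (SInt d)) := by
      intro g hg x hx z hz hxz
      rcases hxz.lt_or_eq with hlt | rfl
      · rw [Finset.mem_coe, Finset.mem_filter] at hx hz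
        exact b.mono (hg.1 x z hlt (hx.2.trans hz.2.symm)).le
      · exact le_rfl
    have hcard : ∀ (g : W d) (l : ℤ), ((Finset.univ.filter fun z => a.f z = a.f y).filter
        fun z => b.f ((g⁻¹).1 z) = l).card =
        (Finset.univ.filter fun x => b.f x = l ∧ a.f (g.1 x) = a.f y).card := by
      intro g l
      rw [Finset.filter_filter]
      refine Finset.card_bij (fun z _ => (g⁻¹).1 z) ?_ ?_ ?_
      · intro z hz
        rw [Finset.mem_filter] at hz ⊢
        refine ⟨Finset.mem_univ _, hz.2.2, ?_⟩
        rw [W_apply_inv_self]; exact hz.2.1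
      · intro z _ z' _ hzz; exact (W_inj _).1 hzz
      · intro x hx
        rw [Finset.mem_filter] at hx
        refine ⟨g.1 x, ?_, W_inv_apply_self g x⟩
        rw [Finset.mem_filter, W_inv_apply_self]
        exact ⟨Finset.mem_univ _, hx.2.2, hx.2.1⟩
    exact eq_of_monotoneOn_of_card (hm g hg) (hm g' hg')
      (fun l => by rw [hcard, hcard, h]) y (Finset.mem_filter.2 ⟨Finset.mem_univ _, rfl⟩)
  have hu : g'⁻¹ * g ∈ b.grp := by
    intro x
    rw [W_mul_apply, ← key, W_inv_apply_self]
  have := b.eq_one_of_inc hg'.2 hu (by rw [mul_inv_cancel_left]; exact hg.2)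
  exact (inv_mul_eq_one.1 this).symm

end Lab

/-! ### The matrix of a double coset -/

section Kap

variable {m n d : ℕ}

theorem kap_eq (mu : Comp m n d) (g : W d) (nu : Comp m n d) (i j : SInt (m + n)) :
    kap mu g nu i j = (Finset.univ.filter fun x =>
      (Lab.of nu).f x = j.1 ∧ (Lab.of mu).f (g.1 x) = i.1).card := by
  unfold kap
  conv_rhs => rw [← Finset.card_image_of_injective _ g.1.injective]
  congr 1
  ext y
  simp only [Finset.mem_inter, Finset.mem_image, Finset.mem_filter, Finset.mem_univ, true_and,
    mem_block]
  constructor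
  · rintro ⟨h1, x, h2, rfl⟩; exact ⟨x, ⟨h2, h1⟩, rfl⟩
  · rintro ⟨x, ⟨h2, h1⟩, rfl⟩; exact ⟨h1, x, h2, rfl⟩

theorem Lab.of_mem (lam : Comp m n d) (x : SInt d) :
    (Lab.of lam).f x ∈ Finset.Icc (-((m + n : ℕ) : ℤ)) ((m + n : ℕ) : ℤ) := by
  have := blockIdx_le lam x.1.natAbs
  rw [Lab.of_f, Finset.mem_Icc]
  split_ifs <;> omega

/-- The index of the block containing a point. -/
def lbl (lam : Comp m n d) (x : SInt d) : SInt (m + n) := ⟨_, Lab.of_mem lam x⟩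

theorem coe_lbl (lam : Comp m n d) (x : SInt d) : (lbl lam x).1 = (Lab.of lam).f x := rfl

theorem lbl_neg (lam : Comp m n d) (x : SInt d) : lbl lam (-x) = -lbl lam x :=
  Subtype.ext (by rw [coe_neg, coe_lbl, coe_lbl, Lab.neg])

theorem kap_eq_lbl (mu : Comp m n d) (g : W d) (nu : Comp m n d) (i j : SInt (m + n)) :
    kap mu g nu i j = (Finset.univ.filter fun x => lbl nu x = j ∧ lbl mu (g.1 x) = i).card := by
  rw [kap_eq]
  simp only [Subtype.ext_iff, coe_lbl]

theorem DMin_eq_of_kap {mu nu : Comp m n d} {g g' : W d} (hg : (Lab.of nu).DMin (Lab.of mu) g)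
    (hg' : (Lab.of nu).DMin (Lab.of mu) g') (h : kap mu g nu = kap mu g' nu) : g = g' := by
  apply hg.eq hg'
  intro i j
  have hemp : ∀ (P : SInt d → Prop) [DecidablePred P], (∀ x, ¬ P x) →
      (Finset.univ.filter P).card = 0 := by
    intro P _ hP
    rw [Finset.card_eq_zero, Finset.filter_eq_empty_iff]
    exact fun x _ => hP x
  by_cases hi : i ∈ Finset.Icc (-((m + n : ℕ) : ℤ)) ((m + n : ℕ) : ℤ)
  · by_cases hj : j ∈ Finset.Icc (-((m + n : ℕ) : ℤ)) ((m + n : ℕ) : ℤ)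
    · have := congrFun (congrFun h ⟨i, hi⟩) ⟨j, hj⟩
      rwa [kap_eq, kap_eq] at this
    · rw [hemp _ (fun x hx => hj (by rw [← hx.1]; exact Lab.of_mem _ _)),
        hemp _ (fun x hx => hj (by rw [← hx.1]; exact Lab.of_mem _ _))]
  · rw [hemp _ (fun x hx => hi (by rw [← hx.2]; exact Lab.of_mem _ _)),
      hemp _ (fun x hx => hi (by rw [← hx.2]; exact Lab.of_mem _ _))]

theorem kap_mul {mu nu : Comp m n d} {x g y : W d} (hx : x ∈ WP mu) (hy : y ∈ WP nu) :
    kap mu (x * g * y) nu = kap mu g nu := by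
  rw [WP_eq] at hx hy
  funext i j
  rw [kap_eq, kap_eq]
  refine Finset.card_bij (fun z _ => y.1 z) ?_ ?_ ?_
  · intro z hz
    rw [Finset.mem_filter, W_mul_apply, W_mul_apply, hx] at hz
    rw [Finset.mem_filter, hy]
    exact ⟨Finset.mem_univ _, hz.2⟩
  · intro z _ z' _ hzz; exact (W_inj _).1 hzz
  · intro z hz
    refine ⟨(y⁻¹).1 z, ?_, W_apply_inv_self y z⟩
    rw [Finset.mem_filter] at hz
    rw [Finset.mem_filter, W_mul_apply, W_mul_apply, hx, W_apply_inv_self,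
      (Lab.of nu).grp.inv_mem hy]
    exact ⟨Finset.mem_univ _, hz.2⟩

theorem exists_shortest (mu nu : Comp m n d) (w : W d) :
    ∃ g, IsShortest mu g nu ∧ kap mu g nu = kap mu w nu ∧ len g ≤ len w := by
  obtain ⟨⟨x, y⟩, hxy, hmin⟩ := Set.exists_min_image {p : W d × W d | p.1 ∈ WP mu ∧ p.2 ∈ WP nu}
    (fun p => len (p.1 * w * p.2)) (Set.toFinite _) ⟨(1, 1), Subgroup.one_mem _, Subgroup.one_mem _⟩
  refine ⟨x * w * y, ?_, kap_mul hxy.1 hxy.2, ?_⟩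
  · intro x' hx' y' hy'
    have := hmin (x' * x, y * y') ⟨Subgroup.mul_mem _ hx' hxy.1, Subgroup.mul_mem _ hxy.2 hy'⟩
    simpa only [mul_assoc] using this
  · have := hmin (1, 1) ⟨Subgroup.one_mem _, Subgroup.one_mem _⟩
    simpa using this

/-- The shortest element of the double coset of `w` is also one-sidedly minimal and has the same
matrix, so it is `g`. -/
theorem len_le_of_kap {mu nu : Comp m n d} {g w : W d} (hg : (Lab.of nu).DMin (Lab.of mu) g)
    (h : kap mu w nu = kap mu g nu) : len g ≤ len w := by
  obtain ⟨g', h1, h2, h3⟩ := exists_shortest mu nu w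
  rwa [DMin_eq_of_kap hg h1.dMin (by rw [h2, h])]

theorem kap_neg (mu : Comp m n d) (g : W d) (nu : Comp m n d) (i j : SInt (m + n)) :
    kap mu g nu i j = kap mu g nu (-i) (-j) := by
  rw [kap_eq_lbl, kap_eq_lbl]
  refine Finset.card_bij (fun z _ => -z) ?_ (fun z _ z' _ h => sint_neg_inj.1 h) ?_
  · intro z hz
    rw [Finset.mem_filter] at hz ⊢
    rw [W_neg, lbl_neg, lbl_neg, hz.2.1, hz.2.2]
    exact ⟨Finset.mem_univ _, rfl, rfl⟩
  · intro z hz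
    refine ⟨-z, ?_, sint_neg_neg z⟩
    rw [Finset.mem_filter] at hz ⊢
    rw [W_neg, lbl_neg, lbl_neg, hz.2.1, hz.2.2, sint_neg_neg, sint_neg_neg]
    exact ⟨Finset.mem_univ _, rfl, rfl⟩

theorem sum_kap_row (mu : Comp m n d) (g : W d) (nu : Comp m n d) (i : SInt (m + n)) :
    ∑ j, kap mu g nu i j = (Finset.univ.filter fun x => lbl mu x = i).card := by
  simp only [kap_eq_lbl]
  have h1 : (Finset.univ.filter fun x => lbl mu x = i).card =
      (Finset.univ.filter fun x => lbl mu (g.1 x) = i).card := by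
    simp only [Finset.card_filter]
    rw [Equiv.sum_comp g.1 (fun x => if lbl mu x = i then 1 else 0)]
  rw [h1, Finset.card_eq_sum_card_fiberwise (f := lbl nu) (t := Finset.univ)
    (fun _ _ => Finset.mem_univ _)]
  refine Finset.sum_congr rfl fun j _ => ?_
  rw [Finset.filter_filter]
  simp only [and_comm]

theorem sum_kap_col (mu : Comp m n d) (g : W d) (nu : Comp m n d) (j : SInt (m + n)) :
    ∑ i, kap mu g nu i j = (Finset.univ.filter fun x => lbl nu x = j).card := by
  simp only [kap_eq_lbl]
  rw [Finset.card_eq_sum_card_fiberwise (f := fun x => lbl mu (g.1 x)) (t := Finset.univ)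
    (fun _ _ => Finset.mem_univ _)]
  refine Finset.sum_congr rfl fun j _ => ?_
  rw [Finset.filter_filter]

theorem sum_kap (mu : Comp m n d) (g : W d) (nu : Comp m n d) :
    ∑ i, ∑ j, kap mu g nu i j = 2 * d + 1 := by
  simp only [sum_kap_row]
  rw [← card_SInt, ← Finset.card_univ, Finset.card_eq_sum_card_fiberwise (f := lbl mu)
    (t := Finset.univ) (fun _ _ => Finset.mem_univ _)]

theorem psum_succ (lam : Comp m n d) (k : ℕ) (hk : k + 1 < m + n + 1) :
    psum lam (k + 1) = psum lam k + lam.1 ⟨k + 1, hk⟩ := by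
  have h1 : lam.1 ⟨k + 1, hk⟩ = ∑ j, if j = ⟨k + 1, hk⟩ then lam.1 j else 0 := by
    rw [Finset.sum_ite_eq' Finset.univ]; simp
  rw [h1]
  unfold psum
  rw [← Finset.sum_add_distrib]
  refine Finset.sum_congr rfl fun j _ => ?_
  simp only [Fin.ext_iff]
  split_ifs <;> omega

theorem psum_zero (lam : Comp m n d) : psum lam 0 = lam.1 0 := by
  unfold psum
  rw [Finset.sum_eq_single 0]
  · simp
  · intro j _ hj
    rw [if_neg]
    intro h
    exact hj (Fin.ext (by simpa using h))
  · intro h; exact absurd (Finset.mem_univ _) h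

theorem card_filter_coe {P : ℤ → Prop} [DecidablePred P] {t : Finset ℤ}
    (h : ∀ x, x ∈ t ↔ (-(d : ℤ) ≤ x ∧ x ≤ d) ∧ P x) :
    (Finset.univ.filter fun x : SInt d => P x.1).card = t.card := by
  refine Finset.card_bij (fun x _ => x.1) ?_ (fun _ _ _ _ hh => Subtype.ext hh) ?_
  · intro x hx
    exact (h _).2 ⟨Finset.mem_Icc.1 x.2, (Finset.mem_filter.1 hx).2⟩
  · intro x hx
    obtain ⟨h1, h2⟩ := (h x).1 hx
    exact ⟨⟨x, Finset.mem_Icc.2 h1⟩, Finset.mem_filter.2 ⟨Finset.mem_univ _, h2⟩, rfl⟩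

theorem psum_le (lam : Comp m n d) (k : ℕ) : psum lam k ≤ d := by
  by_cases h : m + n ≤ k
  · rw [psum_last lam h]
  · have := psum_mono lam (le_of_not_ge h)
    rwa [psum_last lam le_rfl] at this

theorem card_lbl_zero (lam : Comp m n d) :
    (Finset.univ.filter fun x => lbl lam x = 0).card = 2 * lam.1 0 + 1 := by
  have h1 : (Finset.univ.filter fun x => lbl lam x = 0) = Finset.univ.filter fun x : SInt d =>
      -(psum lam 0 : ℤ) ≤ x.1 ∧ x.1 ≤ psum lam 0 := by
    have h := mem_block lam 0
    unfold block at h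
    rw [if_pos coe_zero] at h
    apply Finset.ext
    intro x
    rw [h x, Finset.mem_filter, Subtype.ext_iff, coe_lbl]
    simp
  have h2 := psum_le lam 0
  rw [h1, card_filter_coe (P := fun x => -(psum lam 0 : ℤ) ≤ x ∧ x ≤ psum lam 0)
    (t := Finset.Icc (-(psum lam 0 : ℤ)) (psum lam 0)), Int.card_Icc, psum_zero]
  · omega
  · intro x
    rw [Finset.mem_Icc]
    omega

theorem card_lbl_pos (lam : Comp m n d) (k : ℕ) (hk : k + 1 < m + n + 1) (i : SInt (m + n))
    (hi : i.1 = k + 1) :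
    (Finset.univ.filter fun x => lbl lam x = i).card = lam.1 ⟨k + 1, hk⟩ := by
  have e1 : i.1.natAbs = k + 1 := by omega
  have h1 : (Finset.univ.filter fun x => lbl lam x = i) = Finset.univ.filter fun x : SInt d =>
      (psum lam k : ℤ) < x.1 ∧ x.1 ≤ psum lam (k + 1) := by
    have h := mem_block lam i
    unfold block at h
    rw [if_neg (by omega), if_pos (by omega), e1, Nat.add_sub_cancel] at h
    apply Finset.ext
    intro x
    rw [h x, Finset.mem_filter, Subtype.ext_iff, coe_lbl]
    simp
  have h2 := psum_le lam (k + 1)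
  rw [h1, card_filter_coe (P := fun x => (psum lam k : ℤ) < x ∧ x ≤ psum lam (k + 1))
    (t := Finset.Ioc (psum lam k : ℤ) (psum lam (k + 1))), Int.card_Ioc, psum_succ lam k hk]
  · omega
  · intro x
    rw [Finset.mem_Ioc]
    omega

/-- The row vector of a matrix with given row sums. -/
theorem row_eq {M : Mat m n} (hM : ∀ i j, M i j = M (-i) (-j)) {mu : Comp m n d}
    (h : ∀ i, ∑ j, M i j = (Finset.univ.filter fun x => lbl mu x = i).card) : row M = mu.1 := by
  funext k
  unfold row
  split_ifs with hk
  · subst hk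
    have h0 := h 0
    rw [card_lbl_zero, sum_even_fun _ (fun x => by
      have := hM 0 (-x); rwa [sint_neg_zero, sint_neg_neg] at this)] at h0
    unfold nat
    rw [if_pos ⟨rfl, rfl⟩]
    omega
  · obtain ⟨k, hk'⟩ := k
    cases k with
    | zero => exact absurd rfl hk
    | succ k =>
      rw [h, card_lbl_pos mu k hk']
      simp [idx]

theorem col_eq {M : Mat m n} (hM : ∀ i j, M i j = M (-i) (-j)) {nu : Comp m n d}
    (h : ∀ j, ∑ i, M i j = (Finset.univ.filter fun x => lbl nu x = j).card) : col M = nu.1 := by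
  have h1 : col M = row (fun i j => M j i) := by
    funext k
    unfold col row nat
    split_ifs <;> rfl
  rw [h1]
  exact row_eq (fun i j => hM j i) h

theorem row_kap (mu : Comp m n d) (g : W d) (nu : Comp m n d) : row (kap mu g nu) = mu.1 :=
  row_eq (kap_neg mu g nu) (sum_kap_row mu g nu)

theorem col_kap (mu : Comp m n d) (g : W d) (nu : Comp m n d) : col (kap mu g nu) = nu.1 :=
  col_eq (kap_neg mu g nu) (sum_kap_col mu g nu)

end Kap

/-! ### The bijection between matrices and triples -/

section Triples

variable {m n d : ℕ}

theorem par_eq_iff (lam mu : Comp m n d) (x y : SInt d) :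
    par (lbl lam x) = par (lbl mu y) ↔ ((Lab.of lam).odd x ↔ (Lab.of mu).odd y) := by
  rw [Lab.of_odd, Lab.of_odd, ← coe_lbl, ← coe_lbl]
  unfold par
  by_cases h1 : (lbl lam x).1.natAbs ≤ m <;> by_cases h2 : (lbl mu y).1.natAbs ≤ m
  · simp only [if_pos h1, if_pos h2, true_iff]; omega
  · simp only [if_pos h1, if_neg h2, zero_ne_one, false_iff]; omega
  · simp only [if_neg h1, if_pos h2, one_ne_zero, false_iff]; omega
  · simp only [if_neg h1, if_neg h2, true_iff]; omega

theorem kap_le_one {mu nu : Comp m n d} {g : W d} {hg : (Lab.of nu).Inc g}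
    (hc : (Lab.of nu).Compat (Lab.of mu) g hg) (i j : SInt (m + n)) (hij : par i ≠ par j) :
    kap mu g nu i j ≤ 1 := by
  rw [kap_eq_lbl, Finset.card_le_one]
  intro x hx y hy
  rw [Finset.mem_filter] at hx hy
  by_contra hne
  have h1 := Lab.compat_iff.1 hc x y hne
    (by rw [← coe_lbl, ← coe_lbl, hx.2.1, hy.2.1]) (by rw [← coe_lbl, ← coe_lbl, hx.2.2, hy.2.2])
  rw [← par_eq_iff, hx.2.1, hx.2.2] at h1
  exact hij h1.symm

/-- The matrix of a minimal double coset representative on whose `W_δ` the characters agree. -/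
def kapXi (mu : Comp m n d) (g : W d) (nu : Comp m n d) (hg : (Lab.of nu).Inc g)
    (hc : (Lab.of nu).Compat (Lab.of mu) g hg) : Xi m n d :=
  ⟨kap mu g nu, sum_kap mu g nu, kap_neg mu g nu, kap_le_one hc⟩

/-- Compatibility only concerns cells with two distinct points, and by hypothesis these have equal
row and column parity. -/
theorem compat_of_le_one {mu nu : Comp m n d} {g : W d} {hg : (Lab.of nu).Inc g}
    (h : ∀ i j, par i ≠ par j → kap mu g nu i j ≤ 1) :
    (Lab.of nu).Compat (Lab.of mu) g hg := by
  rw [Lab.compat_iff]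
  intro x y hne hb ha
  rw [← par_eq_iff]
  by_contra hp
  have h1 := h (lbl mu (g.1 x)) (lbl nu x) (fun hh => hp hh.symm)
  rw [kap_eq_lbl, Finset.card_le_one] at h1
  exact hne (h1 x (Finset.mem_filter.2 ⟨Finset.mem_univ _, rfl, rfl⟩) y
    (Finset.mem_filter.2 ⟨Finset.mem_univ _, Subtype.ext hb.symm, Subtype.ext ha.symm⟩))

/-- Central symmetry pairs off all entries except the central one; since the total is odd, $a_{00}$
is odd and the halving in `nat` is exact. -/
theorem sum_row (M : Xi m n d) : ∑ k, row M.1 k = d := by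
  obtain ⟨M, h1, h2, -⟩ := M
  have hr : ∀ i, ∑ j, M (-i) j = ∑ j, M i j := by
    intro i
    rw [← Equiv.sum_comp (negEquiv (m + n))]
    refine Finset.sum_congr rfl fun j _ => ?_
    rw [negEquiv_apply, ← h2]
  have h3 := sum_even_fun (fun i => ∑ j, M i j) hr
  have h4 := sum_even_fun (fun j => M 0 j) (fun x => by
    have := h2 0 (-x); rwa [sint_neg_zero, sint_neg_neg] at this)
  rw [h1] at h3
  rw [sum_pos_eq (fun i => ∑ j, M i j)] at h3
  rw [Fin.sum_univ_succ]
  have h5 : ∀ k : Fin (m + n), row M k.succ = ∑ j, M (ptSucc k) j := by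
    intro k
    unfold row
    rw [if_neg (Fin.succ_ne_zero k)]
    have : (idx k.succ : SInt (m + n)) = ptSucc k := Subtype.ext (by simp [idx, coe_ptSucc])
    rw [this]
  have h6 : row M 0 = (M 0 0 - 1) / 2 + ∑ j with 0 < j.1, M 0 j := by
    unfold row nat
    rw [if_pos rfl, if_pos ⟨rfl, rfl⟩]
  simp only [h5]
  rw [h6]
  omega

theorem sum_col (M : Xi m n d) : ∑ k, col M.1 k = d := by
  have h1 : col M.1 = row (fun i j => M.1 j i) := by
    funext k
    unfold col row nat
    split_ifs <;> rfl
  rw [h1]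
  exact sum_row (⟨fun i j => M.1 j i, by rw [Finset.sum_comm]; exact M.2.1,
    fun i j => M.2.2.1 j i, fun i j h => M.2.2.2 j i h.symm⟩ : Xi m n d)

/-- The row composition of a matrix. -/
def rowComp (M : Xi m n d) : Comp m n d := ⟨row M.1, sum_row M⟩

/-- The column composition of a matrix. -/
def colComp (M : Xi m n d) : Comp m n d := ⟨col M.1, sum_col M⟩

theorem row_sum_eq (M : Xi m n d) (i : SInt (m + n)) :
    ∑ j, M.1 i j = (Finset.univ.filter fun x => lbl (rowComp M) x = i).card := by
  have hneg : ∀ i, (∑ j, M.1 i j = (Finset.univ.filter fun x => lbl (rowComp M) x = i).card) →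
      ∑ j, M.1 (-i) j = (Finset.univ.filter fun x => lbl (rowComp M) x = -i).card := by
    intro i hi
    rw [← Equiv.sum_comp (negEquiv (m + n))]
    simp only [negEquiv_apply, ← M.2.2.1]
    rw [hi]
    refine Finset.card_bij (fun z _ => -z) ?_ (fun z _ z' _ h => sint_neg_inj.1 h) ?_
    · intro z hz
      rw [Finset.mem_filter] at hz ⊢
      exact ⟨Finset.mem_univ _, by rw [lbl_neg, hz.2]⟩
    · intro z hz
      refine ⟨-z, ?_, sint_neg_neg z⟩
      rw [Finset.mem_filter] at hz ⊢
      exact ⟨Finset.mem_univ _, by rw [lbl_neg, hz.2, sint_neg_neg]⟩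
  have hpos : ∀ i, 0 < i.1 →
      ∑ j, M.1 i j = (Finset.univ.filter fun x => lbl (rowComp M) x = i).card := by
    intro i hi
    have hb := Finset.mem_Icc.1 i.2
    have e : i.1 = ((i.1.toNat - 1 : ℕ) : ℤ) + 1 := by omega
    rw [card_lbl_pos (rowComp M) (i.1.toNat - 1) (by omega) i e]
    have hr : (rowComp M).1 = row M.1 := rfl
    rw [hr]
    unfold row
    rw [if_neg (by rw [Fin.ext_iff]; simp)]
    have : (idx ⟨i.1.toNat - 1 + 1, by omega⟩ : SInt (m + n)) = i :=
      Subtype.ext (by simp [idx]; omega)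
    rw [this]
  rcases lt_trichotomy i.1 0 with h | h | h
  · have := hneg (-i) (hpos (-i) (by rw [coe_neg]; omega))
    rwa [sint_neg_neg] at this
  · have h0 : i = 0 := Subtype.ext h
    subst h0
    rw [card_lbl_zero]
    change _ = 2 * row M.1 0 + 1
    have h4 := sum_even_fun (fun j => M.1 0 j) (fun x => by
      have := M.2.2.1 0 (-x); rwa [sint_neg_zero, sint_neg_neg] at this)
    have h6 : row M.1 0 = (M.1 0 0 - 1) / 2 + ∑ j with 0 < j.1, M.1 0 j := by
      unfold row nat
      rw [if_pos rfl, if_pos ⟨rfl, rfl⟩]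
    have hr : ∀ i, ∑ j, M.1 (-i) j = ∑ j, M.1 i j := by
      intro i
      rw [← Equiv.sum_comp (negEquiv (m + n))]
      refine Finset.sum_congr rfl fun j _ => ?_
      rw [negEquiv_apply, ← M.2.2.1]
    have h3 := sum_even_fun (fun i => ∑ j, M.1 i j) hr
    rw [M.2.1] at h3
    omega
  · exact hpos i h

theorem col_sum_eq (M : Xi m n d) (j : SInt (m + n)) :
    ∑ i, M.1 i j = (Finset.univ.filter fun x => lbl (colComp M) x = j).card := by
  let N : Xi m n d := ⟨fun i j => M.1 j i, by rw [Finset.sum_comm]; exact M.2.1,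
    fun i j => M.2.2.1 j i, fun i j h => M.2.2.2 j i h.symm⟩
  have h1 : rowComp N = colComp M := by
    apply Subtype.ext
    funext k
    change row _ k = col _ k
    unfold col row nat
    split_ifs <;> rfl
  rw [← h1]
  exact row_sum_eq N j

theorem lbl_mono (lam : Comp m n d) : Monotone (lbl lam) := fun _ _ h => (Lab.of lam).mono h

/-- The points of $[-d..d]$ are distributed over the cells in lexicographic order, columns before
rows; `ρ` is the resulting row label. -/
theorem exists_labelling (M : Xi m n d) : ∃ ρ : SInt d → SInt (m + n),
    (∀ x, ρ (-x) = -ρ x) ∧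
    ∀ i j, (Finset.univ.filter fun x => lbl (colComp M) x = j ∧ ρ x = i).card = M.1 i j := by
  let L := SInt (m + n) ×ₗ SInt (m + n)
  let wt : L → ℕ := fun l => M.1 (ofLex l).2 (ofLex l).1
  have hwt : ∑ l, wt l = Fintype.card (SInt d) := by
    rw [card_SInt, ← M.2.1, Finset.sum_comm,
      ← Equiv.sum_comp (toLex : SInt (m + n) × SInt (m + n) ≃ L) wt, Fintype.sum_prod_type]
    rfl
  obtain ⟨F, hF, hc⟩ := exists_monotone_of_card wt hwt
  have hcard : ∀ i j, (Finset.univ.filter fun x => (ofLex (F x)).1 = j ∧ (ofLex (F x)).2 = i).card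
      = M.1 i j := by
    intro i j
    refine Eq.trans ?_ (hc (toLex (j, i)))
    congr 1
    apply Finset.filter_congr
    intro x _
    rw [← toLex_ofLex (F x), toLex.injective.eq_iff, Prod.ext_iff]
    rfl
  -- Both sides are monotone with the column sums as fibre sizes.
  have hcol : ∀ x, (ofLex (F x)).1 = lbl (colComp M) x := by
    intro x
    refine eq_of_monotoneOn_of_card (t := Finset.univ) (F := fun x => (ofLex (F x)).1)
      (G := lbl (colComp M)) ?_ ((lbl_mono _).monotoneOn _) ?_ x (Finset.mem_univ x)
    · intro x _ y _ hxy
      exact Prod.Lex.monotone_fst _ _ (hF hxy)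
    · intro j
      rw [← col_sum_eq, Finset.card_eq_sum_card_fiberwise (f := fun x => (ofLex (F x)).2)
        (t := Finset.univ) (fun _ _ => Finset.mem_univ _)]
      refine Finset.sum_congr rfl fun i _ => ?_
      rw [Finset.filter_filter, hcard]
  -- The right side is monotone too, and its fibre sizes agree by $a_{ij}=a_{-i,-j}$; so oddness
  -- comes from uniqueness.
  have hodd : ∀ x, F x = toLex (-(ofLex (F (-x))).1, -(ofLex (F (-x))).2) := by
    intro x
    refine eq_of_monotoneOn_of_card (t := Finset.univ) (F := F)
      (G := fun x => toLex (-(ofLex (F (-x))).1, -(ofLex (F (-x))).2)) (hF.monotoneOn _) ?_ ?_ x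
      (Finset.mem_univ x)
    · intro x _ y _ hxy
      have hxy' : -y ≤ -x := by
        rcases hxy.lt_or_eq with h | rfl
        · exact (sint_neg_lt.2 h).le
        · exact le_rfl
      have h1 := Prod.Lex.le_iff.1 (hF hxy')
      apply Prod.Lex.le_iff.2
      have hl : ∀ u v : SInt (m + n), u ≤ v → -v ≤ -u := by
        intro u v h
        rcases h.lt_or_eq with h | rfl
        · exact (sint_neg_lt.2 h).le
        · exact le_rfl
      rcases h1 with h1 | ⟨h1, h2⟩
      · exact Or.inl (sint_neg_lt.2 h1)
      · exact Or.inr ⟨(congrArg (fun z => -z) h1).symm, hl _ _ h2⟩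
    · intro l
      rw [hc]
      change M.1 (ofLex l).2 (ofLex l).1 = _
      rw [M.2.2.1, ← hcard]
      refine Finset.card_bij (fun z _ => -z) ?_ (fun z _ z' _ h => sint_neg_inj.1 h) ?_
      · intro z hz
        rw [Finset.mem_filter] at hz ⊢
        refine ⟨Finset.mem_univ _, ?_⟩
        rw [sint_neg_neg, hz.2.1, hz.2.2, sint_neg_neg, sint_neg_neg]; rfl
      · intro z hz
        rw [Finset.mem_filter] at hz
        refine ⟨-z, ?_, sint_neg_neg z⟩
        rw [Finset.mem_filter, ← hz.2]
        exact ⟨Finset.mem_univ _, (sint_neg_neg _).symm, (sint_neg_neg _).symm⟩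
  refine ⟨fun x => (ofLex (F x)).2, fun x => ?_, fun i j => ?_⟩
  · dsimp only
    rw [hodd (-x), sint_neg_neg]; rfl
  · simp only [← hcol]
    exact hcard i j

/-- A signed permutation `w` sorting the row labels `ρ` turns them into the block labels of the row
composition, so `w⁻¹` has matrix `M`; it is replaced by a shortest element of its double coset. -/
theorem exists_triple (M : Xi m n d) :
    ∃ g, IsShortest (rowComp M) g (colComp M) ∧ kap (rowComp M) g (colComp M) = M.1 := by
  obtain ⟨ρ, hρ, hc⟩ := exists_labelling M
  obtain ⟨w, hw⟩ := exists_sort (fun x => (ρ x).1) (fun x => by rw [hρ, coe_neg])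
  have h1 : ∀ x, ρ (w.1 x) = lbl (rowComp M) x := by
    intro x
    refine eq_of_monotoneOn_of_card (t := Finset.univ) (F := fun x => ρ (w.1 x))
      (G := lbl (rowComp M)) ?_ ((lbl_mono _).monotoneOn _) ?_ x (Finset.mem_univ x)
    · intro x _ y _ hxy
      exact Subtype.coe_le_coe.1 (hw hxy)
    · intro i
      rw [← row_sum_eq]
      have e1 : (Finset.univ.filter fun x => ρ (w.1 x) = i).card =
          (Finset.univ.filter fun x => ρ x = i).card := by
        simp only [Finset.card_filter]
        rw [Equiv.sum_comp w.1 (fun x => if ρ x = i then 1 else 0)]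
      rw [e1, Finset.card_eq_sum_card_fiberwise (f := lbl (colComp M)) (t := Finset.univ)
        (fun _ _ => Finset.mem_univ _)]
      refine Finset.sum_congr rfl fun j _ => ?_
      rw [Finset.filter_filter, ← hc i j]
      simp only [and_comm]
  have h2 : kap (rowComp M) w⁻¹ (colComp M) = M.1 := by
    funext i j
    rw [kap_eq_lbl, ← hc i j]
    simp only [← h1, W_apply_inv_self]
  obtain ⟨g, hg, hk, -⟩ := exists_shortest (rowComp M) (colComp M) w⁻¹
  exact ⟨g, hg, hk.trans h2⟩

/-- The minimal double coset representative of a matrix. -/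
def gOf (M : Xi m n d) : W d := Classical.choose (exists_triple M)

theorem gOf_shortest (M : Xi m n d) : IsShortest (rowComp M) (gOf M) (colComp M) :=
  (Classical.choose_spec (exists_triple M)).1

theorem kap_gOf (M : Xi m n d) : kap (rowComp M) (gOf M) (colComp M) = M.1 :=
  (Classical.choose_spec (exists_triple M)).2

theorem gOf_dMin (M : Xi m n d) : (Lab.of (colComp M)).DMin (Lab.of (rowComp M)) (gOf M) :=
  (gOf_shortest M).dMin

theorem gOf_compat (M : Xi m n d) :
    (Lab.of (colComp M)).Compat (Lab.of (rowComp M)) (gOf M) (gOf_dMin M).2 := by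
  apply compat_of_le_one
  rw [kap_gOf]
  exact M.2.2.2

theorem eq_of_kap_eq {M : Xi m n d} {mu nu : Comp m n d} {g : W d} (hk : kap mu g nu = M.1)
    (hg : (Lab.of nu).DMin (Lab.of mu) g) : mu = rowComp M ∧ g = gOf M ∧ nu = colComp M := by
  have h1 : mu = rowComp M := Subtype.ext (by rw [← row_kap mu g nu, hk]; rfl)
  have h2 : nu = colComp M := Subtype.ext (by rw [← col_kap mu g nu, hk]; rfl)
  subst h1 h2
  exact ⟨rfl, DMin_eq_of_kap hg (gOf_dMin M) (hk.trans (kap_gOf M).symm), rfl⟩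

end Triples

/-! ## The standard basis -/

section StandardBasis

variable {m n d : ℕ}

open Classical in
theorem isE_iff (M : Xi m n d) (f : Schur m n d) : IsE M f ↔ ∀ nu mu, entry f nu mu =
    if nu = colComp M ∧ mu = rowComp M then
      (Lab.of (colComp M)).dbl (Lab.of (rowComp M)) (gOf M) (gOf_dMin M).2 else 0 := by
  have h0 := TDouble_eq (rowComp M) (colComp M) (gOf_dMin M).2
  constructor
  · rintro ⟨mu, g, nu, h1, h2, h3, h4⟩
    obtain ⟨rfl, rfl, rfl⟩ := eq_of_kap_eq h3 h1.dMin
    intro nu mu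
    unfold entry
    rw [h4, h0]
  · intro h
    refine ⟨rowComp M, gOf M, colComp M, gOf_shortest M, ?_, kap_gOf M, ?_⟩
    · rw [evenOddTrivial_iff (gOf_dMin M).2 (gOf_dMin M).1]
      exact gOf_compat M
    · intro nu mu
      rw [h0]
      exact h nu mu

theorem existsUnique_isE (M : Xi m n d) : ∃! f : Schur m n d, IsE M f := by
  classical
  obtain ⟨f, hf⟩ := exists_schur (fun nu mu => if nu = colComp M ∧ mu = rowComp M then
      (Lab.of (colComp M)).dbl (Lab.of (rowComp M)) (gOf M) (gOf_dMin M).2 else 0)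
    (fun nu mu => by
      split_ifs with h
      · rw [h.2]; exact Lab.leftEig_dbl
      · exact Lab.leftEig_zero)
    (fun nu mu => by
      split_ifs with h
      · rw [h.1]; exact Lab.rightEig_dbl (gOf_dMin M).1 (gOf_compat M)
      · exact Lab.rightEig_zero)
  refine ⟨f, (isE_iff M f).2 hf, fun f' hf' => ?_⟩
  apply schur_ext
  intro nu mu
  rw [hf, (isE_iff M f').1 hf']

theorem isE_eElt (M : Xi m n d) : IsE M (eElt M) :=
  Classical.epsilon_spec (existsUnique_isE M).exists

open Classical in
theorem entry_eElt (M : Xi m n d) (nu mu : Comp m n d) : entry (eElt M) nu mu =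
    if nu = colComp M ∧ mu = rowComp M then
      (Lab.of (colComp M)).dbl (Lab.of (rowComp M)) (gOf M) (gOf_dMin M).2 else 0 :=
  (isE_iff M _).1 (isE_eElt M) nu mu

/-- The coordinate of an element of the iota Schur superalgebra with respect to `e_A`. -/
def coord (M : Xi m n d) : Schur m n d →ₗ[A] A where
  toFun f := coef (entry f (colComp M) (rowComp M)) (gOf M)
  map_add' f g := by rw [entry_add, map_add, Pi.add_apply]
  map_smul' a f := by rw [entry_smul, map_smul, Pi.smul_apply, RingHom.id_apply]

theorem coord_apply (M : Xi m n d) (f : Schur m n d) :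
    coord M f = coef (entry f (colComp M) (rowComp M)) (gOf M) := rfl

theorem eq_of_row_col_g {M N : Xi m n d} (h1 : rowComp M = rowComp N) (h2 : colComp M = colComp N)
    (h3 : gOf M = gOf N) : M = N := by
  apply Subtype.ext
  rw [← kap_gOf M, ← kap_gOf N, h1, h2, h3]

open Classical in
theorem coord_eElt (M N : Xi m n d) : coord M (eElt N) = if M = N then 1 else 0 := by
  rw [coord_apply, entry_eElt]
  split_ifs with h1 h2 h2
  · subst h2
    rw [Lab.coef_dbl (gOf_dMin M).1 (gOf_dMin M), if_pos rfl]
  · obtain ⟨e1, e2⟩ := h1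
    have h3 := gOf_dMin M
    rw [e1, e2] at h3
    rw [Lab.coef_dbl (gOf_dMin N).1 h3, if_neg]
    intro h
    exact h2 (eq_of_row_col_g e2 e1 h)
  · subst h2; exact absurd ⟨rfl, rfl⟩ h1
  · rw [map_zero]; rfl

/-- Each compatible minimal `g` is `gOf` of its own matrix, so the coordinates see every coefficient
that an entry is determined by. -/
theorem eq_of_coord {f f' : Schur m n d} (h : ∀ M, coord M f = coord M f') : f = f' := by
  apply schur_ext
  intro nu mu
  rw [← sub_eq_zero]
  apply Lab.eq_zero_of_compat ((leftEig_entry f nu mu).sub (leftEig_entry f' nu mu))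
    ((rightEig_entry f nu mu).sub (rightEig_entry f' nu mu))
  intro g hg hg' hc
  have h1 := eq_of_kap_eq (M := kapXi mu g nu hg hc) rfl ⟨hg', hg⟩
  have h2 := h (kapXi mu g nu hg hc)
  rw [coord_apply, coord_apply, ← h1.1, ← h1.2.1, ← h1.2.2] at h2
  rw [map_sub, Pi.sub_apply, h2, sub_self]

/-- The coordinates with respect to the `e_A` as a linear equivalence. -/
def coordEquiv (m n d : ℕ) : Schur m n d ≃ₗ[A] (Xi m n d → A) :=
  LinearEquiv.ofBijective (LinearMap.pi coord) (by
    classical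
    constructor
    · exact fun f f' hf => eq_of_coord fun M => congrFun hf M
    · intro c
      refine ⟨∑ N, c N • eElt N, ?_⟩
      funext M
      rw [LinearMap.pi_apply, map_sum]
      simp [coord_eElt])

theorem coordEquiv_apply (f : Schur m n d) (M : Xi m n d) : coordEquiv m n d f M = coord M f := rfl

/-- The basis of the elements `e_A`. -/
def eBasis (m n d : ℕ) : Module.Basis (Xi m n d) A (Schur m n d) :=
  Module.Basis.ofEquivFun (coordEquiv m n d)

theorem eBasis_apply (M : Xi m n d) : eBasis m n d M = eElt M := by
  classical
  apply (coordEquiv m n d).injective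
  funext N
  unfold eBasis
  rw [Module.Basis.coe_ofEquivFun, LinearEquiv.apply_symm_apply, coordEquiv_apply, coord_eElt,
    Pi.single_apply]

end StandardBasis

/-! ## The bar involution of the Hecke algebra -/

theorem vpow_add (k l : ℤ) : vpow (k + l) = vpow k * vpow l := LaurentPolynomial.T_add k l

theorem vpow_zero : vpow 0 = 1 := LaurentPolynomial.T_zero

theorem vpow_neg_mul (k : ℤ) : vpow (-k) * vpow k = 1 := by
  rw [← vpow_add, neg_add_cancel, vpow_zero]

theorem vpow_pow (k : ℤ) (r : ℕ) : vpow k ^ r = vpow (r * k) := LaurentPolynomial.T_pow k r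

theorem barA_vpow (k : ℤ) : barA (vpow k) = vpow (-k) := LaurentPolynomial.invert_T k

theorem barA_barA (a : A) : barA (barA a) = a :=
  LaurentPolynomial.involutive_invert a

theorem barA_q : barA q = qInv := barA_vpow 2

theorem barA_qInv : barA qInv = q := by
  rw [← barA_q, barA_barA]

section BarHecke

variable {d : ℕ}

theorem barH_Tw (w : W d) : barH d (Tw w) = TwInv w⁻¹ := by
  unfold barH Tw
  refine (RingQuot.liftAlgHom_mkAlgHom_apply A (s := HRel d) _ barRel _).trans ?_
  rw [FreeAlgebra.lift_ι_apply]
  rfl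

theorem barH_algebraMap (a : A) : barH d (algebraMap A (H d) a) = algebraMap A (H d) (barA a) := by
  unfold barH
  exact AlgHom.commutes (RingQuot.liftAlgHom A (s := HRel d)
    ⟨FreeAlgebra.lift A (TwBar (d := d)), barRel⟩ : _ →ₐ[A] HBar d) a

theorem barH_smul (a : A) (z : H d) : barH d (a • z) = barA a • barH d z := by
  rw [Algebra.smul_def, map_mul, barH_algebraMap, ← Algebra.smul_def]

theorem TwInv_eq {w : W d} {z : H d} (h : Tw w * z = 1) : TwInv w = z := by
  rw [← one_mul z, ← TwInv_mul_Tw w, mul_assoc, h, mul_one]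

theorem barH_Tw_s (i : Fin d) : barH d (Tw (s i)) = qInv • Tw (s i) + (qInv - 1) • (1 : H d) := by
  rw [barH_Tw, s_inv]
  apply TwInv_eq
  rw [mul_add, mul_smul_comm, mul_smul_comm, mul_one, Tw_s_sq, smul_add, smul_smul, smul_smul,
    mul_comm qInv q, q_mul_qInv, one_smul, add_right_comm, ← add_smul]
  have : qInv * (q - 1) + (qInv - 1) = 0 := by linear_combination q_mul_qInv
  rw [this, zero_smul, zero_add]

theorem barH_barH (z : H d) : barH d (barH d z) = z := by
  have hs : ∀ i : Fin d, barH d (barH d (Tw (s i))) = Tw (s i) := by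
    intro i
    rw [barH_Tw_s, map_add, barH_smul, barH_smul, map_one, barH_Tw_s, map_sub, barA_qInv, map_one,
      smul_add, smul_smul, smul_smul, q_mul_qInv, one_smul, add_assoc, ← add_smul]
    have : q * (qInv - 1) + (q - 1) = 0 := by linear_combination q_mul_qInv
    rw [this, zero_smul, add_zero]
  have hw : ∀ w : W d, barH d (barH d (Tw w)) = Tw w := by
    refine W_induct_left ?_ ?_
    · rw [Tw_one, map_one, map_one]
    · intro w i h ih
      rw [← Tw_s_mul_of_lt h, map_mul, map_mul, hs, ih]
  rw [sum_coef z, map_sum, map_sum]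
  refine Finset.sum_congr rfl fun w _ => ?_
  rw [barH_smul, barH_smul, barA_barA, hw]

/-- Bar inverts both `T_{s_i}` and its eigenvalue; therefore it preserves eigenvectors. -/
theorem Lab.barA_eps_mul (b : Lab d) (i : Fin d) : barA (b.eps i) * b.eps i = 1 := by
  unfold Lab.eps Lab.eta
  split_ifs
  · rw [map_mul, map_neg, barA_q, barA_qInv]
    linear_combination (q * qInv + 1) * q_mul_qInv
  · rw [mul_one, barA_q, mul_comm, q_mul_qInv]

theorem barH_Tw_s_mul (i : Fin d) : barH d (Tw (s i)) * Tw (s i) = 1 := by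
  rw [barH_Tw, s_inv, TwInv_mul_Tw]

theorem mul_barH_Tw_s (i : Fin d) : Tw (s i) * barH d (Tw (s i)) = 1 := by
  rw [barH_Tw, s_inv, Tw_mul_TwInv]

theorem Lab.LeftEig.bar {b : Lab d} {z : H d} (h : b.LeftEig z) : b.LeftEig (barH d z) := by
  intro i hi
  have h1 := congrArg (barH d) (h i hi)
  rw [map_mul, barH_smul] at h1
  have h2 := congrArg (fun x => b.eps i • (Tw (s i) * x)) h1
  rw [← mul_assoc, mul_barH_Tw_s, one_mul, mul_smul_comm, smul_smul, mul_comm, b.barA_eps_mul,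
    one_smul] at h2
  exact h2.symm

theorem Lab.RightEig.bar {b : Lab d} {z : H d} (h : b.RightEig z) : b.RightEig (barH d z) := by
  intro i hi
  have h1 := congrArg (barH d) (h i hi)
  rw [map_mul, barH_smul] at h1
  have h2 := congrArg (fun x => b.eps i • (x * Tw (s i))) h1
  rw [mul_assoc, barH_Tw_s_mul, mul_one, smul_mul_assoc, smul_smul, mul_comm, b.barA_eps_mul,
    one_smul] at h2
  exact h2.symm

/-- The coefficients of the bar conjugate of `T_w` in longest elements. -/
theorem coef_barH_Tw (w : W d) : (∀ u, len w ≤ len u → u ≠ w → coef (barH d (Tw w)) u = 0) ∧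
    coef (barH d (Tw w)) w = qInv ^ len w := by
  refine W_induct_left (motive := fun w => (∀ u, len w ≤ len u → u ≠ w →
    coef (barH d (Tw w)) u = 0) ∧ coef (barH d (Tw w)) w = qInv ^ len w) ?_ ?_ w
  · rw [Tw_one, map_one, ← Tw_one, len_one, pow_zero]
    refine ⟨fun u _ hu => ?_, ?_⟩
    · rw [Lab.coef_Tw', if_neg hu]
    · rw [Lab.coef_Tw', if_pos rfl]
  · intro w i h ih
    have hl := len_s_mul_of_lt h
    have e : ∀ u, coef (barH d (Tw (s i * w))) u =
        qInv * lamOp i (coef (barH d (Tw w))) u + (qInv - 1) * coef (barH d (Tw w)) u := by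
      intro u
      rw [← Tw_s_mul_of_lt h, map_mul, barH_Tw_s, add_mul, smul_mul_assoc, smul_mul_assoc, one_mul,
        map_add, map_smul, map_smul, coef_s_mul]
      rfl
    have h0 : coef (barH d (Tw w)) (s i * w) = 0 := ih.1 _ (by omega) (fun hh => by
      rw [hh] at hl; omega)
    constructor
    · intro u hu hne
      have h1 : coef (barH d (Tw w)) u = 0 := ih.1 u (by omega) (fun hh => by rw [hh] at hu; omega)
      have h2 : coef (barH d (Tw w)) (s i * u) = 0 := by
        apply ih.1
        · have h3 := len_mul_le (s i) (s i * u)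
          rw [s_mul_s_mul, len_s] at h3
          omega
        · intro hh
          exact hne (by rw [← hh, s_mul_s_mul])
      rw [e, lamOp_apply, h1, h2]
      split_ifs <;> ring
    · rw [e, lamOp_apply, if_neg (by rw [s_mul_s_mul]; omega), s_mul_s_mul, h0, ih.2, hl, pow_succ]
      ring

end BarHecke

/-! ## The bar conjugate of `[xy]` -/

namespace Lab

variable {d : ℕ} (b : Lab d)

open Classical in
/-- The number of pairs of points in a common even block minus that for the odd blocks, where pairs
`(x, y)` are ordered and `x ≠ y`, `x ≠ -y`. -/
def sgnSum : ℤ := ∑ x, ∑ y, if x ≠ y ∧ x ≠ -y ∧ b.f x = b.f y then (if b.odd x then -1 else 1) else 0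

/-- An element of maximal length has a descent at every generator, so its negative is increasing on
blocks. -/
theorem exists_longest : ∃ u ∈ b.grp, ∀ x y, x < y → b.f x = b.f y → u.1 y < u.1 x := by
  obtain ⟨u, hu, hmax⟩ := Set.exists_max_image (b.grp : Set (W d)) len (Set.toFinite _)
    ⟨1, b.grp.one_mem⟩
  refine ⟨u, hu, fun x y hxy hb => ?_⟩
  have h1 := b.strictMono_on_blocks (φ := fun x => -(u.1 x).1) (fun x => by rw [W_neg, coe_neg])
    (fun i hi => by
      have h2 := hmax _ (b.grp.mul_mem hu (b.s_mem hi))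
      have h3 := mt len_lt_mul_s.2 (not_lt.2 h2)
      have h4 := W_pt_ne u i
      have h5 : u.1 (ptSucc i) < u.1 (pt i) := lt_of_le_of_ne (not_lt.1 h3) (Ne.symm h4)
      exact neg_lt_neg (Subtype.coe_lt_coe.2 h5)) x y hxy hb
  exact Subtype.coe_lt_coe.1 (neg_lt_neg_iff.1 h1)

/-- The inversions of the longest element are exactly the ordered non-opposite pairs within a block;
dropping the order counts each twice. -/
theorem invSum_longest {u : W d} (hu : u ∈ b.grp)
    (h : ∀ x y, x < y → b.f x = b.f y → u.1 y < u.1 x) {F : SInt d → SInt d → ℤ}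
    (hF : ∀ x y, F x y = F y x) :
    2 * invSum F u = ∑ x, ∑ y, if x ≠ y ∧ x ≠ -y ∧ b.f x = b.f y then F x y else 0 := by
  have h1 : invSum F u = ∑ x, ∑ y, if x < y ∧ x ≠ -y ∧ b.f x = b.f y then F x y else 0 := by
    unfold invSum
    refine Finset.sum_congr rfl fun x _ => Finset.sum_congr rfl fun y _ => ?_
    congr 1
    apply propext
    constructor
    · rintro ⟨a1, a2, a3⟩
      refine ⟨a1, a2, le_antisymm (b.mono a1.le) ?_⟩
      rw [← hu x, ← hu y]
      exact b.mono a3.le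
    · rintro ⟨a1, a2, a3⟩
      exact ⟨a1, a2, h x y a1 a3⟩
  have h2 : invSum F u = ∑ x, ∑ y, if y < x ∧ x ≠ -y ∧ b.f x = b.f y then F x y else 0 := by
    rw [h1, Finset.sum_comm]
    refine Finset.sum_congr rfl fun x _ => Finset.sum_congr rfl fun y _ => ?_
    rw [hF y x]
    congr 1
    apply propext
    have : y ≠ -x ↔ x ≠ -y := by
      rw [ne_eq, ne_eq, not_iff_not]
      simp only [Subtype.ext_iff, coe_neg]; omega
    rw [this, eq_comm (a := b.f y)]
  rw [two_mul]
  nth_rw 1 [h1]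
  rw [h2]
  simp only [← Finset.sum_add_distrib]
  refine Finset.sum_congr rfl fun x _ => Finset.sum_congr rfl fun y _ => ?_
  rcases lt_trichotomy x y with hh | hh | hh
  · simp [hh, hh.not_gt, hh.ne]
  · simp [hh]
  · simp [hh, hh.not_gt, hh.ne']

theorem len_le_longest {u : W d}
    (h : ∀ x y, x < y → b.f x = b.f y → u.1 y < u.1 x) :
    ∀ w ∈ b.grp, len w ≤ len u := by
  intro w hw
  have h1 := two_len w
  have h2 := two_len u
  have h3 : invSum (fun _ _ => 1) w ≤ invSum (fun _ _ => 1) u := by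
    unfold invSum
    refine Finset.sum_le_sum fun x _ => Finset.sum_le_sum fun y _ => ?_
    split_ifs with c1 c2 c2
    · exact le_rfl
    · refine absurd ⟨c1.1, c1.2.1, h x y c1.1 (le_antisymm (b.mono c1.1.le) ?_)⟩ c2
      rw [← hw x, ← hw y]
      exact b.mono c1.2.2.le
    · exact zero_le_one
    · exact le_rfl
  omega

theorem sgnSum_eq {u : W d} (hu : u ∈ b.grp)
    (h : ∀ x y, x < y → b.f x = b.f y → u.1 y < u.1 x) :
    b.sgnSum = 4 * len u - 4 * invSum b.oddPair u := by
  have hk := b.invSum_longest hu h b.oddPair_comm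
  have hl := b.invSum_longest hu h (F := fun _ _ => 1) (fun _ _ => rfl)
  rw [← two_len] at hl
  have h3 : b.sgnSum = (∑ x, ∑ y, if x ≠ y ∧ x ≠ -y ∧ b.f x = b.f y then 1 else 0) -
      2 * ∑ x, ∑ y, if x ≠ y ∧ x ≠ -y ∧ b.f x = b.f y then b.oddPair x y else 0 := by
    unfold sgnSum
    simp only [Finset.mul_sum, ← Finset.sum_sub_distrib]
    refine Finset.sum_congr rfl fun x _ => Finset.sum_congr rfl fun y _ => ?_
    by_cases hc : x ≠ y ∧ x ≠ -y ∧ b.f x = b.f y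
    · simp only [if_pos hc]
      unfold oddPair
      by_cases ho : b.odd x
      · rw [if_pos ho, if_pos ⟨ho, hc.2.2⟩]; rfl
      · rw [if_neg ho, if_neg fun hh => ho hh.1]; rfl
    · simp only [if_neg hc]; rfl
  rw [h3, ← hk, ← hl]
  ring

theorem four_dvd_sgnSum : 4 ∣ b.sgnSum := by
  obtain ⟨u, hu, h⟩ := b.exists_longest
  exact ⟨len u - invSum b.oddPair u, by rw [b.sgnSum_eq hu h]; ring⟩

/-- The scalar by which the bar involution acts on `[xy]`. -/
def barScalar : A := vpow (-(b.sgnSum / 2))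

theorem exists_invSum_eq : ∀ u ∈ b.grp, ∃ k : ℕ, invSum b.oddPair u = 2 * k := by
  refine b.induct (motive := fun u => ∃ k : ℕ, invSum b.oddPair u = 2 * k) ?_ ?_
  · exact ⟨0, invSum_one _⟩
  · rintro u - i hi hlt ⟨k, hk⟩
    have h1 := invSum_mul_s b.oddPair i b.oddPair_comm b.oddPair_neg
      (b.oddPair_apply (b.s_mem hi)) u
    have h2 := b.oddPair_nonneg (pt i) (ptSucc i)
    rw [if_pos hlt, hk] at h1
    exact ⟨k + (b.oddPair (pt i) (ptSucc i)).toNat, by push_cast; omega⟩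

/-- The bar conjugate is again a left eigenvector supported on the subgroup, hence a multiple of
`Z`. The scalar is found by comparing coefficients at the longest element. -/
theorem barH_Z : barH d b.Z = b.barScalar • b.Z := by
  classical
  have hsupp : ∀ w, w ∉ b.grp → coef (barH d b.Z) w = 0 := by
    have key : ∀ u ∈ b.grp, ∀ w, w ∉ b.grp → coef (barH d (Tw u)) w = 0 := by
      refine b.induct (motive := fun u => ∀ w, w ∉ b.grp → coef (barH d (Tw u)) w = 0) ?_ ?_
      · intro w hw
        rw [Tw_one, map_one, ← Tw_one, Lab.coef_Tw', if_neg]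
        rintro rfl
        exact hw b.grp.one_mem
      · intro u _ i hi hlt ih w hw
        rw [← Tw_mul_s_of_lt (len_lt_mul_s.2 hlt), map_mul, barH_Tw_s, mul_add, mul_smul_comm,
          mul_smul_comm, mul_one, map_add, map_smul, map_smul, coef_mul_s, Pi.add_apply,
          Pi.smul_apply, Pi.smul_apply, ih w hw, rhoOp_apply, ih w hw, ih (w * s i)]
        · simp
        · intro hh
          apply hw
          have := b.grp.mul_mem hh (b.s_mem hi)
          rwa [mul_s_mul_s] at this
    intro w hw
    unfold Z
    rw [map_sum, map_sum, Finset.sum_apply]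
    refine Finset.sum_eq_zero fun u hu => ?_
    rw [barH_smul, map_smul, Pi.smul_apply, key u (Finset.mem_filter.1 hu).2 w hw, smul_zero]
  have h1 := b.eq_smul_Z b.leftEig_Z.bar hsupp
  obtain ⟨u, hu, hlong⟩ := b.exists_longest
  -- Only the conjugate of `Tw u` itself contributes here, since conjugates of shorter elements do
  -- not reach `u`.
  have hc : coef (barH d b.Z) u = barA (b.chi u) * qInv ^ len u := by
    unfold Z
    rw [map_sum, map_sum, Finset.sum_apply, Finset.sum_eq_single u]
    · rw [barH_smul, map_smul, Pi.smul_apply, (coef_barH_Tw u).2, smul_eq_mul]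
    · intro w hw hne
      rw [barH_smul, map_smul, Pi.smul_apply, (coef_barH_Tw w).1 u
        (b.len_le_longest hlong w (Finset.mem_filter.1 hw).2) hne.symm, smul_zero]
    · intro hh
      exact absurd (Finset.mem_filter.2 ⟨Finset.mem_univ _, hu⟩) hh
  have h2 : coef (barH d b.Z) u = coef (barH d b.Z) 1 * b.chi u := by
    have := congrFun (congrArg coef h1) u
    rw [map_smul, Pi.smul_apply, coef_Z, if_pos hu, smul_eq_mul] at this
    exact this
  rw [h1]
  congr 1
  have hs := b.sgnSum_eq hu hlong
  obtain ⟨k, hk2⟩ := b.exists_invSum_eq u hu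
  rw [hk2] at hs
  have hchi : b.chi u = (-qInv) ^ k := by
    unfold chi
    rw [hk2]
    congr 1
    omega
  have hbar : barA (b.chi u) = (-q) ^ k := by
    rw [hchi, map_pow, map_neg, barA_qInv]
  have hmul : b.chi u * (-q) ^ k = 1 := by
    rw [hchi, ← mul_pow, neg_mul_neg, mul_comm, q_mul_qInv, one_pow]
  rw [hc, hbar] at h2
  have h4 : coef (barH d b.Z) 1 = (-q) ^ k * (-q) ^ k * qInv ^ len u := by
    calc coef (barH d b.Z) 1 = coef (barH d b.Z) 1 * b.chi u * (-q) ^ k := by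
          rw [mul_assoc, hmul, mul_one]
      _ = _ := by rw [← h2]; ring
  rw [h4, ← mul_pow, neg_mul_neg, barScalar, q, qInv, ← vpow_add, vpow_pow, vpow_pow, ← vpow_add, hs]
  congr 1
  omega

theorem barA_barScalar : barA b.barScalar * b.barScalar = 1 := by
  rw [barScalar, barA_vpow, vpow_neg_mul]

/-- Conjugating $Z^2=PZ$ gives $c^2P=\overline{P}\,c$ with the unit $c=$ `barScalar`. -/
theorem barA_P : barA b.P = b.barScalar * b.P := by
  have h1 := congrArg (barH d) b.rightEig_Z.mul_Z
  rw [map_mul, barH_smul, b.barH_Z, smul_mul_smul_comm, b.rightEig_Z.mul_Z, smul_smul,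
    smul_smul] at h1
  have h2 := congrFun (congrArg coef h1) 1
  rw [map_smul, map_smul, Pi.smul_apply, Pi.smul_apply, coef_Z_one, smul_eq_mul, smul_eq_mul,
    mul_one, mul_one] at h2
  have h3 : barA b.barScalar * (b.barScalar * b.barScalar * b.P) =
      barA b.barScalar * (barA b.P * b.barScalar) := by rw [h2]
  linear_combination -h3 + (b.barScalar * b.P - barA b.P) * b.barA_barScalar

end Lab

/-! ## Triangularity of the bar involution -/

section Rank

variable {d : ℕ}

/-- The sum of `f` over the points up to `r`. -/
def partSum (f : SInt d → ℕ) (r : ℤ) : ℕ := ∑ z, if z.1 ≤ r then f z else 0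

/-- The indicator of the points whose preimage under `w` is at least `t`. -/
def preInd (w : W d) (t : ℤ) (z : SInt d) : ℕ := if t ≤ ((w⁻¹).1 z).1 then 1 else 0

/-- Comparison of the rank functions of signed permutations. -/
def RankLE (u w : W d) : Prop := ∀ t r, partSum (preInd u t) r ≤ partSum (preInd w t) r

theorem preInd_zero (w : W d) (t : ℤ) : preInd w t 0 = if t ≤ 0 then 1 else 0 := by
  unfold preInd
  rw [W_zero]; rfl

theorem preInd_mono (w : W d) (t : ℤ) {x y : SInt d} (h : (w⁻¹).1 x < (w⁻¹).1 y) :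
    preInd w t x ≤ preInd w t y := by
  have := Subtype.coe_lt_coe.2 h
  unfold preInd
  split_ifs <;> omega

theorem preInd_le_one (w : W d) (t : ℤ) (x : SInt d) : preInd w t x ≤ 1 := by
  unfold preInd
  split_ifs <;> omega

theorem partSum_s_mul (i : Fin d) (w : W d) (t r : ℤ) : partSum (preInd (s i * w) t) r =
    ∑ z, if ((s i).1 z).1 ≤ r then preInd w t z else 0 := by
  unfold partSum
  rw [← Equiv.sum_comp (s i).1]
  refine Finset.sum_congr rfl fun z _ => ?_
  unfold preInd
  rw [mul_inv_rev, s_inv, W_mul_apply, s_s_apply]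

theorem sum_ite_eq_partSum_add (f : SInt d → ℕ) {p : SInt d → Prop} [DecidablePred p] {c : ℤ}
    (T : Finset (SInt d)) (h : ∀ z, p z ↔ z.1 ≤ c ∨ z ∈ T) (h' : ∀ z ∈ T, ¬ z.1 ≤ c) :
    (∑ z, if p z then f z else 0) = partSum f c + ∑ z ∈ T, f z := by
  have h1 : ∑ z ∈ T, f z = ∑ z, if z ∈ T then f z else 0 := by
    rw [← Finset.sum_filter]
    congr 1
    ext; simp
  rw [h1, partSum, ← Finset.sum_add_distrib]
  refine Finset.sum_congr rfl fun z _ => ?_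
  have hz := h z
  have hz' := h' z
  by_cases h2 : z ∈ T
  · rw [if_pos (hz.2 (Or.inr h2)), if_neg (hz' h2), if_pos h2, zero_add]
  · rw [if_neg h2, add_zero]
    congr 1
    apply propext
    rw [hz]; tauto

/-- The change of partial sums under a simple reflection. -/
theorem partSum_cases (i : Fin d) (r : ℤ) :
    (∀ f : SInt d → ℕ, (∑ z, if ((s i).1 z).1 ≤ r then f z else 0) = partSum f r) ∨
    ∃ (a b : SInt d) (k k' : ℕ), ((a = pt i ∧ b = ptSucc i) ∨ (a = -ptSucc i ∧ b = -pt i) ∨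
        (i.1 = 0 ∧ a = -ptSucc i ∧ b = ptSucc i)) ∧ (i.1 ≠ 0 → k = 0 ∧ k' = 0) ∧
        (i.1 = 0 → b = ptSucc i) ∧
      ∀ f : SInt d → ℕ,
        (∑ z, if ((s i).1 z).1 ≤ r then f z else 0) = partSum f (a.1 - 1) + f b + k * f 0 ∧
        partSum f r = partSum f (a.1 - 1) + f a + k * f 0 ∧
        partSum f b.1 = partSum f (a.1 - 1) + f a + f b + k * f 0 + k' * f 0 := by
  -- Only a threshold separating two exchanged points is affected; there `b` replaces `a`. For `i =
  -- 0` the points $-1$ and $1$ enclose the fixed point 0, so both $r=-1$ and $r=0$ occur, and `k`,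
  -- `k'` record whether 0 lies below or above the threshold.
  by_cases hi : i.1 = 0
  · have hs := fun z => s_val i z
    simp only [hi, if_true, Nat.cast_zero] at hs
    have hb : (ptSucc i).1 = 1 := by rw [coe_ptSucc, hi]; rfl
    have ha : (-ptSucc i).1 = -1 := by rw [coe_neg, hb]
    have hab : -ptSucc i ≠ ptSucc i := by
      rw [ne_eq, Subtype.ext_iff, ha, hb]; omega
    have h0a : -ptSucc i ≠ 0 := by
      rw [ne_eq, Subtype.ext_iff, ha, coe_zero]; omega
    have h0b : ptSucc i ≠ 0 := by
      rw [ne_eq, Subtype.ext_iff, hb, coe_zero]; omega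
    have h3 : ∀ f : SInt d → ℕ, partSum f (ptSucc i).1 =
        partSum f ((-ptSucc i).1 - 1) + f (-ptSucc i) + f (ptSucc i) + f 0 := by
      intro f
      refine (sum_ite_eq_partSum_add f (c := (-ptSucc i).1 - 1) {-ptSucc i, ptSucc i, 0} ?_ ?_).trans ?_
      · intro z
        simp only [Finset.mem_insert, Finset.mem_singleton, Subtype.ext_iff, ha, hb, coe_zero]
        omega
      · intro z
        simp only [Finset.mem_insert, Finset.mem_singleton, Subtype.ext_iff, ha, hb, coe_zero]
        omega
      · rw [Finset.sum_insert (by simp [hab, h0a]), Finset.sum_pair h0b]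
        ring
    by_cases h1 : r = -1
    · right
      refine ⟨-ptSucc i, ptSucc i, 0, 1, Or.inr (Or.inr ⟨hi, rfl, rfl⟩), fun h => absurd hi h,
        fun _ => rfl, fun f => ⟨?_, ?_, ?_⟩⟩
      · refine (sum_ite_eq_partSum_add f (c := (-ptSucc i).1 - 1) {ptSucc i} ?_ ?_).trans ?_
        · intro z
          have := hs z
          simp only [Finset.mem_singleton, Subtype.ext_iff, ha, hb]
          split_ifs at this <;> omega
        · intro z
          simp only [Finset.mem_singleton, Subtype.ext_iff, ha, hb]
          omega
        · rw [Finset.sum_singleton]; ring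
      · refine (sum_ite_eq_partSum_add f (c := (-ptSucc i).1 - 1) {-ptSucc i} ?_ ?_).trans ?_
        · intro z
          simp only [Finset.mem_singleton, Subtype.ext_iff, ha]
          omega
        · intro z
          simp only [Finset.mem_singleton, Subtype.ext_iff, ha]
          omega
        · rw [Finset.sum_singleton]; ring
      · rw [h3]; ring
    · by_cases h2 : r = 0
      · right
        refine ⟨-ptSucc i, ptSucc i, 1, 0, Or.inr (Or.inr ⟨hi, rfl, rfl⟩), fun h => absurd hi h,
          fun _ => rfl, fun f => ⟨?_, ?_, ?_⟩⟩
        · refine (sum_ite_eq_partSum_add f (c := (-ptSucc i).1 - 1) {ptSucc i, 0} ?_ ?_).trans ?_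
          · intro z
            have := hs z
            simp only [Finset.mem_insert, Finset.mem_singleton, Subtype.ext_iff, ha, hb, coe_zero]
            split_ifs at this <;> omega
          · intro z
            simp only [Finset.mem_insert, Finset.mem_singleton, Subtype.ext_iff, ha, hb, coe_zero]
            omega
          · rw [Finset.sum_pair h0b]; ring
        · refine (sum_ite_eq_partSum_add f (c := (-ptSucc i).1 - 1) {-ptSucc i, 0} ?_ ?_).trans ?_
          · intro z
            simp only [Finset.mem_insert, Finset.mem_singleton, Subtype.ext_iff, ha, coe_zero]
            omega
          · intro z
            simp only [Finset.mem_insert, Finset.mem_singleton, Subtype.ext_iff, ha, coe_zero]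
            omega
          · rw [Finset.sum_pair h0a]; ring
        · rw [h3]; ring
      · left
        intro f
        refine Finset.sum_congr rfl fun z _ => ?_
        have := hs z
        congr 1
        apply propext
        split_ifs at this <;> omega
  · have hs := fun z => s_val i z
    simp only [hi, if_false] at hs
    have key : ∀ a b : SInt d, b.1 = a.1 + 1 → r = a.1 →
        (∀ z, ((s i).1 z).1 ≤ r ↔ z.1 ≤ a.1 - 1 ∨ z = b) → ∀ f : SInt d → ℕ,
        (∑ z, if ((s i).1 z).1 ≤ r then f z else 0) =
          partSum f (a.1 - 1) + f b + (0 : ℕ) * f 0 ∧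
        partSum f r = partSum f (a.1 - 1) + f a + (0 : ℕ) * f 0 ∧
        partSum f b.1 = partSum f (a.1 - 1) + f a + f b + (0 : ℕ) * f 0 + (0 : ℕ) * f 0 := by
      intro a b hab hr hz f
      refine ⟨?_, ?_, ?_⟩
      · refine (sum_ite_eq_partSum_add f (c := a.1 - 1) {b} ?_ ?_).trans ?_
        · intro z
          rw [hz, Finset.mem_singleton]
        · intro z
          simp only [Finset.mem_singleton, Subtype.ext_iff]
          omega
        · rw [Finset.sum_singleton]; ring
      · refine (sum_ite_eq_partSum_add f (c := a.1 - 1) {a} ?_ ?_).trans ?_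
        · intro z
          simp only [Finset.mem_singleton, Subtype.ext_iff]
          omega
        · intro z
          simp only [Finset.mem_singleton, Subtype.ext_iff]
          omega
        · rw [Finset.sum_singleton]; ring
      · refine (sum_ite_eq_partSum_add f (c := a.1 - 1) {a, b} ?_ ?_).trans ?_
        · intro z
          simp only [Finset.mem_insert, Finset.mem_singleton, Subtype.ext_iff]
          omega
        · intro z
          simp only [Finset.mem_insert, Finset.mem_singleton, Subtype.ext_iff]
          omega
        · rw [Finset.sum_pair (by rw [ne_eq, Subtype.ext_iff]; omega)]; ring
    by_cases h1 : r = i.1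
    · right
      refine ⟨pt i, ptSucc i, 0, 0, Or.inl ⟨rfl, rfl⟩, fun _ => ⟨rfl, rfl⟩, fun h => absurd h hi,
        key _ _ (by rw [coe_pt, coe_ptSucc]) h1 fun z => ?_⟩
      have := hs z
      rw [Subtype.ext_iff, coe_pt, coe_ptSucc]
      split_ifs at this <;> omega
    · by_cases h2 : r = -i.1 - 1
      · right
        refine ⟨-ptSucc i, -pt i, 0, 0, Or.inr (Or.inl ⟨rfl, rfl⟩), fun _ => ⟨rfl, rfl⟩,
          fun h => absurd h hi,
          key _ _ (by rw [coe_neg, coe_neg, coe_pt, coe_ptSucc]; ring)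
            (by rw [coe_neg, coe_ptSucc]; omega) fun z => ?_⟩
        have := hs z
        rw [Subtype.ext_iff, coe_neg, coe_neg, coe_pt, coe_ptSucc]
        split_ifs at this <;> omega
      · left
        intro f
        refine Finset.sum_congr rfl fun z _ => ?_
        have := hs z
        congr 1
        apply propext
        split_ifs at this <;> omega

/-- The lifting property. -/
theorem RankLE.lift {u w : W d} (h : RankLE u w) {i : Fin d} (hi : len w < len (s i * w)) :
    RankLE u (s i * w) ∧ RankLE (s i * u) (s i * w) := by
  have hlt := len_lt_s_mul.1 hi
  have h0 := W_zero w⁻¹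
  have main : ∀ t r, partSum (preInd u t) r ≤ partSum (preInd (s i * w) t) r ∧
      partSum (preInd (s i * u) t) r ≤ partSum (preInd (s i * w) t) r := by
    intro t r
    rw [partSum_s_mul, partSum_s_mul]
    rcases partSum_cases i r with hc | ⟨a, b, k, k', hab, hk, hb0, hc⟩
    · rw [hc, hc]
      exact ⟨h t r, h t r⟩
    · have hw : (w⁻¹).1 a < (w⁻¹).1 b := by
        rcases hab with ⟨rfl, rfl⟩ | ⟨rfl, rfl⟩ | ⟨hi0, rfl, rfl⟩
        · exact hlt
        · rw [W_neg, W_neg, sint_neg_lt]; exact hlt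
        · have e : pt i = 0 := Subtype.ext (by rw [coe_pt, hi0]; rfl)
          rw [e, h0] at hlt
          refine lt_trans ?_ hlt
          rw [W_neg, ← sint_neg_lt, sint_neg_neg, sint_neg_zero]
          exact hlt
      have hm := preInd_mono w t hw
      obtain ⟨w1, w2, w3⟩ := hc (preInd w t)
      obtain ⟨u1, u2, u3⟩ := hc (preInd u t)
      have d1 := h t r
      have d2 := h t (a.1 - 1)
      have d3 := h t b.1
      have e0 : preInd u t 0 = preInd w t 0 := by rw [preInd_zero, preInd_zero]
      have lu := preInd_le_one u t b
      have lw := preInd_le_one w t b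
      rw [e0] at u1 u2 u3
      refine ⟨by omega, ?_⟩
      -- If the indicator of `w` at `b` is 1, it dominates that of `u`, and the comparison below `a`
      -- suffices. If it is 0, the indicator of `w` also vanishes at `a`, and at the enclosed point
      -- 0 when `i = 0`, so the comparison at the threshold `b` gives the claim.
      rcases Nat.lt_or_ge (preInd w t b) 1 with hb | hb
      · have hz : k * preInd w t 0 = 0 ∧ k' * preInd w t 0 = 0 := by
          by_cases hi0 : i.1 = 0
          · have hz0 : preInd w t 0 ≤ preInd w t b := by
              apply preInd_mono
              rw [hb0 hi0]
              have e : pt i = 0 := Subtype.ext (by rw [coe_pt, hi0]; rfl)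
              rw [← e]
              exact hlt
            have : preInd w t 0 = 0 := by omega
            rw [this]; exact ⟨rfl, rfl⟩
          · obtain ⟨rfl, rfl⟩ := hk hi0
            exact ⟨zero_mul _, zero_mul _⟩
        omega
      · omega
  exact ⟨fun t r => (main t r).1, fun t r => (main t r).2⟩

/-- Prefixing `s i` multiplies the conjugate by a combination of `T_{s_i}` and 1, so the new support
lies in the old one and its `s i`-translates. Both are covered by the lifting property. -/
theorem rankLE_of_coef_ne_zero (w : W d) : ∀ u, coef (barH d (Tw w)) u ≠ 0 → RankLE u w := by
  refine W_induct_left (motive := fun w => ∀ u, coef (barH d (Tw w)) u ≠ 0 → RankLE u w) ?_ ?_ w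
  · intro u hu
    rw [Tw_one, map_one, ← Tw_one, Lab.coef_Tw'] at hu
    have : u = 1 := by
      by_contra h
      exact hu (if_neg h)
    subst this
    exact fun _ _ => le_rfl
  · intro w i h ih u hu
    by_cases h1 : coef (barH d (Tw w)) u = 0
    · by_cases h2 : coef (barH d (Tw w)) (s i * u) = 0
      · exfalso
        apply hu
        rw [← Tw_s_mul_of_lt h, map_mul, barH_Tw_s, add_mul, smul_mul_assoc, smul_mul_assoc,
          one_mul, map_add, map_smul, map_smul, coef_s_mul, Pi.add_apply, Pi.smul_apply,
          Pi.smul_apply, lamOp_apply, h1, h2]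
        simp
      · have := ((ih _ h2).lift h).2
        rwa [s_mul_s_mul] at this
    · exact ((ih _ h1).lift h).1

end Rank

/-! ### From rank functions to the order on matrices -/

section Sigma

variable {m n d : ℕ}

theorem exists_threshold {p : SInt d → Prop} (h : ∀ x y, x ≤ y → p x → p y) :
    ∃ t : ℤ, ∀ z, p z ↔ t ≤ z.1 := by
  classical
  by_cases hne : (Finset.univ.filter p).Nonempty
  · refine ⟨((Finset.univ.filter p).min' hne).1, fun z => ⟨fun hz => ?_, fun hz => ?_⟩⟩
    · exact Subtype.coe_le_coe.2 (Finset.min'_le _ _ (Finset.mem_filter.2 ⟨Finset.mem_univ _, hz⟩))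
    · exact h _ z (Subtype.coe_le_coe.1 hz) (Finset.mem_filter.1 (Finset.min'_mem _ hne)).2
  -- The empty set is cut out by a threshold beyond all points.
  · refine ⟨d + 1, fun z => ⟨fun hz => ?_, fun hz => ?_⟩⟩
    · exact absurd ⟨z, Finset.mem_filter.2 ⟨Finset.mem_univ _, hz⟩⟩ hne
    · have := Finset.mem_Icc.1 z.2
      omega

theorem sigma_kap (mu : Comp m n d) (w : W d) (nu : Comp m n d) (i j : SInt (m + n)) :
    sigma (kap mu w nu) i j =
      (Finset.univ.filter fun z => j ≤ lbl nu z ∧ lbl mu (w.1 z) ≤ i).card := by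
  unfold sigma
  have h1 : ∀ x y, kap mu w nu x y =
      ∑ z, if lbl nu z = y then (if lbl mu (w.1 z) = x then 1 else 0) else 0 := by
    intro x y
    rw [kap_eq_lbl, Finset.card_filter]
    simp only [ite_and]
  simp only [h1]
  rw [Finset.card_filter]
  simp only [Finset.sum_comm (t := (Finset.univ : Finset (SInt d)))]
  refine Finset.sum_congr rfl fun z _ => ?_
  simp only [Finset.sum_ite_eq, Finset.mem_filter, Finset.mem_univ, true_and]
  by_cases h2 : j ≤ lbl nu z <;> by_cases h3 : lbl mu (w.1 z) ≤ i <;> simp [h2, h3]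

/-- Unions of final column blocks and of initial row blocks are given by thresholds, so each
$\sigma_{ij}$ is a value of the rank function. -/
theorem sigma_kap_le {u w : W d} (h : RankLE u w) (mu nu : Comp m n d) (i j : SInt (m + n)) :
    sigma (kap mu u nu) i j ≤ sigma (kap mu w nu) i j := by
  obtain ⟨t, ht⟩ := exists_threshold (p := fun z => j ≤ lbl nu z)
    (fun x y hxy hx => hx.trans (lbl_mono nu hxy))
  obtain ⟨r, hr⟩ := exists_threshold (p := fun z => i < lbl mu z)
    (fun x y hxy hx => hx.trans_le (lbl_mono mu hxy))
  have h1 : ∀ v : W d, sigma (kap mu v nu) i j = partSum (preInd v t) (r - 1) := by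
    intro v
    rw [sigma_kap, Finset.card_filter, partSum,
      ← Equiv.sum_comp v.1 (fun z => if z.1 ≤ r - 1 then preInd v t z else 0)]
    refine Finset.sum_congr rfl fun z _ => ?_
    have hz := hr (v.1 z)
    rw [← not_le] at hz
    unfold preInd
    simp only [W_inv_apply_self, ht z]
    by_cases h2 : lbl mu (v.1 z) ≤ i
    · have : (v.1 z).1 ≤ r - 1 := by
        by_contra h3
        exact hz.2 (by omega) h2
      simp [h2, this]
    · have : ¬ (v.1 z).1 ≤ r - 1 := by
        have := hz.1 h2
        omega
      simp [h2, this]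
  rw [h1, h1]
  exact h t (r - 1)

end Sigma

/-! ## The bar involution of the iota Schur superalgebra -/

section BarSchur

variable {m n d : ℕ}

theorem Lab.barScalar_smul_barA (b : Lab d) (z : H d) :
    barA b.barScalar • b.barScalar • z = z := by
  rw [smul_smul, b.barA_barScalar, one_smul]

/-- Bar multiplies the generator $[xy]_\nu$ by `barScalar`; testing on generators gives this
rescaled conjugate, and linearity gives the converse. -/
theorem isBarOf_iff (f g : Schur m n d) : IsBarOf f g ↔ ∀ nu mu,
    entry g nu mu = barA (Lab.of nu).barScalar • barH d (entry f nu mu) := by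
  constructor
  · intro h nu mu
    have h1 := h (gen nu) (MulOpposite.op (algebraMap A (H d) (Lab.of nu).barScalar) • gen nu) (by
      intro lam
      rw [DFinsupp.smul_apply, Submodule.coe_smul]
      by_cases hl : lam = nu
      · subst hl
        rw [coe_gen_self, xy_eq, (Lab.of lam).barH_Z, MulOpposite.smul_eq_mul_unop,
          MulOpposite.unop_op, Algebra.smul_def, Algebra.commutes]
      · rw [gen_of_ne hl]; simp) mu
    have h2 : (Lab.of nu).barScalar • entry g nu mu = barH d (entry f nu mu) := by
      rw [Algebra.smul_def, Algebra.commutes]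
      refine Eq.trans ?_ h1
      rw [map_smul, DFinsupp.smul_apply, Submodule.coe_smul]
      rfl
    rw [← h2, Lab.barScalar_smul_barA]
  · intro h x y hxy mu
    obtain ⟨c, hc⟩ := exists_coords x
    have hy : ∀ nu, (y nu : H d) = xy nu * ((Lab.of nu).barScalar • barH d (c nu)) := by
      intro nu
      rw [hxy, hc, map_mul, xy_eq, (Lab.of nu).barH_Z, smul_mul_assoc, mul_smul_comm]
    rw [apply_eq_sum f x c hc, apply_eq_sum g y _ hy, map_sum]
    refine Finset.sum_congr rfl fun nu _ => ?_
    rw [h, smul_mul_smul_comm, (Lab.of nu).barA_barScalar, one_smul, map_mul]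

theorem existsUnique_isBarOf (f : Schur m n d) : ∃! g : Schur m n d, IsBarOf f g := by
  obtain ⟨g, hg⟩ := exists_schur
    (fun nu mu => barA (Lab.of nu).barScalar • barH d (entry f nu mu))
    (fun nu mu => (leftEig_entry f nu mu).bar.smul _)
    (fun nu mu => (rightEig_entry f nu mu).bar.smul _)
  refine ⟨g, (isBarOf_iff f g).2 hg, fun g' hg' => schur_ext fun nu mu => ?_⟩
  rw [hg, (isBarOf_iff f g').1 hg']

theorem entry_barS (f : Schur m n d) (nu mu : Comp m n d) :
    entry (barS f) nu mu = barA (Lab.of nu).barScalar • barH d (entry f nu mu) :=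
  (isBarOf_iff f _).1 (Classical.epsilon_spec (existsUnique_isBarOf f).exists) nu mu

theorem barS_add (f g : Schur m n d) : barS (f + g) = barS f + barS g :=
  schur_ext fun nu mu => by
    rw [entry_add, entry_barS, entry_barS, entry_barS, entry_add, map_add, smul_add]

theorem barS_smul (a : A) (f : Schur m n d) : barS (a • f) = barA a • barS f :=
  schur_ext fun nu mu => by
    rw [entry_smul, entry_barS, entry_barS, entry_smul, barH_smul, smul_comm]

theorem barS_barS (f : Schur m n d) : barS (barS f) = f :=
  schur_ext fun nu mu => by
    rw [entry_barS, entry_barS, barH_smul, barA_barA, barH_barH, Lab.barScalar_smul_barA]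

/-- The coefficients of `[xy]_μ T_u [xy]_ν` are supported on the double coset of `u`. -/
theorem kap_eq_of_coef_ne_zero {mu nu : Comp m n d} {u w : W d}
    (h : coef ((Lab.of mu).Z * Tw u * (Lab.of nu).Z) w ≠ 0) : kap mu w nu = kap mu u nu := by
  by_contra hne
  apply h
  refine Lab.coef_mul_Z_eq_zero _ (S := {w | kap mu w nu = kap mu u nu}) ?_ ?_ hne
  · intro y hy w hw
    have h1 := kap_mul (mu := mu) (nu := nu) (x := 1) (g := w) (y := y) (Subgroup.one_mem _)
      (by rwa [WP_eq])
    rw [one_mul] at h1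
    exact h1.symm.trans hw
  · intro w hw
    refine Lab.coef_Z_mul_eq_zero _ (S := {w | kap mu w nu = kap mu u nu}) ?_ ?_ hw
    · intro y hy w hw
      have h1 := kap_mul (mu := mu) (nu := nu) (x := y) (g := w) (y := 1) (by rwa [WP_eq])
        (Subgroup.one_mem _)
      rw [mul_one] at h1
      exact h1.symm.trans hw
    · intro w hw
      rw [Lab.coef_Tw', if_neg]
      rintro rfl
      exact hw rfl

/-- The label of `W_δ` for the matrix `M`. -/
def deltaLab (M : Xi m n d) : Lab d :=
  (Lab.of (colComp M)).meet (Lab.of (rowComp M)) (gOf M) (gOf_dMin M).2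

/-- Multiplying by `P` replaces `dbl` by $[xy]_\mu T_g[xy]_\nu$, whose conjugate is known. By
`barA_P` the conjugate of `P` is a unit multiple of `P`, and the scalar of $[xy]_\nu$ cancels
against the one in `barS`. -/
theorem P_mul_coord_barS (M N : Xi m n d) : (deltaLab M).P * coord N (barS (eElt M)) =
    if colComp N = colComp M ∧ rowComp N = rowComp M then
      barA (deltaLab M).barScalar * (Lab.of (rowComp M)).barScalar *
        ∑ u, coef (barH d (Tw (gOf M))) u *
          coef ((Lab.of (rowComp M)).Z * Tw u * (Lab.of (colComp M)).Z) (gOf N) else 0 := by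
  classical
  rw [coord_apply, entry_barS, entry_eElt]
  split_ifs with h
  · obtain ⟨h1, -⟩ := h
    rw [h1]
    have h3 := congrArg (barH d) (Lab.P_smul_dbl (gOf_dMin M).1 (gOf_compat M))
    rw [barH_smul, map_mul, map_mul, Lab.barH_Z, Lab.barH_Z, smul_mul_assoc, smul_mul_assoc,
      mul_smul_comm] at h3
    have h4 : barA ((deltaLab M).P) = _ := (deltaLab M).barA_P
    unfold deltaLab at h4
    rw [h4] at h3
    have h5 := congrArg (fun z => barA (deltaLab M).barScalar •
      barA (Lab.of (colComp M)).barScalar • z) h3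
    have h6 : (deltaLab M).P • barA (Lab.of (colComp M)).barScalar •
        barH d ((Lab.of (colComp M)).dbl (Lab.of (rowComp M)) (gOf M) (gOf_dMin M).2) =
        (barA (deltaLab M).barScalar * (Lab.of (rowComp M)).barScalar) •
          ((Lab.of (rowComp M)).Z * barH d (Tw (gOf M)) * (Lab.of (colComp M)).Z) := by
      calc _ = barA (deltaLab M).barScalar • barA (Lab.of (colComp M)).barScalar •
            ((deltaLab M).barScalar * (deltaLab M).P) •
            barH d ((Lab.of (colComp M)).dbl (Lab.of (rowComp M)) (gOf M) (gOf_dMin M).2) := by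
              simp only [smul_smul]
              congr 1
              linear_combination - (barA (Lab.of (colComp M)).barScalar * (deltaLab M).P) *
                (deltaLab M).barA_barScalar
        _ = _ := h5
        _ = _ := by
              simp only [smul_smul]
              congr 1
              linear_combination (barA (deltaLab M).barScalar * (Lab.of (rowComp M)).barScalar) *
                (Lab.of (colComp M)).barA_barScalar
    have h7 := congrFun (congrArg coef h6) (gOf N)
    rw [map_smul, Pi.smul_apply, smul_eq_mul] at h7
    rw [h7, map_smul, Pi.smul_apply, smul_eq_mul]
    congr 1
    conv_lhs => rw [sum_coef (barH d (Tw (gOf M)))]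
    rw [Finset.mul_sum, Finset.sum_mul, map_sum, Finset.sum_apply]
    refine Finset.sum_congr rfl fun u _ => ?_
    rw [mul_smul_comm, smul_mul_assoc, map_smul, Pi.smul_apply, smul_eq_mul]
  · rw [map_zero, smul_zero, map_zero, Pi.zero_apply, mul_zero]

theorem algLE_of_coord_barS_ne_zero {M N : Xi m n d} (h : coord N (barS (eElt M)) ≠ 0) :
    algLE N M := by
  have h1 := P_mul_coord_barS M N
  have h2 := mul_ne_zero (deltaLab M).P_ne_zero h
  rw [h1] at h2
  split_ifs at h2 with hc
  · obtain ⟨u, -, hu⟩ := Finset.exists_ne_zero_of_sum_ne_zero (right_ne_zero_of_mul h2)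
    have hr := rankLE_of_coef_ne_zero _ u (left_ne_zero_of_mul hu)
    have hk := kap_eq_of_coef_ne_zero (right_ne_zero_of_mul hu)
    rw [← hc.1, ← hc.2, kap_gOf] at hk
    refine ⟨congrArg Subtype.val hc.2, congrArg Subtype.val hc.1, fun i j _ => ?_⟩
    rw [hk, ← kap_gOf M, hc.1, hc.2]
    exact sigma_kap_le hr _ _ i j
  · exact absurd rfl h2

/-- Only `u = gOf M` contributes: every other `u` with this matrix is at least as long as `gOf M`,
and there the conjugate of `Tw (gOf M)` has coefficient 0. -/
theorem coord_barS_self (M : Xi m n d) : coord M (barS (eElt M)) =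
    barA (deltaLab M).barScalar * (Lab.of (rowComp M)).barScalar * qInv ^ len (gOf M) := by
  apply mul_left_cancel₀ (deltaLab M).P_ne_zero
  rw [P_mul_coord_barS, if_pos ⟨rfl, rfl⟩, Finset.sum_eq_single (gOf M)]
  · rw [(coef_barH_Tw _).2, ← Lab.P_smul_dbl (gOf_dMin M).1 (gOf_compat M), map_smul, Pi.smul_apply,
      Lab.coef_dbl (gOf_dMin M).1 (gOf_dMin M), if_pos rfl, smul_eq_mul]
    unfold deltaLab
    ring
  · intro u _ hu
    by_contra h
    have hk := kap_eq_of_coef_ne_zero (right_ne_zero_of_mul h)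
    exact left_ne_zero_of_mul h ((coef_barH_Tw _).1 u (len_le_of_kap (gOf_dMin M) hk.symm) hu)
  · intro hh; exact absurd (Finset.mem_univ _) hh

end BarSchur

/-! ## Lengths in terms of matrices -/

section Lengths

variable {m n d : ℕ}

theorem Xi.odd_zero (M : Xi m n d) : M.1 0 0 = 2 * nat M.1 0 0 + 1 := by
  have h4 := sum_even_fun (fun j => M.1 0 j) (fun x => by
    have := M.2.2.1 0 (-x); rwa [sint_neg_zero, sint_neg_neg] at this)
  have hr : ∀ i, ∑ j, M.1 (-i) j = ∑ j, M.1 i j := by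
    intro i
    rw [← Equiv.sum_comp (negEquiv (m + n))]
    refine Finset.sum_congr rfl fun j _ => ?_
    rw [negEquiv_apply, ← M.2.2.1]
  have h3 := sum_even_fun (fun i => ∑ j, M.1 i j) hr
  rw [M.2.1] at h3
  unfold nat
  rw [if_pos ⟨rfl, rfl⟩]
  omega

theorem sum_neg_neg (h : SInt (m + n) → SInt (m + n) → ℤ) :
    ∑ i, ∑ j, h (-i) (-j) = ∑ i, ∑ j, h i j := by
  rw [← Equiv.sum_comp (negEquiv (m + n)) (fun i => ∑ j, h i j)]
  refine Finset.sum_congr rfl fun i _ => ?_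
  rw [← Equiv.sum_comp (negEquiv (m + n)) (fun j => h _ j)]
  rfl

open Classical in
/-- Sums over all cells in terms of sums over the cells in `I_c`. -/
theorem sum_eq_sum_inIc (M : Xi m n d) (Ψ : SInt (m + n) → SInt (m + n) → ℤ)
    (hΨ : ∀ i j, Ψ (-i) (-j) = Ψ i j) :
    ∑ i, ∑ j, M.1 i j * Ψ i j =
      2 * (∑ i, ∑ j, if InIc i j then nat M.1 i j * Ψ i j else 0) + Ψ 0 0 := by
  have h0 : Ψ 0 0 = ∑ i, ∑ j, if i = 0 then (if j = 0 then Ψ i j else 0) else 0 := by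
    rw [Finset.sum_eq_single 0 (fun i _ hi => by simp [hi]) (by simp)]
    simp
  -- $I_c$ and its negative cover all cells and overlap only in $(0,0)$, where
  -- $a_{00}=2a^\natural_{00}+1$ accounts for the extra summand.
  have h1 : (∑ i, ∑ j, if InIc (-i) (-j) then nat M.1 i j * Ψ i j else 0) =
      ∑ i, ∑ j, if InIc i j then nat M.1 i j * Ψ i j else 0 := by
    rw [← sum_neg_neg]
    refine Finset.sum_congr rfl fun i _ => Finset.sum_congr rfl fun j _ => ?_
    rw [sint_neg_neg, sint_neg_neg, hΨ]
    have : nat M.1 (-i) (-j) = nat M.1 i j := by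
      unfold nat
      rw [← M.2.2.1]
      have e : ∀ x : SInt (m + n), -x = 0 ↔ x = 0 := fun x => by
        rw [← sint_neg_inj, sint_neg_neg, sint_neg_zero]
      simp only [e]
    rw [this]
  rw [show ∀ z : ℤ, 2 * z = z + z from two_mul]
  nth_rw 2 [← h1]
  rw [h0]
  simp only [← Finset.sum_add_distrib]
  refine Finset.sum_congr rfl fun i _ => Finset.sum_congr rfl fun j _ => ?_
  unfold InIc
  rw [coe_neg, coe_neg]
  by_cases hi : i = 0
  · subst hi
    by_cases hj : j = 0
    · subst hj
      have := M.odd_zero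
      have e : ((M.1 0 0 : ℕ) : ℤ) = 2 * (nat M.1 0 0 : ℤ) + 1 := by rw [this]; push_cast; rfl
      rw [e]
      simp [coe_zero]
      ring
    · have hj' : j.1 ≠ 0 := fun h => hj (Subtype.ext h)
      have hn : nat M.1 0 j = M.1 0 j := by unfold nat; rw [if_neg fun h => hj h.2]
      rw [hn]
      rcases lt_or_gt_of_ne hj' with h | h
      · simp [coe_zero, hj, h.not_ge, h.le]
      · simp [coe_zero, hj, h.not_ge, h.le]
  · have hi' : i.1 ≠ 0 := fun h => hi (Subtype.ext h)
    have hn : nat M.1 i j = M.1 i j := by unfold nat; rw [if_neg fun h => hi h.1]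
    rw [hn]
    rcases lt_or_gt_of_ne hi' with h | h
    · simp [hi, hi', h, h.not_gt]
    · simp [hi, hi', h, h.not_gt]

theorem sum_cell (M : Xi m n d) (h : SInt (m + n) → SInt (m + n) → ℤ) :
    ∑ x, h (lbl (rowComp M) ((gOf M).1 x)) (lbl (colComp M) x) = ∑ i, ∑ j, M.1 i j * h i j := by
  have h1 : ∀ i j, (M.1 i j : ℤ) * h i j = ∑ x, if lbl (rowComp M) ((gOf M).1 x) = i then
      (if lbl (colComp M) x = j then h i j else 0) else 0 := by
    intro i j
    rw [← kap_gOf M, kap_eq_lbl, Finset.card_filter, Nat.cast_sum, Finset.sum_mul]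
    refine Finset.sum_congr rfl fun x _ => ?_
    by_cases h2 : lbl (rowComp M) ((gOf M).1 x) = i <;> by_cases h3 : lbl (colComp M) x = j <;>
      simp [h2, h3]
  simp only [h1, Finset.sum_comm (t := (Finset.univ : Finset (SInt d)))]
  simp

-- By `hK0` the omitted pairs $y=-x$ contribute as much as pairing all points with the central cell.
-- That is exactly the extra term of `sum_eq_sum_inIc`, so only the sum over $I_c$ remains.
open Classical in
theorem sum_pair_cell (M : Xi m n d)
    (K : SInt (m + n) → SInt (m + n) → SInt (m + n) → SInt (m + n) → ℤ)
    (hK : ∀ i j k l, K (-i) (-j) (-k) (-l) = K i j k l)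
    (hK0 : ∀ k l, K 0 0 k l = K k l (-k) (-l)) :
    (∑ x, ∑ y, if x ≠ -y then K (lbl (rowComp M) ((gOf M).1 x)) (lbl (colComp M) x)
      (lbl (rowComp M) ((gOf M).1 y)) (lbl (colComp M) y) else 0) =
    2 * ∑ i, ∑ j, ∑ k, ∑ l, if InIc i j then nat M.1 i j * (M.1 k l * K i j k l) else 0 := by
  have h1 : (∑ x, ∑ y, if x ≠ -y then K (lbl (rowComp M) ((gOf M).1 x)) (lbl (colComp M) x)
      (lbl (rowComp M) ((gOf M).1 y)) (lbl (colComp M) y) else 0) =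
      (∑ x, ∑ y, K (lbl (rowComp M) ((gOf M).1 x)) (lbl (colComp M) x)
      (lbl (rowComp M) ((gOf M).1 y)) (lbl (colComp M) y)) -
      ∑ x, K 0 0 (lbl (rowComp M) ((gOf M).1 x)) (lbl (colComp M) x) := by
    rw [← Finset.sum_sub_distrib]
    refine Finset.sum_congr rfl fun x _ => ?_
    rw [hK0, eq_sub_iff_add_eq]
    have h2 : K (lbl (rowComp M) ((gOf M).1 x)) (lbl (colComp M) x)
        (-lbl (rowComp M) ((gOf M).1 x)) (-lbl (colComp M) x) =
        ∑ y, if y = -x then K (lbl (rowComp M) ((gOf M).1 x)) (lbl (colComp M) x)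
      (lbl (rowComp M) ((gOf M).1 y)) (lbl (colComp M) y) else 0 := by
      rw [Finset.sum_ite_eq' Finset.univ (-x), if_pos (Finset.mem_univ _), W_neg, lbl_neg, lbl_neg]
    rw [h2, ← Finset.sum_add_distrib]
    refine Finset.sum_congr rfl fun y _ => ?_
    have e : x = -y ↔ y = -x := by simp only [Subtype.ext_iff, coe_neg]; omega
    by_cases hy : y = -x
    · rw [if_neg (fun h => h (e.2 hy)), if_pos hy, zero_add]
    · rw [if_pos (fun h => hy (e.1 h)), if_neg hy, add_zero]
  let Ψ : SInt (m + n) → SInt (m + n) → ℤ := fun i j => ∑ k, ∑ l, M.1 k l * K i j k l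
  have h3 : ∀ i j, ∑ y, K i j (lbl (rowComp M) ((gOf M).1 y)) (lbl (colComp M) y) = Ψ i j :=
    fun i j => sum_cell M (K i j)
  have h4 : ∀ i j, Ψ (-i) (-j) = Ψ i j := by
    intro i j
    dsimp only [Ψ]
    rw [← sum_neg_neg]
    simp only [hK, ← M.2.2.1]
  rw [h1]
  simp only [h3]
  rw [sum_cell M Ψ, sum_eq_sum_inIc M Ψ h4, add_sub_cancel_right]
  congr 1
  refine Finset.sum_congr rfl fun i _ => Finset.sum_congr rfl fun j _ => ?_
  by_cases h : InIc i j
  · simp only [if_pos h, Ψ, Finset.mul_sum]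
  · simp only [if_neg h, Finset.sum_const_zero]

/-- The length of the minimal double coset representative. -/
theorem ell_eq (M : Xi m n d) : ell M.1 = len (gOf M) := by
  classical
  let K : SInt (m + n) → SInt (m + n) → SInt (m + n) → SInt (m + n) → ℤ := fun i j k l =>
    if (k < i ∧ j < l) ∨ (i < k ∧ l < j) then 1 else 0
  have hneg : ∀ u v : SInt (m + n), -u < -v ↔ v < u := fun u v => sint_neg_lt
  have h1 := sum_pair_cell M K (fun i j k l => by
    dsimp only [K]
    simp only [hneg]
    congr 1
    apply propext
    tauto) (fun k l => by
    dsimp only [K]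
    congr 1
    apply propext
    simp only [← Subtype.coe_lt_coe, coe_neg, coe_zero]
    omega)
  have h2 : (∑ x, ∑ y, if x ≠ -y then K (lbl (rowComp M) ((gOf M).1 x)) (lbl (colComp M) x)
      (lbl (rowComp M) ((gOf M).1 y)) (lbl (colComp M) y) else 0) =
      2 * invSum (fun _ _ => 1) (gOf M) := by
    obtain ⟨ha, hb⟩ := gOf_dMin M
    set g := gOf M
    have hlt : ∀ x y, x < y → g.1 y < g.1 x → lbl (colComp M) x < lbl (colComp M) y := by
      intro x y hxy hg
      refine lt_of_le_of_ne (lbl_mono _ hxy.le) fun he => ?_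
      exact absurd (hb x y hxy (congrArg Subtype.val he)) hg.not_gt
    have hlt' : ∀ x y, x < y → g.1 y < g.1 x →
        lbl (rowComp M) (g.1 y) < lbl (rowComp M) (g.1 x) := by
      intro x y hxy hg
      refine lt_of_le_of_ne (lbl_mono _ hg.le) fun he => ?_
      have := ha _ _ hg (congrArg Subtype.val he)
      rw [W_inv_apply_self, W_inv_apply_self] at this
      exact absurd this hxy.not_gt
    -- By minimality of `g` on both sides an inverted pair lies in different row blocks and in
    -- different column blocks, so inversions can be read off the cells.
    have hiff : ∀ x y, (x < y ∧ g.1 y < g.1 x) ↔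
        (lbl (rowComp M) (g.1 y) < lbl (rowComp M) (g.1 x) ∧
          lbl (colComp M) x < lbl (colComp M) y) := by
      intro x y
      refine ⟨fun h => ⟨hlt' x y h.1 h.2, hlt x y h.1 h.2⟩, fun h => ⟨?_, ?_⟩⟩
      · by_contra hh
        exact absurd h.2 (lbl_mono _ (not_lt.1 hh)).not_gt
      · by_contra hh
        exact absurd h.1 (lbl_mono _ (not_lt.1 hh)).not_gt
    have h3 : invSum (fun _ _ => 1) g = ∑ x, ∑ y, if y < x ∧ x ≠ -y ∧ g.1 x < g.1 y then 1 else 0 := by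
      unfold invSum
      rw [Finset.sum_comm]
      refine Finset.sum_congr rfl fun x _ => Finset.sum_congr rfl fun y _ => ?_
      congr 1
      apply propext
      have : y ≠ -x ↔ x ≠ -y := by
        rw [ne_eq, ne_eq, not_iff_not]
        simp only [Subtype.ext_iff, coe_neg]; omega
      rw [this]
    rw [two_mul]
    nth_rw 2 [h3]
    unfold invSum
    simp only [← Finset.sum_add_distrib]
    refine Finset.sum_congr rfl fun x _ => Finset.sum_congr rfl fun y _ => ?_
    dsimp only [K]
    simp only [← hiff]
    by_cases c0 : x = -y
    · simp [c0]
    · by_cases c1 : x < y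
      · simp [c0, c1, c1.not_gt]
      · simp [c0, c1]
  rw [h2, ← two_len] at h1
  have h6 : ((∑ i, ∑ j, ∑ k, ∑ l, if InIc i j ∧ ((k < i ∧ j < l) ∨ (i < k ∧ l < j))
    then nat M.1 i j * M.1 k l else 0 : ℕ) : ℤ) =
      ∑ i, ∑ j, ∑ k, ∑ l, if InIc i j then nat M.1 i j * (M.1 k l * K i j k l) else 0 := by
    simp only [Nat.cast_sum]
    refine Finset.sum_congr rfl fun i _ => Finset.sum_congr rfl fun j _ =>
      Finset.sum_congr rfl fun k _ => Finset.sum_congr rfl fun l _ => ?_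
    dsimp only [K]
    by_cases c1 : InIc i j <;> by_cases c2 : (k < i ∧ j < l) ∨ (i < k ∧ l < j) <;> simp [c1, c2]
  rw [← h6] at h1
  unfold ell
  omega

/-- With row signs, pairs in one row but different columns are the pairs in a block of $W_\mu$ minus
those in a single cell. The latter are counted by `deltaLab` with column signs, which agree with the
row signs by compatibility. -/
theorem ellCirc_eq (M : Xi m n d) :
    4 * ellCirc M.1 = (Lab.of (rowComp M)).sgnSum - (deltaLab M).sgnSum := by
  classical
  let K : SInt (m + n) → SInt (m + n) → SInt (m + n) → SInt (m + n) → ℤ := fun i j k l =>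
    if i = k ∧ l ≠ j then (-1) ^ par i else 0
  have hpar : ∀ i : SInt (m + n), par (-i) = par i := by
    intro i
    unfold par
    rw [coe_neg, Int.natAbs_neg]
  have h1 := sum_pair_cell M K (fun i j k l => by
    dsimp only [K]
    simp only [hpar, sint_neg_inj, ne_eq]) (fun k l => by
    dsimp only [K]
    simp only [ne_eq, Subtype.ext_iff, coe_neg, coe_zero]
    by_cases hk : k.1 = 0
    · have : k = 0 := Subtype.ext hk
      subst this
      congr 1
      apply propext
      rw [coe_zero]; omega
    · rw [if_neg (by omega), if_neg (by omega)])
  set g := gOf M with hg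
  have hodd : ∀ x, (if (Lab.of (rowComp M)).odd x then (-1 : ℤ) else 1) =
      (-1) ^ par (lbl (rowComp M) x) := by
    intro x
    rw [Lab.of_odd, ← coe_lbl]
    unfold par
    split_ifs <;> omega
  have h2 : (Lab.of (rowComp M)).sgnSum = ∑ x, ∑ y, if x ≠ y ∧ x ≠ -y ∧
      lbl (rowComp M) (g.1 x) = lbl (rowComp M) (g.1 y) then
        (-1) ^ par (lbl (rowComp M) (g.1 x)) else 0 := by
    unfold Lab.sgnSum
    rw [← Equiv.sum_comp g.1]
    refine Finset.sum_congr rfl fun x _ => ?_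
    rw [← Equiv.sum_comp g.1]
    refine Finset.sum_congr rfl fun y _ => ?_
    simp only [hodd, ne_eq, ← W_neg, W_inj]
    simp only [Subtype.ext_iff, coe_lbl]
  have h3 : (deltaLab M).sgnSum = ∑ x, ∑ y, if x ≠ y ∧ x ≠ -y ∧
      lbl (rowComp M) (g.1 x) = lbl (rowComp M) (g.1 y) ∧ lbl (colComp M) x = lbl (colComp M) y then
        (-1) ^ par (lbl (rowComp M) (g.1 x)) else 0 := by
    unfold Lab.sgnSum
    refine Finset.sum_congr rfl fun x _ => Finset.sum_congr rfl fun y _ => ?_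
    have e : (deltaLab M).f x = (deltaLab M).f y ↔
        lbl (rowComp M) (g.1 x) = lbl (rowComp M) (g.1 y) ∧
          lbl (colComp M) x = lbl (colComp M) y := by
      simp only [Subtype.ext_iff (a1 := lbl _ _), coe_lbl]
      rw [and_comm]
      exact Lab.meet_eq_iff
    by_cases hc : x ≠ y ∧ x ≠ -y ∧ (deltaLab M).f x = (deltaLab M).f y
    · have hc' := hc
      rw [e] at hc'
      rw [if_pos hc, if_pos hc', ← hodd]
      have h4 := Lab.compat_iff.1 (gOf_compat M) x y hc.1 (congrArg Subtype.val hc'.2.2.2)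
        (congrArg Subtype.val hc'.2.2.1)
      congr 1
      exact propext h4
    · rw [if_neg hc, if_neg (by rwa [e] at hc)]
  have h5 : (∑ x, ∑ y, if x ≠ -y then K (lbl (rowComp M) (g.1 x)) (lbl (colComp M) x)
      (lbl (rowComp M) (g.1 y)) (lbl (colComp M) y) else 0) =
      (Lab.of (rowComp M)).sgnSum - (deltaLab M).sgnSum := by
    rw [h2, h3]
    simp only [← Finset.sum_sub_distrib]
    refine Finset.sum_congr rfl fun x _ => Finset.sum_congr rfl fun y _ => ?_
    dsimp only [K]
    by_cases c0 : x = y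
    · subst c0; simp
    · by_cases c1 : x = -y
      · simp [c1]
      · by_cases c2 : lbl (rowComp M) (g.1 x) = lbl (rowComp M) (g.1 y)
        · by_cases c3 : lbl (colComp M) x = lbl (colComp M) y
          · simp [c0, c1, c2, c3]
          · simp [c0, c1, c2, c3, Ne.symm c3]
        · simp [c2]
  rw [h5] at h1
  have h6 : (∑ i, ∑ j, ∑ l, if InIc i j ∧ l ≠ j
    then (-1 : ℤ) ^ par i * ((nat M.1 i j : ℤ) * (M.1 i l : ℤ)) else 0) =
      ∑ i, ∑ j, ∑ k, ∑ l, if InIc i j then nat M.1 i j * (M.1 k l * K i j k l) else 0 := by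
    refine Finset.sum_congr rfl fun i _ => Finset.sum_congr rfl fun j _ => ?_
    symm
    rw [Finset.sum_eq_single i]
    · refine Finset.sum_congr rfl fun l _ => ?_
      dsimp only [K]
      by_cases c1 : InIc i j <;> by_cases c2 : l = j <;> simp [c1, c2]
      ring
    · intro k _ hk
      refine Finset.sum_eq_zero fun l _ => ?_
      dsimp only [K]
      simp [hk.symm]
    · intro hh; exact absurd (Finset.mem_univ _) hh
  rw [← h6] at h1
  have h7 := (Lab.of (rowComp M)).four_dvd_sgnSum
  have h8 := (deltaLab M).four_dvd_sgnSum
  unfold ellCirc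
  omega

theorem coord_barS_eq (M : Xi m n d) :
    coord M (barS (eElt M)) = vpow (-(2 * ellHat M.1)) := by
  have h1 := ell_eq M
  have h2 := ellCirc_eq M
  have h7 := (Lab.of (rowComp M)).four_dvd_sgnSum
  have h8 := (deltaLab M).four_dvd_sgnSum
  rw [coord_barS_self, Lab.barScalar, Lab.barScalar, barA_vpow, qInv, vpow_pow, ← vpow_add,
    ← vpow_add]
  congr 1
  unfold ellHat
  omega

end Lengths

/-! ## Canonical bases -/

theorem coeff_barA (p : A) (k : ℤ) : (barA p).coeff k = p.coeff (-k) :=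
  LaurentPolynomial.invert_apply p k

theorem zero_mem_negPart : (0 : A) ∈ negPart := fun _ _ => rfl

theorem sub_mem_negPart {p p' : A} (h : p ∈ negPart) (h' : p' ∈ negPart) : p - p' ∈ negPart := by
  intro k hk
  rw [AddMonoidAlgebra.coeff_sub, Finsupp.sub_apply, h k hk, h' k hk, sub_zero]

theorem add_mem_negPart {p p' : A} (h : p ∈ negPart) (h' : p' ∈ negPart) : p + p' ∈ negPart := by
  intro k hk
  rw [AddMonoidAlgebra.coeff_add, Finsupp.add_apply, h k hk, h' k hk, add_zero]

theorem eq_zero_of_mem_negPart {p : A} (h : p ∈ negPart) (hp : barA p = p) : p = 0 := by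
  apply LaurentPolynomial.ext
  intro k
  rcases le_or_gt 0 k with hk | hk
  · exact h k hk
  · rw [← hp, coeff_barA]
    exact h (-k) (by omega)

/-- An anti-invariant Laurent polynomial has no constant term and is determined by its part in
negative degrees, which is `c`. -/
theorem exists_mem_negPart {p : A} (hp : barA p = -p) : ∃ c ∈ negPart, c - barA c = p := by
  classical
  let c : A := AddMonoidAlgebra.ofCoeff (p.coeff.filter fun k => k < 0)
  have hc : ∀ k, c.coeff k = if k < 0 then p.coeff k else 0 := fun k => Finsupp.filter_apply _ _ _
  refine ⟨c, fun k hk => by rw [hc, if_neg (not_lt.2 hk)], ?_⟩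
  apply LaurentPolynomial.ext
  intro k
  have h1 : p.coeff (-k) = -p.coeff k := by
    rw [← coeff_barA, hp, AddMonoidAlgebra.coeff_neg, Finsupp.neg_apply]
  rw [AddMonoidAlgebra.coeff_sub, Finsupp.sub_apply, coeff_barA, hc, hc, h1]
  rcases lt_trichotomy k 0 with hk | hk | hk
  · rw [if_pos hk, if_neg (by omega), sub_zero]
  · subst hk
    rw [neg_zero] at h1
    rw [if_neg (by omega), if_neg (by omega)]
    omega
  · rw [if_neg (by omega), if_pos (by omega), zero_sub, neg_neg]

section Canonical

variable {ι V : Type*} [Finite ι] [AddCommGroup V] [Module A V] {lt : ι → ι → Prop}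
  {φ : Module.Basis ι A V} {bar : V →+ V}

theorem repr_bar_of_maximal (hsmul : ∀ (a : A) x, bar (a • x) = barA a • bar x)
    (htri : ∀ j, φ.repr (bar (φ j)) j = 1 ∧ ∀ k, k ≠ j → ¬ lt k j → φ.repr (bar (φ j)) k = 0)
    {x : V} {j : ι} (hx : ∀ k, lt j k → φ.repr x k = 0) :
    φ.repr (bar x) j = barA (φ.repr x j) := by
  have := Fintype.ofFinite ι
  conv_lhs => rw [← φ.sum_repr x]
  rw [map_sum, map_sum, Finsupp.finsetSum_apply, Finset.sum_eq_single j]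
  · rw [hsmul, map_smul, Finsupp.smul_apply, (htri j).1, smul_eq_mul, mul_one]
  · intro k _ hk
    rw [hsmul, map_smul, Finsupp.smul_apply, smul_eq_mul]
    by_cases h : lt j k
    · rw [hx k h, map_zero, zero_mul]
    · rw [(htri k).2 j hk.symm h, mul_zero]
  · intro hh; exact absurd (Finset.mem_univ _) hh

variable [IsStrictOrder ι lt]

theorem exists_maximal_coord {x : V} (hx : x ≠ 0) :
    ∃ j, φ.repr x j ≠ 0 ∧ ∀ k, lt j k → φ.repr x k = 0 := by
  have hne : ∃ j, φ.repr x j ≠ 0 := by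
    by_contra h
    push Not at h
    exact hx (φ.repr.map_eq_zero_iff.1 (Finsupp.ext h))
  have hwf : WellFounded (Function.swap lt) := Finite.wellFounded_of_trans_of_irrefl _
  refine ⟨hwf.min {j | φ.repr x j ≠ 0} hne, hwf.min_mem _ hne, fun k hk => ?_⟩
  by_contra h
  exact hwf.not_lt_min {j | φ.repr x j ≠ 0} h hk

/-- A maximal nonzero coordinate is bar invariant by unitriangularity, and no nonzero element of
$v^{-1}\mathbb Z[v^{-1}]$ is. -/
theorem eq_zero_of_bar_eq (hsmul : ∀ (a : A) x, bar (a • x) = barA a • bar x)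
    (htri : ∀ j, φ.repr (bar (φ j)) j = 1 ∧ ∀ k, k ≠ j → ¬ lt k j → φ.repr (bar (φ j)) k = 0)
    {x : V} (hx : bar x = x) (hn : ∀ j, φ.repr x j ∈ negPart) : x = 0 := by
  by_contra h
  obtain ⟨j, hj, hm⟩ := exists_maximal_coord (φ := φ) (lt := lt) h
  have h1 := repr_bar_of_maximal hsmul htri hm
  rw [hx] at h1
  exact hj (eq_zero_of_mem_negPart (hn j) h1.symm)

/-- The coordinate of `y` at a maximal element of the lower set `L` is anti-invariant, hence $c-\bar
c$. Subtracting $c\varphi_j-\overline{c\varphi_j}$ leaves an anti-invariant vector supported on `L`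
without `j`. -/
theorem exists_sub_bar (hsmul : ∀ (a : A) x, bar (a • x) = barA a • bar x)
    (hinv : ∀ x, bar (bar x) = x)
    (htri : ∀ j, φ.repr (bar (φ j)) j = 1 ∧ ∀ k, k ≠ j → ¬ lt k j → φ.repr (bar (φ j)) k = 0)
    (L : Finset ι) (hL : ∀ j ∈ L, ∀ k, lt k j → k ∈ L) {y : V} (hy : bar y = -y)
    (hs : ∀ j, j ∉ L → φ.repr y j = 0) :
    ∃ z, (∀ j, φ.repr z j ∈ negPart) ∧ (∀ j, j ∉ L → φ.repr z j = 0) ∧ z - bar z = y := by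
  classical
  induction L using Finset.strongInduction generalizing y with
  | H L ih =>
    by_cases hy0 : y = 0
    · exact ⟨0, fun j => by rw [map_zero]; exact zero_mem_negPart,
        fun j _ => by rw [map_zero]; rfl, by rw [map_zero, sub_zero, hy0]⟩
    have hLne : ∃ j, j ∈ L := by
      obtain ⟨j, hj, -⟩ := exists_maximal_coord (φ := φ) (lt := lt) hy0
      exact ⟨j, by by_contra h; exact hj (hs j h)⟩
    have hwf : WellFounded (Function.swap lt) := Finite.wellFounded_of_trans_of_irrefl _
    obtain ⟨j, hj, hm⟩ : ∃ j ∈ L, ∀ k ∈ L, ¬ lt j k :=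
      ⟨hwf.min {j | j ∈ L} hLne, hwf.min_mem {j | j ∈ L} hLne,
        fun k hk h => hwf.not_lt_min {j | j ∈ L} hk h⟩
    have h1 : φ.repr (bar y) j = barA (φ.repr y j) :=
      repr_bar_of_maximal hsmul htri fun k hk => hs k fun hkL => hm k hkL hk
    rw [hy, map_neg, Finsupp.neg_apply] at h1
    obtain ⟨c, hc, hc'⟩ := exists_mem_negPart h1.symm
    obtain ⟨z, hz1, hz2, hz3⟩ := ih (L.erase j) (Finset.erase_ssubset hj)
      (fun i hi k hk => Finset.mem_erase.2 ⟨fun h => by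
        subst h
        exact hm i (Finset.mem_of_mem_erase hi) hk, hL i (Finset.mem_of_mem_erase hi) k hk⟩)
      (y := y - (c • φ j - bar (c • φ j))) (by
        rw [map_sub, map_sub, hinv, hy]; abel) (fun k hk => by
        rw [hsmul, map_sub, map_sub, map_smul, map_smul, Finsupp.sub_apply, Finsupp.sub_apply,
          Finsupp.smul_apply, Finsupp.smul_apply, φ.repr_self]
        by_cases hkj : k = j
        · subst hkj
          rw [(htri k).1, Finsupp.single_eq_same, smul_eq_mul, smul_eq_mul, mul_one, mul_one, hc',
            sub_self]
        · have hkL : k ∉ L := fun h => hk (Finset.mem_erase.2 ⟨hkj, h⟩)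
          rw [hs k hkL, (htri j).2 k hkj fun h => hkL (hL j hj k h),
            Finsupp.single_eq_of_ne hkj]
          simp)
    refine ⟨z + c • φ j, fun k => ?_, fun k hk => ?_, ?_⟩
    · rw [map_add, map_smul, Finsupp.add_apply, Finsupp.smul_apply, φ.repr_self]
      refine add_mem_negPart (hz1 k) ?_
      by_cases hkj : k = j
      · subst hkj
        rwa [Finsupp.single_eq_same, smul_eq_mul, mul_one]
      · rw [Finsupp.single_eq_of_ne hkj, smul_zero]
        exact zero_mem_negPart
    · have hkj : k ≠ j := fun h => hk (h ▸ hj)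
      rw [map_add, map_smul, Finsupp.add_apply, Finsupp.smul_apply, φ.repr_self,
        hz2 k fun h => hk (Finset.mem_of_mem_erase h), Finsupp.single_eq_of_ne hkj, smul_zero,
        add_zero]
    · rw [map_add, add_sub_add_comm, hz3, sub_add_cancel]

open Classical in
/-- Existence and uniqueness of the canonical basis for a unitriangular involution. -/
theorem existsUnique_canonical [Fintype ι] (hsmul : ∀ (a : A) x, bar (a • x) = barA a • bar x)
    (hinv : ∀ x, bar (bar x) = x)
    (htri : ∀ j, φ.repr (bar (φ j)) j = 1 ∧ ∀ k, k ≠ j → ¬ lt k j → φ.repr (bar (φ j)) k = 0) :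
    ∃! b : Module.Basis ι A V, ∀ i, bar (b i) = b i ∧
      ∃ c : ι → A, (∀ j, c j ∈ negPart) ∧ b i = φ i + ∑ j with lt j i, c j • φ j := by
  have hex : ∀ i, ∃ c : ι → A, (∀ j, c j ∈ negPart) ∧
      bar (φ i + ∑ j with lt j i, c j • φ j) = φ i + ∑ j with lt j i, c j • φ j := by
    intro i
    -- The defect $\bar\varphi_i-\varphi_i$ is anti-invariant and supported strictly below `i`;
    -- writing it as $z-\bar z$ makes $\varphi_i+z$ bar invariant.
    obtain ⟨z, h1, h2, h3⟩ := exists_sub_bar hsmul hinv htri (Finset.univ.filter fun j => lt j i)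
      (fun j hj k hk => Finset.mem_filter.2 ⟨Finset.mem_univ _,
        _root_.trans hk (Finset.mem_filter.1 hj).2⟩) (y := bar (φ i) - φ i)
      (by rw [map_sub, hinv, neg_sub]) (fun j hj => by
        have hj' : ¬ lt j i := fun h => hj (Finset.mem_filter.2 ⟨Finset.mem_univ _, h⟩)
        rw [map_sub, Finsupp.sub_apply, φ.repr_self]
        by_cases hji : j = i
        · subst hji; rw [(htri j).1, Finsupp.single_eq_same, sub_self]
        · rw [(htri i).2 j hji hj', Finsupp.single_eq_of_ne hji, sub_self])
    have hz : ∑ j with lt j i, φ.repr z j • φ j = z := by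
      conv_rhs => rw [← φ.sum_repr z]
      refine Finset.sum_subset (Finset.filter_subset _ _) fun j _ hj => ?_
      rw [h2 j hj, zero_smul]
    refine ⟨fun j => φ.repr z j, h1, ?_⟩
    rw [hz, map_add]
    have : bar (φ i) + bar z = φ i + z + ((bar (φ i) - φ i) - (z - bar z)) := by abel
    rw [this, h3, sub_self, add_zero]
  choose c hc hbar using hex
  let f : V →ₗ[A] V := φ.constr A fun i => φ i + ∑ j with lt j i, c i j • φ j
  have hf : ∀ i, f (φ i) = φ i + ∑ j with lt j i, c i j • φ j := fun i => φ.constr_basis A _ i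
  -- A unitriangular endomorphism is surjective by induction along the order, and a surjective
  -- endomorphism of a finite module is bijective.
  have hwf : WellFounded lt := Finite.wellFounded_of_trans_of_irrefl _
  have hrange : ∀ i, φ i ∈ LinearMap.range f := by
    intro i
    induction i using hwf.induction with
    | _ i ih =>
      have h1 : φ i = f (φ i) - ∑ j with lt j i, c i j • φ j := by rw [hf, add_sub_cancel_right]
      rw [h1]
      exact Submodule.sub_mem _ (LinearMap.mem_range_self f _) (Submodule.sum_mem _ fun j hj =>
        Submodule.smul_mem _ _ (ih j (Finset.mem_filter.1 hj).2))
  have hsurj : Function.Surjective f := by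
    rw [← LinearMap.range_eq_top, eq_top_iff, ← φ.span_eq, Submodule.span_le]
    rintro _ ⟨i, rfl⟩
    exact hrange i
  have hfin : Module.Finite A V := Module.Finite.of_basis φ
  have hbij := OrzechProperty.bijective_of_surjective_endomorphism f hsurj
  refine ⟨φ.map (LinearEquiv.ofBijective f hbij), fun i => ?_, fun b' hb' => ?_⟩
  · have e : φ.map (LinearEquiv.ofBijective f hbij) i = φ i + ∑ j with lt j i, c i j • φ j := by
      rw [Module.Basis.map_apply, LinearEquiv.ofBijective_apply, hf]
    rw [e]
    exact ⟨hbar i, c i, hc i, rfl⟩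
  · apply Module.Basis.eq_of_apply_eq
    intro i
    have e : φ.map (LinearEquiv.ofBijective f hbij) i = φ i + ∑ j with lt j i, c i j • φ j := by
      rw [Module.Basis.map_apply, LinearEquiv.ofBijective_apply, hf]
    obtain ⟨h1, c', hc', h2⟩ := hb' i
    rw [e, ← sub_eq_zero]
    apply eq_zero_of_bar_eq hsmul htri
    · rw [map_sub, h1, hbar]
    · intro k
      rw [h2, add_sub_add_left_eq_sub, ← Finset.sum_sub_distrib, map_sum, Finsupp.finsetSum_apply]
      simp only [← sub_smul, map_smul, φ.repr_self, Finsupp.smul_apply, Finsupp.single_apply,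
        smul_eq_mul, mul_ite, mul_one, mul_zero]
      rw [Finset.sum_ite_eq']
      split_ifs
      · exact sub_mem_negPart (hc' k) (hc i k)
      · exact zero_mem_negPart

end Canonical

/-! ## The canonical bases of the iota Schur superalgebra -/

section Order

variable {m n d : ℕ}

theorem sigma_eq_sum_product (M : Mat m n) (i j : SInt (m + n)) :
    sigma M i j = ∑ p ∈ (Finset.univ.filter (· ≤ i)) ×ˢ (Finset.univ.filter (j ≤ ·)), M p.1 p.2 := by
  unfold sigma
  rw [Finset.sum_product]

/-- $\sigma_{ij}$ is $a_{ij}$ plus entries farther from the diagonal on the same side, so the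
entries are recovered by induction from the corner inwards. -/
theorem eq_of_sigma_eq {M N : Mat m n} (h : ∀ i j, i < j → sigma M i j = sigma N i j)
    (i j : SInt (m + n)) (hij : i < j) : M i j = N i j := by
  have hlo := fun x : SInt (m + n) => Finset.mem_Icc.1 x.2
  induction hk : (i.1 - j.1 + 2 * (m + n)).toNat using Nat.strong_induction_on generalizing i j with
  | _ k ih =>
    have h1 := h i j hij
    rw [sigma_eq_sum_product, sigma_eq_sum_product] at h1
    have hmem : (i, j) ∈ (Finset.univ.filter (· ≤ i)) ×ˢ (Finset.univ.filter (j ≤ ·)) := by simp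
    rw [← Finset.add_sum_erase _ _ hmem, ← Finset.add_sum_erase _ _ hmem] at h1
    have h2 : ∀ p ∈ ((Finset.univ.filter (· ≤ i)) ×ˢ (Finset.univ.filter (j ≤ ·))).erase (i, j),
        M p.1 p.2 = N p.1 p.2 := by
      rintro ⟨x, y⟩ hp
      rw [Finset.mem_erase, Finset.mem_product, Finset.mem_filter, Finset.mem_filter] at hp
      obtain ⟨hne, ⟨-, hx⟩, -, hy⟩ := hp
      have hx' := Subtype.coe_le_coe.2 hx
      have hy' := Subtype.coe_le_coe.2 hy
      dsimp only at hx' hy'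
      have hne' : x.1 ≠ i.1 ∨ y.1 ≠ j.1 := by
        by_contra hh
        push Not at hh
        exact hne (Prod.ext (Subtype.ext hh.1) (Subtype.ext hh.2))
      have b1 := hlo x
      have b2 := hlo y
      have b3 := hlo i
      have b4 := hlo j
      push_cast at b1 b2 b3 b4
      exact ih _ (by omega) x y ((hx.trans_lt hij).trans_le hy) rfl
    rw [Finset.sum_congr rfl h2] at h1
    exact Nat.add_right_cancel h1

/-- The sums $\sigma_{ij}$ determine the entries above the diagonal, central symmetry those below
it, and the row sums the diagonal. -/
theorem algLE_antisymm {M N : Xi m n d} (h : algLE M N) (h' : algLE N M) : M = N := by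
  have hlt := eq_of_sigma_eq fun i j hij => le_antisymm (h.2.2 i j hij) (h'.2.2 i j hij)
  have hgt : ∀ i j, j < i → M.1 i j = N.1 i j := by
    intro i j hij
    rw [M.2.2.1, N.2.2.1]
    exact hlt _ _ (sint_neg_lt.2 hij)
  have hne : ∀ i j, j ≠ i → M.1 i j = N.1 i j := fun i j hij =>
    (lt_or_gt_of_ne hij).elim (hgt i j) (hlt i j)
  have hr : rowComp M = rowComp N := Subtype.ext h.1
  apply Subtype.ext
  funext i j
  by_cases hij : j = i
  · subst hij
    have h1 := row_sum_eq M j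
    rw [hr, ← row_sum_eq N j, ← Finset.add_sum_erase _ _ (Finset.mem_univ j),
      ← Finset.add_sum_erase _ (fun k => N.1 j k) (Finset.mem_univ j),
      Finset.sum_congr rfl fun k hk => hne j k (Finset.ne_of_mem_erase hk)] at h1
    exact Nat.add_right_cancel h1
  · exact hne i j hij

instance instIsStrictOrderAlgLT : IsStrictOrder (Xi m n d) algLT where
  irrefl _ h := h.2 rfl
  trans M N K h h' := by
    have hle : algLE M K := ⟨h.1.1.trans h'.1.1, h.1.2.1.trans h'.1.2.1,
      fun i j hij => (h.1.2.2 i j hij).trans (h'.1.2.2 i j hij)⟩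
    refine ⟨hle, ?_⟩
    rintro rfl
    exact h.2 (algLE_antisymm h.1 h'.1)

end Order

section Final

variable {m n d : ℕ}

/-- Arbitrary signs are allowed, which covers both standard bases at once: a sign occurs squared in
the diagonal coefficient and does not affect the support. -/
theorem existsUnique_isCanonical (k : Xi m n d → ℕ) :
    ∃! b : Module.Basis (Xi m n d) A (Schur m n d),
      IsCanonical (fun M => ((-1 : A) ^ k M) • phiElt M) b := by
  -- Negation is supplied by the scalar $-1$ on top of the existing addition, so the module
  -- structure in the statement is unchanged.
  let _ : AddCommGroup (Schur m n d) := Module.addCommMonoidToAddCommGroup A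
  let u : Xi m n d → Aˣ := fun M =>
    ⟨(-1) ^ k M * vpow (-ellHat M.1), (-1) ^ k M * vpow (ellHat M.1), by
      rw [mul_mul_mul_comm, ← mul_pow, vpow_neg_mul]; simp, by
      rw [mul_mul_mul_comm, ← mul_pow, mul_comm (vpow _), vpow_neg_mul]; simp⟩
  let φ : Module.Basis (Xi m n d) A (Schur m n d) := (eBasis m n d).unitsSMul u
  have hφ : ∀ M, φ M = ((-1 : A) ^ k M) • phiElt M := by
    intro M
    dsimp only [φ]
    rw [Module.Basis.unitsSMul_apply, eBasis_apply, phiElt, smul_smul]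
    rfl
  have hrepr : ∀ f N, φ.repr f N = (-1) ^ k N * vpow (ellHat N.1) * coord N f := by
    intro f N
    dsimp only [φ]
    rw [Module.Basis.repr_unitsSMul]
    rfl
  let bar : Schur m n d →+ Schur m n d := AddMonoidHom.mk' barS barS_add
  have htri : ∀ j, φ.repr (bar (φ j)) j = 1 ∧
      ∀ k, k ≠ j → ¬ algLT k j → φ.repr (bar (φ j)) k = 0 := by
    intro M
    have h1 : ∀ N, φ.repr (bar (φ M)) N = (-1) ^ k N * vpow (ellHat N.1) *
        ((-1) ^ k M * vpow (ellHat M.1) * coord N (barS (eElt M))) := by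
      intro N
      have h2 : bar (φ M) = barS (((-1 : A) ^ k M) • phiElt M) := by rw [← hφ]; rfl
      rw [hrepr, h2, phiElt, smul_smul, barS_smul, map_smul, smul_eq_mul, map_mul, map_pow, map_neg,
        map_one, barA_vpow, neg_neg]
    refine ⟨?_, fun N hne hlt => ?_⟩
    · rw [h1, coord_barS_eq]
      have e1 : ((-1 : A) ^ k M) * (-1) ^ k M = 1 := by rw [← mul_pow]; simp
      -- One factor $v^{\hat\ell}$ comes from conjugating the normalisation and one from passing to
      -- coordinates in the rescaled basis; together they cancel $v^{-2\hat\ell}$.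
      have e2 : vpow (ellHat M.1) * (vpow (ellHat M.1) * vpow (-(2 * ellHat M.1))) = 1 := by
        rw [← vpow_add, ← vpow_add, ← vpow_zero]
        congr 1
        ring
      linear_combination e1 + (-1) ^ k M * (-1) ^ k M * e2
    · rw [h1]
      have : coord N (barS (eElt M)) = 0 := by
        by_contra h
        exact hlt ⟨algLE_of_coord_barS_ne_zero h, hne⟩
      rw [this, mul_zero, mul_zero]
  have key := existsUnique_canonical (lt := algLT) (φ := φ) (bar := bar) barS_smul barS_barS htri
  simp only [hφ] at key
  exact key

theorem existsUnique_isCanonical_phiElt :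
    ∃! b : Module.Basis (Xi m n d) A (Schur m n d), IsCanonical phiElt b := by
  have h := existsUnique_isCanonical (fun _ : Xi m n d => 0)
  simp only [pow_zero, one_smul] at h
  exact h

end Final

end IotaSchur

end

theorem theorem4p13 (m n d : ℕ) (hd : 0 < d) :
    (∀ M : IotaSchur.Xi m n d, ∃! f : IotaSchur.Schur m n d, IotaSchur.IsE M f) ∧
    (∀ f : IotaSchur.Schur m n d, ∃! g : IotaSchur.Schur m n d, IotaSchur.IsBarOf f g) ∧
    (∃! b : Module.Basis (IotaSchur.Xi m n d) IotaSchur.A (IotaSchur.Schur m n d),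
      IotaSchur.IsCanonical IotaSchur.bracket b) ∧
    (∃! b : Module.Basis (IotaSchur.Xi m n d) IotaSchur.A (IotaSchur.Schur m n d),
      IotaSchur.IsCanonical IotaSchur.phiElt b) := by
  exact ⟨IotaSchur.existsUnique_isE, IotaSchur.existsUnique_isBarOf,
    IotaSchur.existsUnique_isCanonical fun M => IotaSchur.ell (IotaSchur.circ M.1),
    IotaSchur.existsUnique_isCanonical_phiElt⟩
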